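/- Let $c\in\{1,-1\}$, $m\ge 1$ and $n=2m-1$. Let $\mathbb{C}Q^m(4c)$ denote the complex projective space $\mathbb{C}P^m(4)$ (if $c=1$) or the complex hyperbolic space $\mathbb{C}H^m(-4)$ (if $c=-1$), of constant holomorphic sectional curvature $4c$, with complex structure $J$ and Levi-Civita connection $\overline\nabla$. Let $x:M^n\to\mathbb{C}Q^m(4c)$ be an isometric immersion of a smooth Riemannian $n$-manifold as a real hypersurface, whose mean curvature is not assumed to be constant, and let $\xi$ be a smooth unit normal vector field on an open set $O\subseteq M$. On $O$ let $A$ be the shape operator, $AX=-\overline\nabla_X\xi$; let $U=-J\xi$, let $SX=(JX)_T$ be the tangential component of $JX$, and let $f_k=\operatorname{tr}A^k$, $f=f_1=\operatorname{tr}A$. Let $\nabla$ be the Levi-Civita connection of $M$, $\nabla f$ the gradient of $f$, $\mathrm{Hess}_f(X,Y)=\langle\nabla_X(\nabla f),Y\rangle$, and $\Delta\varphi=-\operatorname{tr}\mathrm{Hess}_\varphi$ the Laplacian of a function $\varphi$. For a local smooth orthonormal frame $e_1,\dots,e_n$ of $TM$ on $O$, let $$\Delta A=\sum_{i=1}^n\bigl[\nabla_{\nabla_{e_i}e_i}A-\nabla_{e_i}(\nabla_{e_i}A)\bigr],\qquad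 \|\nabla A\|^2=\sum_{i,j}\langle(\nabla_{e_j}A)e_i,(\nabla_{e_j}A)e_i\rangle .$$ Then on $O$, for every smooth tangent vector field $X$, $$(\Delta A)X=3c\bigl[\langle AU-fU,X\rangle U+\langle U,X\rangle AU\bigr]-6c\,SASX+cfX+[f_2-c(n+3)]AX-fA^2X-\nabla_X(\nabla f),$$ and $$\tfrac12\Delta(\operatorname{tr}A^2)=6c\langle AU,AU\rangle-3cf\langle AU,U\rangle-6c\operatorname{tr}(SA)^2+cf^2+[f_2-c(n+3)]f_2-ff_3-\|\nabla A\|^2-\sum_{i=1}^n\mathrm{Hess}_f(Ae_i,e_i).$$ -/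

import Mathlib

open scoped Manifold ContDiff Bundle

attribute [local instance] Matrix.linftyOpNormedRing Matrix.linftyOpNormedAlgebra
attribute [-instance] instTopologicalSpaceMatrix Matrix.instUniformSpace

noncomputable section

namespace ComplexSpaceForm

/-! ### The complex space form `ℂQ^m(4c)`, `c = ±1`, and its embedding by projectors -/

/-- The Hermitian form `Ψ_c(z, w) = c z̄₀ w₀ + ∑_{j ≥ 1} z̄ⱼ wⱼ` on `ℂ^{m+1}`. -/
def hermForm (c : ℝ) {m : ℕ} (z w : Fin (m + 1) → ℂ) : ℂ :=
  c * (star (z 0) * w 0) + ∑ j : Fin m, star (z j.succ) * w j.succ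

/-- The quadric `N^{2m+1} = {z | Ψ_c(z, z) = c}`: the sphere if `c = 1`, the anti-de Sitter space
if `c = -1`. -/
def Quadric (c : ℝ) (m : ℕ) : Type := {z : Fin (m + 1) → ℂ // hermForm c z z = c}

/-- Two points of the quadric are equivalent if they lie on the same orbit of the circle group. -/
def circleOrbit (c : ℝ) (m : ℕ) : Setoid (Quadric c m) where
  r z w := ∃ u : ℂ, ‖u‖ = 1 ∧ w.1 = u • z.1
  iseqv :=
    { refl := fun z => ⟨1, by simp, by simp⟩
      symm := by
        rintro z w ⟨u, hu, h⟩
        have hu0 : u ≠ 0 := by rintro rfl; simp at hu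
        exact ⟨u⁻¹, by simp [hu], by rw [h, smul_smul, inv_mul_cancel₀ hu0, one_smul]⟩
      trans := by
        rintro z w y ⟨u, hu, h⟩ ⟨v, hv, k⟩
        exact ⟨v * u, by simp [hu, hv], by rw [k, h, smul_smul]⟩ }

/-- The complex space form `ℂQ^m(4c)`: the complex projective space `ℂP^m(4)` if `c = 1` and the
complex hyperbolic space `ℂH^m(-4)` if `c = -1`, as the orbit space of the circle action. -/
def CQ (c : ℝ) (m : ℕ) : Type := Quotient (circleOrbit c m)

/-- The complex `(m+1) × (m+1)` matrices, as a real normed space. -/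
abbrev Mat (m : ℕ) : Type := Matrix (Fin (m + 1)) (Fin (m + 1)) ℂ

/-- The sesquilinear map with `projMatrix c z z = Φ([z])`: the entries are `zᵢ w̄₀` in the
zeroth column and `c zᵢ w̄ⱼ` in the other columns. -/
def projMatrix (c : ℝ) {m : ℕ} (z w : Fin (m + 1) → ℂ) : Mat m :=
  Matrix.of fun i j => (if j = 0 then 1 else (c : ℂ)) * (z i * star (w j))

theorem projMatrix_smul (c : ℝ) {m : ℕ} (z : Fin (m + 1) → ℂ) {u : ℂ} (hu : ‖u‖ = 1) :
    projMatrix c (u • z) (u • z) = projMatrix c z z := by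
  have h : u * star u = 1 := by
    have := Complex.mul_conj u
    rw [Complex.normSq_eq_norm_sq, hu] at this
    simpa using this
  ext i j
  simp only [projMatrix, Matrix.of_apply, Pi.smul_apply, smul_eq_mul, star_mul']
  linear_combination (if j = 0 then 1 else (c : ℂ)) * (z i * star (z j)) * h

/-- The embedding `Φ` of `ℂQ^m(4c)`, sending a complex line to the projection operator onto it. -/
def embed {c : ℝ} {m : ℕ} (q : CQ c m) : Mat m :=
  Quotient.liftOn q (fun z => projMatrix c z.1 z.1) (by
    rintro z w ⟨u, hu, h⟩
    simp only [h, projMatrix_smul c z.1 hu])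

/-- The trace metric `⟨A, B⟩ = (c/2) tr (AB)`, which is real on `Ψ_c`-Hermitian matrices. -/
def traceForm (c : ℝ) {m : ℕ} : Mat m →ₗ[ℝ] Mat m →ₗ[ℝ] ℝ :=
  LinearMap.mk₂ ℝ (fun A B => c / 2 * (A * B).trace.re)
    (by intros; simp [add_mul, mul_add]) (by intros; simp; ring)
    (by intros; simp [mul_add]) (by intros; simp; ring)

/-- The horizontal lift description of the tangent vectors: `dΦ(z)(w)`. -/
def liftTangent (c : ℝ) {m : ℕ} (z w : Fin (m + 1) → ℂ) : Mat m :=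
  projMatrix c w z + projMatrix c z w

/-- `V` is (the image under `dΦ` of) a tangent vector of `ℂQ^m(4c)` at `q`: it is the image
`dΦ(z)(w)` of a horizontal vector `w` at a point `z` of the quadric over `q`. -/
def IsTangent {c : ℝ} {m : ℕ} (q : CQ c m) (V : Mat m) : Prop :=
  ∃ z : Quadric c m, Quotient.mk (circleOrbit c m) z = q ∧
    ∃ w : Fin (m + 1) → ℂ, hermForm c z.1 w = 0 ∧ V = liftTangent c z.1 w

/-- The complex structure `J` of `ℂQ^m(4c)` in the embedding `Φ`: `J V = i (V P - P V)` at
`P = Φ(q)`, that is `dΦ(z)(w) ↦ dΦ(z)(i w)` (see `complexJ_liftTangent`). -/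
def complexJ {c : ℝ} {m : ℕ} (q : CQ c m) : Mat m →ₗ[ℝ] Mat m where
  toFun V := Complex.I • (V * embed q - embed q * V)
  map_add' := by intros; rw [← smul_add]; congr 1; noncomm_ring
  map_smul' := by
    intros
    simp only [Matrix.smul_mul, Matrix.mul_smul, RingHom.id_apply]
    rw [← smul_sub, smul_comm]

/-- The orthogonal projection `W ↦ P W + W P - 2 P W P`, `P = Φ(q)`, of the (pseudo-)Euclidean
space of `Ψ_c`-Hermitian matrices onto the tangent space of `ℂQ^m(4c)` at `q`. -/
def tangentProj {c : ℝ} {m : ℕ} (q : CQ c m) : Mat m →ₗ[ℝ] Mat m where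
  toFun W := embed q * W + W * embed q - (2 : ℝ) • (embed q * W * embed q)
  map_add' := by intros; simp only [mul_add, add_mul, smul_add]; abel
  map_smul' := by
    intros
    simp only [Matrix.smul_mul, Matrix.mul_smul, RingHom.id_apply, smul_sub, smul_add]
    rw [smul_comm]

section Sanity

variable {c : ℝ} {m : ℕ}

theorem hermForm_eq (hc : c = 1 ∨ c = -1) (b z : Fin (m + 1) → ℂ) :
    (c : ℂ) * hermForm c b z =
      ∑ k, (if k = 0 then 1 else (c : ℂ)) * (star (b k) * z k) := by
  have h2 : (c : ℂ) * c = 1 := by rcases hc with rfl | rfl <;> norm_num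
  rw [Fin.sum_univ_succ, hermForm, mul_add, ← mul_assoc, h2, Finset.mul_sum]
  simp [Fin.succ_ne_zero]

theorem projMatrix_mul (hc : c = 1 ∨ c = -1) (a b z w : Fin (m + 1) → ℂ) :
    projMatrix c a b * projMatrix c z w = ((c : ℂ) * hermForm c b z) • projMatrix c a w := by
  ext i j
  rw [hermForm_eq hc, Matrix.mul_apply, Matrix.smul_apply, smul_eq_mul, Finset.sum_mul]
  refine Finset.sum_congr rfl fun k _ => ?_
  simp only [projMatrix, Matrix.of_apply]
  ring

theorem trace_projMatrix (hc : c = 1 ∨ c = -1) (a b : Fin (m + 1) → ℂ) :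
    (projMatrix c a b).trace = c * hermForm c b a := by
  rw [hermForm_eq hc, Matrix.trace]
  refine Finset.sum_congr rfl fun k _ => ?_
  simp only [projMatrix, Matrix.of_apply, Matrix.diag_apply]
  ring

theorem hermForm_conj (b z : Fin (m + 1) → ℂ) : hermForm c z b = star (hermForm c b z) := by
  simp [hermForm, mul_comm]

theorem embed_mk (z : Quadric c m) :
    embed (Quotient.mk (circleOrbit c m) z) = projMatrix c z.1 z.1 := rfl

theorem embed_mul_self (hc : c = 1 ∨ c = -1) (q : CQ c m) : embed q * embed q = embed q := by
  obtain ⟨z, rfl⟩ := Quotient.exists_rep q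
  have h2 : (c : ℂ) * c = 1 := by rcases hc with rfl | rfl <;> norm_num
  rw [embed_mk, projMatrix_mul hc, z.2, h2, one_smul]

/-- `Φ` is injective. -/
theorem embed_injective (hc : c = 1 ∨ c = -1) :
    Function.Injective (embed : CQ c m → Mat m) := by
  intro p q h
  obtain ⟨z, rfl⟩ := Quotient.exists_rep p
  obtain ⟨w, rfl⟩ := Quotient.exists_rep q
  have h2 : (c : ℂ) * c = 1 := by rcases hc with rfl | rfl <;> norm_num
  have hc0 : (c : ℂ) ≠ 0 := by rcases hc with rfl | rfl <;> norm_num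
  have hvec : ∀ a b v : Fin (m + 1) → ℂ,
      Matrix.mulVec (projMatrix c a b) v = ((c : ℂ) * hermForm c b v) • a := by
    intro a b v
    ext i
    rw [hermForm_eq hc, Matrix.mulVec, dotProduct, Pi.smul_apply, smul_eq_mul, Finset.sum_mul]
    refine Finset.sum_congr rfl fun k _ => ?_
    simp only [projMatrix, Matrix.of_apply]
    ring
  have hw : w.1 = ((c : ℂ) * hermForm c z.1 w.1) • z.1 := by
    rw [← hvec z.1 z.1, ← embed_mk, h, embed_mk, hvec, w.2, h2, one_smul]
  set u := (c : ℂ) * hermForm c z.1 w.1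
  have hu : (star u * u) * c = c := by
    have h3 : hermForm c (u • z.1) (u • z.1) = (star u * u) * hermForm c z.1 z.1 := by
      simp only [hermForm, Pi.smul_apply, smul_eq_mul, star_mul', mul_add, Finset.mul_sum]
      congr 1
      · ring
      · exact Finset.sum_congr rfl fun k _ => by ring
    rw [← hw, z.2, w.2] at h3
    exact h3.symm
  have hu1 : star u * u = 1 := mul_right_cancel₀ hc0 (by rw [hu, one_mul])
  refine Quotient.sound ⟨u, ?_, hw⟩
  have h4 := Complex.conj_mul' u
  rw [← Complex.star_def, hu1] at h4
  have h5 : ‖u‖ ^ 2 = 1 := by exact_mod_cast h4.symm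
  nlinarith [norm_nonneg u]

/-- On horizontal vectors the trace metric is the metric `Re Ψ_c` of the quadric: `Φ` is isometric
for the metric that makes the quadric a (pseudo-)Riemannian submersion. -/
theorem traceForm_liftTangent (hc : c = 1 ∨ c = -1) (z : Quadric c m) (v w : Fin (m + 1) → ℂ)
    (hv : hermForm c z.1 v = 0) (hw : hermForm c z.1 w = 0) :
    traceForm c (liftTangent c z.1 v) (liftTangent c z.1 w) = (hermForm c v w).re := by
  have h2 : (c : ℂ) * c = 1 := by rcases hc with rfl | rfl <;> norm_num
  have hv' : hermForm c v z.1 = 0 := by rw [hermForm_conj, hv, star_zero]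
  have hw' : hermForm c w z.1 = 0 := by rw [hermForm_conj, hw, star_zero]
  have h : (liftTangent c z.1 v * liftTangent c z.1 w).trace =
      c * (hermForm c v w + star (hermForm c v w)) := by
    simp only [liftTangent, add_mul, mul_add, projMatrix_mul hc, hw, hv', z.2, h2, mul_zero,
      zero_smul, one_smul, zero_add, add_zero, Matrix.trace_add, Matrix.trace_smul, smul_eq_mul,
      trace_projMatrix hc, ← hermForm_conj]
    ring
  have h3 : c * c = 1 := by exact_mod_cast h2
  simp only [traceForm, LinearMap.mk₂_apply, h, Complex.re_ofReal_mul, Complex.add_re,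
    Complex.star_def, Complex.conj_re]
  linear_combination (hermForm c v w).re * h3

theorem complexJ_liftTangent (hc : c = 1 ∨ c = -1) (z : Quadric c m) (w : Fin (m + 1) → ℂ)
    (hw : hermForm c z.1 w = 0) :
    complexJ (Quotient.mk (circleOrbit c m) z) (liftTangent c z.1 w) =
      liftTangent c z.1 (Complex.I • w) := by
  have h2 : (c : ℂ) * c = 1 := by rcases hc with rfl | rfl <;> norm_num
  have hw' : hermForm c w z.1 = 0 := by rw [hermForm_conj, hw, star_zero]
  simp only [complexJ, LinearMap.coe_mk, AddHom.coe_mk, embed_mk, liftTangent, add_mul, mul_add,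
    projMatrix_mul hc, hw, hw', z.2, h2, mul_zero, zero_smul, one_smul, zero_add, add_zero]
  ext i j
  simp [projMatrix]
  split_ifs <;> ring

/-- `tangentProj` maps `Ψ_c`-Hermitian matrices to tangent vectors. -/
theorem isTangent_tangentProj (hc : c = 1 ∨ c = -1) (q : CQ c m) {W : Mat m}
    (hW : ∀ a b : Fin (m + 1) → ℂ,
      hermForm c (Matrix.mulVec W a) b = hermForm c a (Matrix.mulVec W b)) :
    IsTangent q (tangentProj q W) := by
  obtain ⟨z, rfl⟩ := Quotient.exists_rep q
  have h2 : (c : ℂ) * c = 1 := by rcases hc with rfl | rfl <;> norm_num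
  have hl : ∀ a b : Fin (m + 1) → ℂ,
      W * projMatrix c a b = projMatrix c (Matrix.mulVec W a) b := by
    intro a b
    ext i j
    simp only [Matrix.mul_apply, projMatrix, Matrix.of_apply, Matrix.mulVec, dotProduct,
      Finset.sum_mul, Finset.mul_sum]
    exact Finset.sum_congr rfl fun k _ => by ring
  have hr : ∀ a b : Fin (m + 1) → ℂ,
      projMatrix c a b * W = projMatrix c a (Matrix.mulVec W b) := by
    intro a b
    ext i j
    have h := congrArg (fun t => a i * ((c : ℂ) * t)) (hW b (Pi.single j 1))
    simp only [hermForm_eq hc] at h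
    simp only [Matrix.mul_apply, projMatrix, Matrix.of_apply]
    simp [Pi.single_apply, Finset.mul_sum] at h
    refine Eq.trans ?_ (Eq.trans h.symm ?_)
    · exact Finset.sum_congr rfl fun k _ => by split_ifs <;> simp <;> ring
    · split_ifs <;> simp <;> ring
  set w := Matrix.mulVec W z.1
  set r := (c : ℂ) * hermForm c z.1 w with hr0
  have hrc : star r = r := by
    rw [hr0, star_mul', ← hermForm_conj, hW z.1 z.1]
    simp [w]
  refine ⟨z, rfl, w - r • z.1, ?_, ?_⟩
  · have : hermForm c z.1 (w - r • z.1) = hermForm c z.1 w - r * hermForm c z.1 z.1 := by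
      simp only [hermForm, Pi.sub_apply, Pi.smul_apply, smul_eq_mul, mul_add, mul_sub,
        Finset.mul_sum, Finset.sum_sub_distrib]
      have : ∀ k : Fin m, star (z.1 k.succ) * (r * z.1 k.succ) =
        r * (star (z.1 k.succ) * z.1 k.succ) := fun k => by ring
      simp only [this]
      ring
    rw [this, z.2, hr0]
    linear_combination -(hermForm c z.1 w) * h2
  · have h3 : projMatrix c z.1 z.1 * W * projMatrix c z.1 z.1 = r • projMatrix c z.1 z.1 := by
      rw [mul_assoc, hl, projMatrix_mul hc]
    simp only [tangentProj, LinearMap.coe_mk, AddHom.coe_mk, embed_mk, h3]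
    simp only [hl, hr]
    rw [show Matrix.mulVec W z.1 = w from rfl]
    ext i j
    simp only [liftTangent, projMatrix, Matrix.sub_apply, Matrix.add_apply, Matrix.smul_apply,
      Matrix.of_apply, Pi.sub_apply, Pi.smul_apply, smul_eq_mul, star_sub, star_mul', hrc,
      Complex.real_smul]
    push_cast
    ring

/-- `tangentProj` is the identity on tangent vectors. -/
theorem tangentProj_eq_self {q : CQ c m} (hc : c = 1 ∨ c = -1) {V : Mat m} (hV : IsTangent q V) :
    tangentProj q V = V := by
  obtain ⟨z, rfl, w, hw, rfl⟩ := hV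
  have h2 : (c : ℂ) * c = 1 := by rcases hc with rfl | rfl <;> norm_num
  have hw' : hermForm c w z.1 = 0 := by rw [hermForm_conj, hw, star_zero]
  simp only [tangentProj, LinearMap.coe_mk, AddHom.coe_mk, embed_mk, liftTangent, add_mul, mul_add,
    projMatrix_mul hc, hw, hw', z.2, h2, mul_zero, zero_smul, one_smul, zero_add, add_zero,
    smul_zero, sub_zero]
  exact add_comm _ _

/-- `W - tangentProj q W` is orthogonal to the vectors fixed by `tangentProj q`. -/
theorem traceForm_tangentProj (hc : c = 1 ∨ c = -1) (q : CQ c m) (V W : Mat m)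
    (hV : tangentProj q V = V) : traceForm c (tangentProj q W) V = traceForm c W V := by
  have hP := embed_mul_self hc q
  simp only [tangentProj, LinearMap.coe_mk, AddHom.coe_mk] at hV ⊢
  set P := embed q
  have h : ((P * W + W * P - (2 : ℝ) • (P * W * P)) * V).trace =
      (W * (P * V + V * P - (2 : ℝ) • (P * V * P))).trace := by
    simp only [sub_mul, mul_sub, add_mul, mul_add, Matrix.trace_sub, Matrix.trace_add,
      Matrix.smul_mul, Matrix.mul_smul, Matrix.trace_smul]
    rw [mul_assoc P W V, Matrix.trace_mul_comm P (W * V), mul_assoc (P * W) P V,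
      mul_assoc P W (P * V), Matrix.trace_mul_comm P (W * (P * V))]
    simp only [mul_assoc]
    ring
  simp only [traceForm, LinearMap.mk₂_apply, h, hV]

end Sanity

/-! ### Real hypersurfaces -/

/-- Vector fields on the `n`-manifold `M` (no regularity is built in). -/
abbrev VField (n : ℕ) (M : Type*) [TopologicalSpace M]
    [ChartedSpace (EuclideanSpace ℝ (Fin n)) M] : Type _ :=
  (p : M) → TangentSpace (𝓡 n) p

variable {n m : ℕ} {c : ℝ} {M : Type*} [TopologicalSpace M]
  [ChartedSpace (EuclideanSpace ℝ (Fin n)) M]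

/-- `V` is a smooth vector field on the set `O`. -/
def SmoothOn [IsManifold (𝓡 n) ∞ M] (V : VField n M) (O : Set M) : Prop :=
  ContMDiffOn (𝓡 n) (𝓡 n).tangent ∞ (fun p => (⟨p, V p⟩ : TangentBundle (𝓡 n) M)) O

/-- The differential of `Φ ∘ x` at `p`. -/
def diff (x : M → CQ c m) (p : M) : TangentSpace (𝓡 n) p →L[ℝ] Mat m :=
  mvfderiv (𝓡 n) (fun q => embed (x q)) p

/-- The derivative `∇̄_v V` in `ℂQ^m(4c)`, in the direction `v ∈ T_pM`, of a vector field `V` of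
`ℂQ^m(4c)` along `x`: the component tangent to `ℂQ^m(4c)` of the derivative in the ambient
(pseudo-)Euclidean space of matrices, as `Φ` is an isometric embedding. -/
def ambientDeriv (x : M → CQ c m) (V : M → Mat m) (p : M) :
    TangentSpace (𝓡 n) p →ₗ[ℝ] Mat m :=
  tangentProj (x p) ∘ₗ (mvfderiv (𝓡 n) V p).toLinearMap

instance (p : M) : FiniteDimensional ℝ (TangentSpace (𝓡 n) p) :=
  inferInstanceAs (FiniteDimensional ℝ (EuclideanSpace ℝ (Fin n)))

theorem mdifferentiableAt_mvfderiv [IsManifold (𝓡 n) ∞ M] {F : Type*} [NormedAddCommGroup F] [NormedSpace ℝ F]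
    {g : M → F} (hg : ContMDiff (𝓡 n) 𝓘(ℝ, F) ∞ g) {Y : VField n M} {p : M}
    (hY : MDifferentiableAt (𝓡 n) (𝓡 n).tangent (fun q => (⟨q, Y q⟩ : TangentBundle (𝓡 n) M)) p) :
    MDifferentiableAt (𝓡 n) 𝓘(ℝ, F) (fun q => mvfderiv (𝓡 n) g q (Y q)) p := by
  have h1 : ContMDiff (𝓡 n).tangent 𝓘(ℝ, F).tangent 1 (tangentMap (𝓡 n) 𝓘(ℝ, F) g) :=
    hg.contMDiff_tangentMap (by norm_cast)
  have h2 := (h1.mdifferentiableAt (x := ⟨p, Y p⟩) one_ne_zero).comp p hY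
  exact ((contMDiff_snd_tangentBundle_modelSpace F 𝓘(ℝ, F)).contMDiffAt.mdifferentiableAt
    one_ne_zero).comp p h2

theorem fderiv_comp_chart [IsManifold (𝓡 n) ∞ M] {F : Type*} [NormedAddCommGroup F] [NormedSpace ℝ F]
    {g : M → F} (p : M) {y : EuclideanSpace ℝ (Fin n)} (hy : y ∈ (extChartAt (𝓡 n) p).target)
    (hg : MDifferentiableAt (𝓡 n) 𝓘(ℝ, F) g ((extChartAt (𝓡 n) p).symm y)) (X : VField n M) :
    fderiv ℝ (g ∘ (extChartAt (𝓡 n) p).symm) y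
      (VectorField.mpullbackWithin 𝓘(ℝ, EuclideanSpace ℝ (Fin n)) (𝓡 n)
        (extChartAt (𝓡 n) p).symm X (Set.range (𝓡 n)) y) =
      mvfderiv (𝓡 n) g ((extChartAt (𝓡 n) p).symm y) (X ((extChartAt (𝓡 n) p).symm y)) := by
  have hs : MDifferentiableWithinAt 𝓘(ℝ, EuclideanSpace ℝ (Fin n)) (𝓡 n)
      (extChartAt (𝓡 n) p).symm (Set.range (𝓡 n)) y :=
    (contMDiffWithinAt_extChartAt_symm_range (n := 1) p hy).mdifferentiableWithinAt one_ne_zero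
  have hi := isInvertible_mfderivWithin_extChartAt_symm (I := 𝓡 n) hy
  have hc := mfderiv_comp_mfderivWithin y hg hs
    (by simp [uniqueMDiffWithinAt_univ])
  have h1 : mfderivWithin 𝓘(ℝ, EuclideanSpace ℝ (Fin n)) 𝓘(ℝ, F)
      (g ∘ (extChartAt (𝓡 n) p).symm) (Set.range (𝓡 n)) y =
      fderiv ℝ (g ∘ (extChartAt (𝓡 n) p).symm) y := by
    rw [ModelWithCorners.range_eq_univ, mfderivWithin_univ, mfderiv_eq_fderiv]
  rw [h1] at hc
  rw [VectorField.mpullbackWithin_apply]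
  have h2 := congrArg (fun L => L ((mfderivWithin 𝓘(ℝ, EuclideanSpace ℝ (Fin n)) (𝓡 n)
      (extChartAt (𝓡 n) p).symm (Set.range (𝓡 n)) y).inverse
        (X ((extChartAt (𝓡 n) p).symm y)))) hc
  refine h2.trans ?_
  change mfderiv (𝓡 n) 𝓘(ℝ, F) g _ (mfderivWithin _ _ _ _ _ (ContinuousLinearMap.inverse _ _)) = _
  obtain ⟨L, hL⟩ := hi
  rw [← hL]
  simp only [ContinuousLinearMap.inverse_equiv, ContinuousLinearEquiv.coe_coe,
    ContinuousLinearEquiv.apply_symm_apply]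
  rfl

variable [Bundle.RiemannianBundle (fun p : M => TangentSpace (𝓡 n) p)]

instance (p : M) : CompleteSpace (TangentSpace (𝓡 n) p) :=
  FiniteDimensional.complete ℝ _

/-- `x` is a smooth isometric immersion of the Riemannian manifold `M` into `ℂQ^m(4c)`. -/
structure IsIsometricImmersion (x : M → CQ c m) : Prop where
  smooth : ContMDiff (𝓡 n) 𝓘(ℝ, Mat m) ∞ (fun p => embed (x p))
  isometric : ∀ (p : M) (v w : TangentSpace (𝓡 n) p),
    traceForm c (diff x p v) (diff x p w) = inner ℝ v w

/-- `ξ` is a smooth field of unit vectors of `ℂQ^m(4c)` normal to `M` along `x` on the set `O`. -/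
structure IsUnitNormalOn (x : M → CQ c m) (ξ : M → Mat m) (O : Set M) : Prop where
  smooth : ContMDiffOn (𝓡 n) 𝓘(ℝ, Mat m) ∞ ξ O
  tangent : ∀ p ∈ O, IsTangent (x p) (ξ p)
  normal : ∀ p ∈ O, ∀ v : TangentSpace (𝓡 n) p, traceForm c (ξ p) (diff x p v) = 0
  unit : ∀ p ∈ O, traceForm c (ξ p) (ξ p) = 1

/-- `e` is a smooth orthonormal frame of `TM` on the set `O`. -/
structure IsOrthonormalFrameOn [IsManifold (𝓡 n) ∞ M] (e : Fin n → VField n M) (O : Set M) :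
    Prop where
  smooth : ∀ i, SmoothOn (e i) O
  orthonormal : ∀ p ∈ O, Orthonormal ℝ (fun i => e i p)

/-- The tangent vector of `M` representing a linear form through the Riemannian metric. -/
def sharp (p : M) : (TangentSpace (𝓡 n) p →ₗ[ℝ] ℝ) →ₗ[ℝ] TangentSpace (𝓡 n) p where
  toFun φ := (InnerProductSpace.toDual ℝ _).symm (LinearMap.toContinuousLinearMap φ)
  map_add' := by intros; simp
  map_smul' := by intros; simp

theorem inner_sharp (p : M) (φ : TangentSpace (𝓡 n) p →ₗ[ℝ] ℝ) (v : TangentSpace (𝓡 n) p) :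
    inner ℝ (sharp p φ) v = φ v := by
  simp [sharp]

/-- The component `W_T` of a vector `W` along `x` tangent to `M`, as a vector of `T_pM`: it is
determined by `⟨W_T, v⟩ = ⟨W, dx(v)⟩` for all `v ∈ T_pM`. -/
def tangentPart (x : M → CQ c m) (p : M) : Mat m →ₗ[ℝ] TangentSpace (𝓡 n) p :=
  sharp p ∘ₗ (LinearMap.lcomp ℝ ℝ (diff x p).toLinearMap) ∘ₗ traceForm c

theorem inner_tangentPart (x : M → CQ c m) (p : M) (W : Mat m) (v : TangentSpace (𝓡 n) p) :
    inner ℝ (tangentPart x p W) v = traceForm c W (diff x p v) := by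
  simp [tangentPart, inner_sharp]

/-- The Levi-Civita connection of `M`: `∇_v Y = (∇̄_v Y)_T`; see `covDeriv_metric` and
`covDeriv_torsionFree`. -/
def covDeriv (x : M → CQ c m) (Y : VField n M) (p : M) :
    TangentSpace (𝓡 n) p →ₗ[ℝ] TangentSpace (𝓡 n) p :=
  tangentPart x p ∘ₗ ambientDeriv x (fun q => diff x q (Y q)) p

/-- The vector field `∇_X Y`. -/
def nabla (x : M → CQ c m) (X Y : VField n M) : VField n M :=
  fun p => covDeriv x Y p (X p)

section LeviCivita

variable {x : M → CQ c m}

theorem tangentProj_diff (hc : c = 1 ∨ c = -1) (hx : IsIsometricImmersion (n := n) x) (p : M)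
    (v : TangentSpace (𝓡 n) p) : tangentProj (x p) (diff x p v) = diff x p v := by
  have hd : MDifferentiableAt (𝓡 n) 𝓘(ℝ, Mat m) (fun q => embed (x q)) p :=
    hx.smooth.mdifferentiableAt (by simp)
  have h1 := hd.hasMFDerivAt
  have h2 := h1.mul' h1
  have h3 : (fun q => embed (x q)) * (fun q => embed (x q)) = fun q => embed (x q) := by
    funext q
    exact embed_mul_self hc (x q)
  rw [h3] at h2
  have h4 := hasMFDerivAt_unique h1 h2
  have h5 : diff x p v = embed (x p) * diff x p v + diff x p v * embed (x p) := by
    have := congrArg (fun L => L v) h4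
    exact this
  have hP := embed_mul_self hc (x p)
  have h6 : embed (x p) * diff x p v * embed (x p) = 0 := by
    have := congrArg (fun W => embed (x p) * W * embed (x p)) h5
    simp only [mul_add, add_mul] at this
    rw [← mul_assoc, hP, mul_assoc _ (diff x p v * _), mul_assoc (diff x p v), hP] at this
    simpa [mul_assoc] using this
  simp only [tangentProj, LinearMap.coe_mk, AddHom.coe_mk, h6, smul_zero, sub_zero]
  exact h5.symm

theorem inner_covDeriv (hc : c = 1 ∨ c = -1) (hx : IsIsometricImmersion (n := n) x)
    (Y : VField n M) (p : M) (v w : TangentSpace (𝓡 n) p) :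
    inner ℝ (covDeriv x Y p v) w =
      traceForm c (mvfderiv (𝓡 n) (fun q => diff x q (Y q)) p v) (diff x p w) := by
  simp only [covDeriv, LinearMap.comp_apply, inner_tangentPart, ambientDeriv]
  exact traceForm_tangentProj hc _ _ _ (tangentProj_diff hc hx p w)

variable [IsManifold (𝓡 n) ∞ M]

/-- `∇` is compatible with the Riemannian metric of `M`. -/
theorem covDeriv_metric (hc : c = 1 ∨ c = -1) (hx : IsIsometricImmersion (n := n) x)
    {Y Z : VField n M} {p : M}
    (hY : MDifferentiableAt (𝓡 n) (𝓡 n).tangent (fun q => (⟨q, Y q⟩ : TangentBundle (𝓡 n) M)) p)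
    (hZ : MDifferentiableAt (𝓡 n) (𝓡 n).tangent (fun q => (⟨q, Z q⟩ : TangentBundle (𝓡 n) M)) p)
    (v : TangentSpace (𝓡 n) p) :
    mvfderiv (𝓡 n) (fun q => (inner ℝ (Y q) (Z q) : ℝ)) p v =
      inner ℝ (covDeriv x Y p v) (Z p) + inner ℝ (Y p) (covDeriv x Z p v) := by
  let L : Mat m →L[ℝ] ℝ := LinearMap.toContinuousLinearMap
    ((c / 2) • Complex.reLm ∘ₗ (Matrix.traceLinearMap (Fin (m + 1)) ℝ ℂ))
  have hL : ∀ A B : Mat m, traceForm c A B = L (A * B) := fun A B => by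
    simp [L, traceForm]
  have hfun : (fun q => (inner ℝ (Y q) (Z q) : ℝ)) =
      fun q => L (diff x q (Y q) * diff x q (Z q)) := by
    funext q
    rw [← hL, hx.isometric]
  have hG := (mdifferentiableAt_mvfderiv hx.smooth hY).hasMFDerivAt
  have hH := (mdifferentiableAt_mvfderiv hx.smooth hZ).hasMFDerivAt
  have hd := (L.hasMFDerivAt (x := diff x p (Y p) * diff x p (Z p))).comp p (hG.mul' hH)
  have key : mvfderiv (𝓡 n) (fun q => (inner ℝ (Y q) (Z q) : ℝ)) p v =
      L (diff x p (Y p) * mvfderiv (𝓡 n) (fun q => diff x q (Z q)) p v +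
        mvfderiv (𝓡 n) (fun q => diff x q (Y q)) p v * diff x p (Z p)) := by
    rw [hfun]
    exact congrArg (fun T => T v) hd.mfderiv
  rw [key, map_add, ← hL, ← hL, inner_covDeriv hc hx, ← real_inner_comm,
    inner_covDeriv hc hx, add_comm]
  congr 1
  rw [hL, hL]
  simp only [L, LinearMap.coe_toContinuousLinearMap', LinearMap.smul_apply, LinearMap.comp_apply,
    Matrix.traceLinearMap_apply]
  rw [Matrix.trace_mul_comm]

/-- `∇` is torsion-free. -/
theorem covDeriv_torsionFree (hc : c = 1 ∨ c = -1) (hx : IsIsometricImmersion (n := n) x)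
    {X Y : VField n M} {p : M}
    (hX : MDifferentiableAt (𝓡 n) (𝓡 n).tangent (fun q => (⟨q, X q⟩ : TangentBundle (𝓡 n) M)) p)
    (hY : MDifferentiableAt (𝓡 n) (𝓡 n).tangent (fun q => (⟨q, Y q⟩ : TangentBundle (𝓡 n) M)) p) :
    covDeriv x Y p (X p) - covDeriv x X p (Y p) = VectorField.mlieBracket (𝓡 n) X Y p := by
  have hs := hx.smooth
  let φ := extChartAt (𝓡 n) p
  have hpt : φ p ∈ φ.target := mem_extChartAt_target p
  have hps : φ.symm (φ p) = p := extChartAt_to_inv p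
  let P : VField n M → EuclideanSpace ℝ (Fin n) → EuclideanSpace ℝ (Fin n) := fun V =>
    VectorField.mpullbackWithin 𝓘(ℝ, EuclideanSpace ℝ (Fin n)) (𝓡 n) φ.symm V (Set.range (𝓡 n))
  let F : EuclideanSpace ℝ (Fin n) → Mat m := (fun q => embed (x q)) ∘ φ.symm
  have hmd : ∀ q, MDifferentiableAt (𝓡 n) 𝓘(ℝ, Mat m) (fun q => embed (x q)) q :=
    fun q => hs.mdifferentiableAt (by simp)
  have hP : ∀ {V : VField n M}, MDifferentiableAt (𝓡 n) (𝓡 n).tangent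
      (fun q => (⟨q, V q⟩ : TangentBundle (𝓡 n) M)) p → DifferentiableAt ℝ (P V) (φ p) := by
    intro V hV
    have := MDifferentiableWithinAt.differentiableWithinAt_mpullbackWithin_vectorField
      (s := Set.univ) hV.mdifferentiableWithinAt
    exact this.differentiableAt (by simp)
  have hF : ContDiffAt ℝ ∞ F (φ p) := by
    have h1 : ContMDiffAt 𝓘(ℝ, EuclideanSpace ℝ (Fin n)) 𝓘(ℝ, Mat m) ∞ F (φ p) := by
      have h2 := contMDiffOn_extChartAt_symm (I := 𝓡 n) (n := ∞) p
      have h3 := (h2 (φ p) hpt).contMDiffAt (extChartAt_target_mem_nhds p)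
      exact (hs (φ.symm (φ p))).comp (φ p) h3
    exact h1.contDiffAt
  have hD : ∀ {V W : VField n M}, MDifferentiableAt (𝓡 n) (𝓡 n).tangent
      (fun q => (⟨q, V q⟩ : TangentBundle (𝓡 n) M)) p →
      fderiv ℝ (fun y => fderiv ℝ F y (P V y)) (φ p) (P W (φ p)) =
        mvfderiv (𝓡 n) (fun q => diff x q (V q)) p (W p) := by
    intro V W hV
    have h1 : (fun y => fderiv ℝ F y (P V y)) =ᶠ[nhds (φ p)]
        (fun q => diff x q (V q)) ∘ φ.symm := by
      filter_upwards [extChartAt_target_mem_nhds p] with y hy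
      exact fderiv_comp_chart p hy (hmd _) V
    rw [h1.fderiv_eq]
    have h2 := fderiv_comp_chart (g := fun q => diff x q (V q)) p hpt
      (by rw [hps]; exact mdifferentiableAt_mvfderiv hs hV) W
    refine h2.trans ?_
    rw [hps]
  have hbr := VectorField.fderiv_apply_lieBracket (𝕜 := ℝ) (f := F) (x := φ p) (n := ∞) hF
    (by simpa using WithTop.coe_le_coe.2 (le_top : (2 : ℕ∞) ≤ ⊤)) (hP hY) (hP hX)
  rw [hD hY, hD hX] at hbr
  have hbr2 : fderiv ℝ F (φ p) (VectorField.lieBracket ℝ (P X) (P Y) (φ p)) =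
      diff x p (VectorField.mlieBracket (𝓡 n) X Y p) := by
    have hB : VectorField.mlieBracket (𝓡 n) X Y p =
        (mfderiv (𝓡 n) 𝓘(ℝ, EuclideanSpace ℝ (Fin n)) φ p).inverse
          (VectorField.lieBracket ℝ (P X) (P Y) (φ p)) := by
      have h := VectorField.mlieBracketWithin_apply (I := 𝓡 n) (V := X) (W := Y) (s := Set.univ)
        (x₀ := p)
      rw [Set.preimage_univ, Set.univ_inter] at h
      refine h.trans ?_
      congr 1
      have h0 : Set.range (𝓡 n) = Set.univ := ModelWithCorners.range_eq_univ _
      change VectorField.lieBracketWithin ℝ (P X) (P Y) (Set.range (𝓡 n)) (φ p) = _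
      rw [h0, VectorField.lieBracketWithin_univ]
      rfl
    have hφ : MDifferentiableAt (𝓡 n) 𝓘(ℝ, EuclideanSpace ℝ (Fin n)) φ p :=
      mdifferentiableAt_extChartAt (mem_chart_source _ p)
    have hFd : HasMFDerivAt 𝓘(ℝ, EuclideanSpace ℝ (Fin n)) 𝓘(ℝ, Mat m) F (φ p)
        (fderiv ℝ F (φ p)) :=
      (hF.differentiableAt (by simp)).hasFDerivAt.hasMFDerivAt
    have hcomp := hFd.comp p hφ.hasMFDerivAt
    have hev : (fun q => embed (x q)) =ᶠ[nhds p] F ∘ φ := by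
      filter_upwards [extChartAt_source_mem_nhds (I := 𝓡 n) p] with q hq
      simp only [F, Function.comp_apply]
      rw [PartialEquiv.left_inv φ hq]
    have hdiff := (hcomp.congr_of_eventuallyEq hev).mfderiv
    obtain ⟨L, hL⟩ := isInvertible_mfderiv_extChartAt (I := 𝓡 n) (mem_extChartAt_source (I := 𝓡 n) p)
    rw [hB]
    have h2 := congrArg (fun T => T ((mfderiv (𝓡 n) 𝓘(ℝ, EuclideanSpace ℝ (Fin n)) φ p).inverse
          (VectorField.lieBracket ℝ (P X) (P Y) (φ p)))) hdiff
    refine Eq.trans ?_ h2.symm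
    change _ = fderiv ℝ F (φ p) (mfderiv (𝓡 n) 𝓘(ℝ, EuclideanSpace ℝ (Fin n)) φ p
      (ContinuousLinearMap.inverse _ _))
    congr 1
    rw [← hL, ContinuousLinearMap.inverse_equiv]
    exact (L.apply_symm_apply _).symm
  rw [hbr2] at hbr
  refine ext_inner_right ℝ fun w => ?_
  rw [inner_sub_left, inner_covDeriv hc hx, inner_covDeriv hc hx, ← hx.isometric, hbr,
    map_sub, LinearMap.sub_apply]

end LeviCivita

/-- The shape operator, `A v = -∇̄_v ξ`. -/
def shape (x : M → CQ c m) (ξ : M → Mat m) (p : M) :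
    TangentSpace (𝓡 n) p →ₗ[ℝ] TangentSpace (𝓡 n) p :=
  -(tangentPart x p ∘ₗ ambientDeriv x ξ p)

/-- The structure vector field `U = -Jξ`. -/
def structVec (x : M → CQ c m) (ξ : M → Mat m) : VField n M :=
  fun p => tangentPart x p (-(complexJ (x p) (ξ p)))

/-- The endomorphism `S v = (J v)_T`. -/
def structEndo (x : M → CQ c m) (p : M) :
    TangentSpace (𝓡 n) p →ₗ[ℝ] TangentSpace (𝓡 n) p :=
  tangentPart x p ∘ₗ complexJ (x p) ∘ₗ (diff x p).toLinearMap

/-- The gradient of a function. -/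
def grad (φ : M → ℝ) : VField n M :=
  fun p => sharp p (mvfderiv (𝓡 n) φ p).toLinearMap

/-- The Hessian `Hess_φ(v, w) = ⟨∇_v (∇φ), w⟩`. -/
def hess (x : M → CQ c m) (φ : M → ℝ) (p : M) (v w : TangentSpace (𝓡 n) p) : ℝ :=
  inner ℝ (covDeriv x (grad φ) p v) w

/-- The Laplacian `Δφ = -tr Hess_φ` on functions. -/
def laplacian (x : M → CQ c m) (φ : M → ℝ) (p : M) : ℝ :=
  -LinearMap.trace ℝ (TangentSpace (𝓡 n) p) (covDeriv x (grad φ) p)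

/-- The covariant derivative `(∇_Z B) X = ∇_Z (B X) - B (∇_Z X)` of an operator `B` on vector
fields. -/
def nablaOp (x : M → CQ c m) (Z : VField n M) (B : VField n M → VField n M) :
    VField n M → VField n M :=
  fun X => nabla x Z (B X) - B (nabla x Z X)

/-- The shape operator as an operator on vector fields. -/
def shapeOp (x : M → CQ c m) (ξ : M → Mat m) : VField n M → VField n M :=
  fun X p => shape (n := n) x ξ p (X p)

/-- The trace Laplacian `ΔA = ∑ᵢ [∇_{∇_{eᵢ} eᵢ} A - ∇_{eᵢ} (∇_{eᵢ} A)]` of the shape operator. -/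
def laplacianShape (x : M → CQ c m) (ξ : M → Mat m) (e : Fin n → VField n M) :
    VField n M → VField n M :=
  fun X => ∑ i, (nablaOp x (nabla x (e i) (e i)) (shapeOp x ξ) X -
    nablaOp x (e i) (nablaOp x (e i) (shapeOp x ξ)) X)

/-- `‖∇A‖² = ∑_{i,j} ⟨(∇_{eⱼ} A) eᵢ, (∇_{eⱼ} A) eᵢ⟩`. -/
def normSqNablaShape (x : M → CQ c m) (ξ : M → Mat m) (e : Fin n → VField n M) (p : M) : ℝ :=
  ∑ i, ∑ j, inner ℝ (nablaOp x (e j) (shapeOp x ξ) (e i) p)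
    (nablaOp x (e j) (shapeOp x ξ) (e i) p)

end ComplexSpaceForm

end

/-! This is a Simons type argument. By the Codazzi equation `(∇_Y A)X` is symmetric in `X` and `Y`
up to an explicit tensor C built from `S` and `U`. Hence `(∇²_{e_i,e_i} A)X` equals `(∇²_{e_i,X}
A)e_i` plus a derivative of C, and the Ricci identity exchanges the two derivatives at the cost of
curvature terms. What remains after summation, `∑ (∇²_{X,e_i} A)e_i`, is the derivative along `X` of
the divergence of `A`. This divergence is the gradient of `tr A`, because the trace of C vanishes.
No constancy of the mean curvature is needed, which is why `∇_X(∇f)` survives.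

The correction terms are frame traces. The Gauss equation gives `∑ R(e_i,X)(A e_i)` and `∑
R(e_i,X)e_i` (`sum_curvature`, `sum_ricci`), and `∇U = SA` together with the formula for `∇S` gives
the derivative of C (`sum_connBilin_codazziTensor`). The `A³` terms cancel, and the curvature and
Codazzi contributions each supply half of the `6c SAS` term. This yields `laplacianA_eq`. Pairing it
with `A` and using `½Δ tr A² = ⟨ΔA, A⟩ - ‖∇A‖²` yields `laplacian_tr_A_sq`. All of this is pure
algebra over the structure equations, so it is carried out in an abstract module of fields.

The geometry consists in deriving the structure equations from the embedding by projectors. A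
tangent vector anticommutes with the reflection `1 - 2P`, and the second fundamental form of the
embedding is `(1 - 2P)(VW + WV)`. Differentiating twice and antisymmetrising gives the curvature as
the double commutator `[[X,Y],W]` (`ambientDeriv_ambientDeriv_sub`), which `commutator_commutator`
evaluates as the curvature tensor of constant holomorphic sectional curvature. Its tangential and
normal parts along the hypersurface are the Gauss and Codazzi equations (`gauss_and_codazzi`); those
of `∇̄J = 0` give `∇U` and `∇S` (`covDeriv_structEndo_and`). Fields smooth on `O` and cut off
outside it then form an instance of the abstract module, and both formulas follow by evaluation at a
point. -/

/-- A module `V` of vector fields over a ring `R` of functions, with a metric, an orthonormal frame,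
the Levi-Civita connection, and the tensors `A`, `S`, `U` of a real hypersurface of a complex space
form of holomorphic sectional curvature `4c`, subject to the structure equations. -/
structure HypersurfaceAlgebra (R V ι : Type*) [CommRing R] [AddCommGroup V] [Module R V]
    [Fintype ι] where
  c : R
  /-- the derivative of a function in the direction of a vector field -/
  D : V →ₗ[R] R →+ R
  /-- the metric -/
  g : V →ₗ[R] V →ₗ[R] R
  /-- the Levi-Civita connection -/
  conn : V →ₗ[R] V →+ V
  /-- the frame -/
  e : ι → V
  A : V →ₗ[R] V
  S : V →ₗ[R] V
  U : V
  eq_zero_of_two_mul : ∀ r : R, 2 * r = 0 → r = 0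
  D_mul : ∀ X φ ψ, D X (φ * ψ) = D X φ * ψ + φ * D X ψ
  D_c : ∀ X, D X c = 0
  g_symm : ∀ X Y, g X Y = g Y X
  conn_smul : ∀ X φ Y, conn X (φ • Y) = D X φ • Y + φ • conn X Y
  D_g : ∀ X Y Z, D X (g Y Z) = g (conn X Y) Z + g Y (conn X Z)
  -- Orthonormality enters only through this expansion and the constancy of the products `g (e i) (e
  -- j)`. The relation `g (e i) (e j) = δ_ij` would fail in the intended model, where the frame is
  -- set to zero outside an open set; for the same reason the dimension appears below as `tr id` and
  -- not as a number.
  frame : ∀ X, ∑ i, g X (e i) • e i = X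
  D_frame : ∀ X i j, D X (g (e i) (e j)) = 0
  A_symm : ∀ X Y, g (A X) Y = g X (A Y)
  S_skew : ∀ X Y, g (S X) Y = -g X (S Y)
  S_sq : ∀ X, S (S X) = -X + g X U • U
  S_U : S U = 0
  conn_U : ∀ X, conn X U = S (A X)
  conn_S : ∀ X Y, conn X (S Y) = S (conn X Y) + g Y U • A X - g (A X) Y • U
  codazzi : ∀ X Y, (conn X (A Y) - A (conn X Y)) - (conn Y (A X) - A (conn Y X)) =
    c • (g X U • S Y - g Y U • S X - (2 * g (S X) Y) • U)
  gauss : ∀ X Y Z, conn X (conn Y Z) - conn Y (conn X Z) - conn (conn X Y - conn Y X) Z =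
    c • (g Y Z • X - g X Z • Y + g (S Y) Z • S X - g (S X) Z • S Y - (2 * g (S X) Y) • S Z)
      + g (A Y) Z • A X - g (A X) Z • A Y

/-! ### The Simons computation from the structure equations. -/

namespace HypersurfaceAlgebra

variable {R V ι : Type*} [CommRing R] [AddCommGroup V] [Module R V] [Fintype ι]
  (H : HypersurfaceAlgebra R V ι)

/-- `nablaA Y X = (∇_Y A) X` -/
def nablaA : V →ₗ[R] V →ₗ[R] V :=
  LinearMap.mk₂ R (fun Y X => H.conn Y (H.A X) - H.A (H.conn Y X))
    (by intros; simp only [map_add, AddMonoidHom.add_apply]; abel)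
    (by intros; simp only [map_smul, AddMonoidHom.smul_apply, smul_sub])
    (by intros; simp only [map_add]; abel)
    (by intros; simp only [map_smul, map_add, H.conn_smul, smul_sub]; abel)

theorem nablaA_apply (Y X : V) : H.nablaA Y X = H.conn Y (H.A X) - H.A (H.conn Y X) := rfl

/-- The right hand side of the Codazzi equation. -/
def codazziTensor : V →ₗ[R] V →ₗ[R] V :=
  LinearMap.mk₂ R (fun X Y => H.c • (H.g X H.U • H.S Y - H.g Y H.U • H.S X
      - (2 * H.g (H.S X) Y) • H.U))
    (by intros; simp only [map_add, LinearMap.add_apply]; module)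
    (by intros; simp only [map_smul, LinearMap.smul_apply, smul_eq_mul]; module)
    (by intros; simp only [map_add, LinearMap.add_apply]; module)
    (by intros; simp only [map_smul, LinearMap.smul_apply, smul_eq_mul]; module)

theorem nablaA_eq (X Y : V) : H.nablaA X Y = H.nablaA Y X + H.codazziTensor X Y := by
  rw [← sub_eq_iff_eq_add']
  exact H.codazzi X Y

/-- The covariant derivative of a vector-valued bilinear tensor. -/
def connBilin (B : V →ₗ[R] V →ₗ[R] V) (Y Z X : V) : V :=
  H.conn Y (B Z X) - B (H.conn Y Z) X - B Z (H.conn Y X)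

/-- The connection coefficients `g (∇_X e_i) e_j` are skew in `i` and `j`, because the products of
frame fields have zero derivative. Consequently frame traces may be differentiated as if the frame
were parallel. -/
theorem sum_conn_frame {W : Type*} [AddCommGroup W] [Module R W] (B : V →ₗ[R] V →ₗ[R] W) (X : V) :
    ∑ i, (B (H.conn X (H.e i)) (H.e i) + B (H.e i) (H.conn X (H.e i))) = 0 := by
  have h1 : ∀ i, B (H.conn X (H.e i)) (H.e i) =
      ∑ j, H.g (H.conn X (H.e i)) (H.e j) • B (H.e j) (H.e i) := fun i => by
    conv_lhs => rw [← H.frame (H.conn X (H.e i))]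
    simp [map_sum]
  have h2 : ∀ i, B (H.e i) (H.conn X (H.e i)) =
      ∑ j, H.g (H.conn X (H.e i)) (H.e j) • B (H.e i) (H.e j) := fun i => by
    conv_lhs => rw [← H.frame (H.conn X (H.e i))]
    simp [map_sum]
  rw [Finset.sum_add_distrib, Finset.sum_congr rfl fun i _ => h1 i, Finset.sum_comm,
    Finset.sum_congr rfl fun i _ => h2 i, ← Finset.sum_add_distrib]
  refine Finset.sum_eq_zero fun i _ => ?_
  rw [← Finset.sum_add_distrib]
  refine Finset.sum_eq_zero fun j _ => ?_
  rw [← add_smul, H.g_symm (H.conn X (H.e i)), add_comm (H.g _ _), ]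
  have := H.D_g X (H.e j) (H.e i)
  rw [H.D_frame] at this
  rw [add_comm, ← this, zero_smul]

theorem eq_of_inner {X Y : V} (h : ∀ Z, H.g X Z = H.g Y Z) : X = Y := by
  rw [← H.frame X, ← H.frame Y]
  simp only [h]

theorem sum_smul_map {W : Type*} [AddCommGroup W] [Module R W] (T : V →ₗ[R] W) (X : V) :
    ∑ i, H.g X (H.e i) • T (H.e i) = T X := by
  conv_rhs => rw [← H.frame X]
  simp [map_sum]

theorem sum_smul_map' {W : Type*} [AddCommGroup W] [Module R W] (T : V →ₗ[R] W) (X : V) :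
    ∑ i, H.g (H.e i) X • T (H.e i) = T X := by
  simp only [H.g_symm _ X, sum_smul_map]

/-- The trace of an endomorphism. -/
def tr (T : V →ₗ[R] V) : R := ∑ i, H.g (T (H.e i)) (H.e i)

theorem tr_comp_comm (T T' : V →ₗ[R] V) : H.tr (T ∘ₗ T') = H.tr (T' ∘ₗ T) := by
  have h : ∀ T T' : V →ₗ[R] V, H.tr (T ∘ₗ T') =
      ∑ i, ∑ j, H.g (T' (H.e i)) (H.e j) * H.g (T (H.e j)) (H.e i) := fun T T' => by
    refine Finset.sum_congr rfl fun i _ => ?_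
    exact (H.sum_smul_map ((H.g.flip (H.e i)) ∘ₗ T) (T' (H.e i))).symm
  rw [h, h, Finset.sum_comm]
  exact Finset.sum_congr rfl fun i _ => Finset.sum_congr rfl fun j _ => mul_comm _ _

/-- The trace of a skew endomorphism times a symmetric one equals its own negative. -/
theorem tr_S_comp_A : H.tr (H.S ∘ₗ H.A) = 0 := by
  apply H.eq_zero_of_two_mul
  have h : H.tr (H.S ∘ₗ H.A) = -H.tr (H.A ∘ₗ H.S) := by
    rw [tr, tr, ← Finset.sum_neg_distrib]
    refine Finset.sum_congr rfl fun i _ => ?_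
    simp only [LinearMap.comp_apply]
    rw [H.S_skew, H.A_symm, H.g_symm]
  rw [two_mul]
  nth_rewrite 1 [h]
  rw [H.tr_comp_comm, neg_add_cancel]

theorem nablaA_symm (Z X Y : V) : H.g (H.nablaA Z X) Y = H.g X (H.nablaA Z Y) := by
  have h1 := H.D_g Z (H.A X) Y
  have h2 := H.D_g Z X (H.A Y)
  rw [H.A_symm X Y, h2, H.A_symm X (H.conn Z Y)] at h1
  simp only [nablaA_apply, map_sub, LinearMap.sub_apply, H.A_symm (H.conn Z X) Y]
  linear_combination -h1

/-- The Ricci identity for `A`. -/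
theorem ricci (Y Z X : V) :
    H.connBilin H.nablaA Y Z X = H.connBilin H.nablaA Z Y X
      + (H.conn Y (H.conn Z (H.A X)) - H.conn Z (H.conn Y (H.A X))
          - H.conn (H.conn Y Z - H.conn Z Y) (H.A X))
      - H.A (H.conn Y (H.conn Z X) - H.conn Z (H.conn Y X) - H.conn (H.conn Y Z - H.conn Z Y) X) := by
  simp only [connBilin, nablaA_apply, map_sub, AddMonoidHom.sub_apply]
  abel

/-- This is the covariant derivative of the Codazzi equation; here `connBilin nablaA Y Z X` is the
second covariant derivative `(∇²_{Y,Z} A)X`. -/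
theorem connBilin_swap (Y Z X : V) :
    H.connBilin H.nablaA Y Z X =
      H.connBilin H.nablaA Y X Z + H.connBilin H.codazziTensor Y Z X := by
  simp only [connBilin, H.nablaA_eq Z X, H.nablaA_eq (H.conn Y Z) X, H.nablaA_eq Z (H.conn Y X),
    map_add]
  abel

theorem g_S_self (X : V) : H.g (H.S X) X = 0 := by
  apply H.eq_zero_of_two_mul
  have := H.S_skew X X
  rw [H.g_symm X] at this
  linear_combination this

/-- The divergence of `A` is the gradient of its trace. Symmetry of `∇_Y A` and Codazzi turn the
divergence paired with `Y` into `tr (∇_Y A)` plus a trace of the Codazzi tensor. That trace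
vanishes: each of its terms contains `g (S Z) Z` or `g (S Y) U`, and `S` is skew with `S U = 0`. -/
theorem sum_nablaA_frame (G : V) (hG : ∀ X, H.g G X = H.D X (H.tr H.A)) :
    ∑ i, H.nablaA (H.e i) (H.e i) = G := by
  refine H.eq_of_inner fun Y => ?_
  rw [hG, tr, map_sum, map_sum, LinearMap.sum_apply]
  have h1 : ∀ i, H.g (H.nablaA (H.e i) (H.e i)) Y =
      H.g (H.nablaA Y (H.e i)) (H.e i) + H.g (H.e i) (H.codazziTensor (H.e i) Y) := fun i => by
    rw [nablaA_symm, H.nablaA_eq (H.e i) Y, map_add, H.g_symm (H.nablaA Y _)]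
  have h2 : ∀ i, H.D Y (H.g (H.A (H.e i)) (H.e i)) = H.g (H.nablaA Y (H.e i)) (H.e i) +
      ((H.g ∘ₗ H.A) (H.conn Y (H.e i)) (H.e i) + (H.g ∘ₗ H.A) (H.e i) (H.conn Y (H.e i))) :=
    fun i => by
      rw [H.D_g, nablaA_apply]
      simp only [map_sub, LinearMap.sub_apply, LinearMap.comp_apply]
      ring
  rw [Finset.sum_congr rfl fun i _ => h1 i, Finset.sum_congr rfl fun i _ => h2 i,
    Finset.sum_add_distrib, Finset.sum_add_distrib, sum_conn_frame]
  congr 1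
  have h3 : ∀ i, H.g (H.e i) (H.codazziTensor (H.e i) Y) =
      H.c * (H.g (H.e i) H.U • H.g (H.S Y) (H.e i)) - H.c * (H.g Y H.U * H.g (H.S (H.e i)) (H.e i))
        + (2 * H.c) * (H.g (H.e i) (H.S Y) • H.g H.U (H.e i)) := fun i => by
    simp only [codazziTensor, LinearMap.mk₂_apply, map_smul, map_sub, smul_eq_mul, H.S_skew _ Y,
      H.g_symm (H.e i) (H.S _), H.g_symm (H.e i) H.U]
    ring
  rw [Finset.sum_congr rfl fun i _ => h3 i, Finset.sum_add_distrib, Finset.sum_sub_distrib]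
  simp only [← Finset.mul_sum, g_S_self, sum_smul_map']
  simp [H.S_skew, H.S_U, H.g_symm H.U]

theorem sum_connBilin_frame (G : V) (hG : ∀ X, H.g G X = H.D X (H.tr H.A)) (X : V) :
    ∑ i, H.connBilin H.nablaA X (H.e i) (H.e i) = H.conn X G := by
  have h := H.sum_conn_frame H.nablaA X
  rw [← H.sum_nablaA_frame G hG, map_sum, ← sub_eq_zero, ← Finset.sum_sub_distrib, ← neg_eq_zero,
    ← h, ← Finset.sum_neg_distrib]
  refine Finset.sum_congr rfl fun i _ => ?_
  simp only [connBilin]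
  abel

theorem connBilin_codazziTensor (Y Z X : V) :
    H.connBilin H.codazziTensor Y Z X =
      H.c • (H.g Z (H.S (H.A Y)) • H.S X + H.g Z H.U • (H.g X H.U • H.A Y - H.g (H.A Y) X • H.U)
        - H.g X (H.S (H.A Y)) • H.S Z - H.g X H.U • (H.g Z H.U • H.A Y - H.g (H.A Y) Z • H.U)
        - (2 * (H.g Z H.U * H.g (H.A Y) X - H.g (H.A Y) Z * H.g H.U X)) • H.U
        - (2 * H.g (H.S Z) X) • H.S (H.A Y)) := by
  simp only [connBilin, codazziTensor, LinearMap.mk₂_apply, H.conn_smul, map_sub, H.D_mul, H.D_g,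
    H.conn_U, H.conn_S, H.D_c, map_add, map_smul, LinearMap.add_apply, LinearMap.sub_apply,
    LinearMap.smul_apply, smul_eq_mul]
  -- A derivation kills integers; this removes the derivative of the coefficient 2 in the Codazzi
  -- tensor.
  have h2 : H.D Y 2 = 0 := by
    have h1 : H.D Y 1 = 0 := by
      have := H.D_mul Y 1 1
      simpa using this
    rw [← one_add_one_eq_two, map_add, h1, add_zero]
  rw [h2]
  module

/-- This is the trace of `R(e_i, X)(A e_i)`. The term `S A S X` arises once from the pairing `g (S
X) (A e_i)` and twice from the last curvature term, whence the 3; the term carrying `tr (SA)` drops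
out. -/
theorem sum_curvature (X : V) :
    ∑ i, (H.conn (H.e i) (H.conn X (H.A (H.e i))) - H.conn X (H.conn (H.e i) (H.A (H.e i)))
          - H.conn (H.conn (H.e i) X - H.conn X (H.e i)) (H.A (H.e i))) =
      H.c • (H.A X - H.tr H.A • X + (3 : R) • H.S (H.A (H.S X)))
        + H.A (H.A (H.A X)) - H.tr (H.A ∘ₗ H.A) • H.A X := by
  have h1 : ∀ i, (H.conn (H.e i) (H.conn X (H.A (H.e i))) - H.conn X (H.conn (H.e i) (H.A (H.e i)))
          - H.conn (H.conn (H.e i) X - H.conn X (H.e i)) (H.A (H.e i))) =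
      H.c • (H.g (H.A X) (H.e i) • H.e i) - H.c • (H.g (H.A (H.e i)) (H.e i) • X)
        + H.c • (H.g (H.A (H.S X)) (H.e i) • H.S (H.e i))
        + H.c • (H.g ((H.S ∘ₗ H.A) (H.e i)) (H.e i) • H.S X)
        + (2 * H.c) • (H.g (H.S X) (H.e i) • (H.S ∘ₗ H.A) (H.e i))
        + H.g (H.A (H.A X)) (H.e i) • H.A (H.e i)
        - H.g ((H.A ∘ₗ H.A) (H.e i)) (H.e i) • H.A X := fun i => by
    have a1 : H.g (H.S (H.e i)) (H.A (H.e i)) = -H.g (H.S (H.A (H.e i))) (H.e i) := by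
      rw [H.S_skew, H.g_symm (H.e i)]
    have a2 : H.g (H.S (H.e i)) X = -H.g (H.S X) (H.e i) := by
      rw [H.S_skew, H.g_symm (H.e i)]
    rw [H.gauss, a1, a2, ← H.A_symm X, ← H.A_symm (H.e i) (H.e i), ← H.A_symm (H.S X),
      ← H.A_symm (H.A X), ← H.A_symm (H.A (H.e i))]
    simp only [LinearMap.comp_apply]
    module
  rw [Finset.sum_congr rfl fun i _ => h1 i]
  simp only [Finset.sum_add_distrib, Finset.sum_sub_distrib, ← Finset.smul_sum, ← Finset.sum_smul,
    sum_smul_map, H.frame]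
  rw [show ∑ i, H.g ((H.S ∘ₗ H.A) (H.e i)) (H.e i) = 0 from H.tr_S_comp_A]
  simp only [tr, LinearMap.comp_apply]
  module

/-- Up to sign this is the Ricci operator. The two `S`-terms combine to `3c S(S X)`, and `S_sq`
splits it into a multiple of `X` and a multiple of `U`; with `c(1 - tr id)` from the
constant-curvature part this makes the coefficient `-(tr id + 2)`. -/
theorem sum_ricci (X : V) :
    ∑ i, (H.conn (H.e i) (H.conn X (H.e i)) - H.conn X (H.conn (H.e i) (H.e i))
          - H.conn (H.conn (H.e i) X - H.conn X (H.e i)) (H.e i)) =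
      H.c • ((3 * H.g X H.U) • H.U - (H.tr LinearMap.id + 2) • X)
        + H.A (H.A X) - H.tr H.A • H.A X := by
  have h1 : ∀ i, (H.conn (H.e i) (H.conn X (H.e i)) - H.conn X (H.conn (H.e i) (H.e i))
          - H.conn (H.conn (H.e i) X - H.conn X (H.e i)) (H.e i)) =
      H.c • (H.g X (H.e i) • H.e i) - H.c • (H.g (LinearMap.id (R := R) (H.e i)) (H.e i) • X)
        + (3 * H.c) • (H.g (H.S X) (H.e i) • H.S (H.e i))
        + H.g (H.A X) (H.e i) • H.A (H.e i)
        - H.g (H.A (H.e i)) (H.e i) • H.A X := fun i => by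
    have a2 : H.g (H.S (H.e i)) X = -H.g (H.S X) (H.e i) := by
      rw [H.S_skew, H.g_symm (H.e i)]
    rw [H.gauss, H.g_S_self, a2]
    simp only [LinearMap.id_apply]
    module
  rw [Finset.sum_congr rfl fun i _ => h1 i]
  simp only [Finset.sum_add_distrib, Finset.sum_sub_distrib, ← Finset.smul_sum, ← Finset.sum_smul,
    sum_smul_map, H.frame, H.S_sq]
  simp only [tr]
  module

/-- The second half of the `S A S` contribution to the Laplacian comes from here, together with all
terms proportional to `U`. -/
theorem sum_connBilin_codazziTensor (X : V) :
    ∑ i, H.connBilin H.codazziTensor (H.e i) (H.e i) X =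
      (3 * H.c) • (H.S (H.A (H.S X)) - H.g (H.A H.U) X • H.U + (H.tr H.A * H.g H.U X) • H.U) := by
  have h1 : ∀ i, H.connBilin H.codazziTensor (H.e i) (H.e i) X =
      H.c • (H.g ((H.S ∘ₗ H.A) (H.e i)) (H.e i) • H.S X)
        - (3 * H.c) • ((H.g (H.e i) H.U * H.g (H.A (H.e i)) X) • H.U)
        + H.c • (H.g (H.A (H.S X)) (H.e i) • H.S (H.e i))
        + (3 * H.c) • ((H.g (H.A (H.e i)) (H.e i) * H.g H.U X) • H.U)
        + (2 * H.c) • (H.g (H.S X) (H.e i) • (H.S ∘ₗ H.A) (H.e i)) := fun i => by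
    have a1 : H.g (H.e i) (H.S (H.A (H.e i))) = H.g ((H.S ∘ₗ H.A) (H.e i)) (H.e i) := H.g_symm _ _
    have a2 : H.g X (H.S (H.A (H.e i))) = -H.g (H.A (H.S X)) (H.e i) := by
      rw [H.A_symm, ← neg_neg (H.g X _), ← H.S_skew]
    have a3 : H.g (H.S (H.e i)) X = -H.g (H.S X) (H.e i) := by
      rw [H.S_skew, H.g_symm (H.e i)]
    rw [connBilin_codazziTensor, a1, a2, a3, H.g_symm X H.U, LinearMap.comp_apply]
    module
  have h2 : ∑ i, H.g (H.e i) H.U * H.g (H.A (H.e i)) X = H.g (H.A H.U) X :=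
    H.sum_smul_map' ((H.g.flip X) ∘ₗ H.A) H.U
  rw [Finset.sum_congr rfl fun i _ => h1 i]
  simp only [Finset.sum_add_distrib, Finset.sum_sub_distrib, ← Finset.smul_sum, ← Finset.sum_smul,
    sum_smul_map, h2, ← Finset.sum_mul]
  rw [show ∑ i, H.g ((H.S ∘ₗ H.A) (H.e i)) (H.e i) = 0 from H.tr_S_comp_A]
  simp only [tr, LinearMap.comp_apply]
  module

/-- The trace Laplacian of `A`. -/
def laplacianA (X : V) : V :=
  ∑ i, ((H.conn (H.conn (H.e i) (H.e i)) (H.A X) - H.A (H.conn (H.conn (H.e i) (H.e i)) X))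
    - ((H.conn (H.e i) (H.conn (H.e i) (H.A X) - H.A (H.conn (H.e i) X)))
      - (H.conn (H.e i) (H.A (H.conn (H.e i) X)) - H.A (H.conn (H.e i) (H.conn (H.e i) X)))))

theorem laplacianA_eq_neg_sum (X : V) :
    H.laplacianA X = -∑ i, H.connBilin H.nablaA (H.e i) (H.e i) X := by
  rw [laplacianA, ← Finset.sum_neg_distrib]
  refine Finset.sum_congr rfl fun i _ => ?_
  simp only [connBilin, nablaA_apply]
  abel

/-- The Simons type formula for the shape operator. -/
theorem laplacianA_eq (G : V) (hG : ∀ X, H.g G X = H.D X (H.tr H.A)) (X : V) :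
    H.laplacianA X =
      (3 * H.c) • (H.g (H.A H.U - H.tr H.A • H.U) X • H.U + H.g H.U X • H.A H.U)
        - (6 * H.c) • H.S (H.A (H.S X)) + (H.c * H.tr H.A) • X
        + (H.tr (H.A ∘ₗ H.A) - H.c * (H.tr LinearMap.id + 3)) • H.A X
        - H.tr H.A • H.A (H.A X) - H.conn X G := by
  have h : ∀ i, H.connBilin H.nablaA (H.e i) (H.e i) X =
      H.connBilin H.nablaA X (H.e i) (H.e i)
      + (H.conn (H.e i) (H.conn X (H.A (H.e i))) - H.conn X (H.conn (H.e i) (H.A (H.e i)))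
          - H.conn (H.conn (H.e i) X - H.conn X (H.e i)) (H.A (H.e i)))
      - H.A (H.conn (H.e i) (H.conn X (H.e i)) - H.conn X (H.conn (H.e i) (H.e i))
          - H.conn (H.conn (H.e i) X - H.conn X (H.e i)) (H.e i))
      + H.connBilin H.codazziTensor (H.e i) (H.e i) X := fun i => by
    -- Codazzi exchanges the inner derivative `e i` with `X`, then the Ricci identity exchanges the
    -- two derivatives, so that the sum contracts to the derivative of a divergence.
    rw [connBilin_swap, ricci]
  rw [laplacianA_eq_neg_sum, Finset.sum_congr rfl fun i _ => h i, Finset.sum_add_distrib,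
    Finset.sum_sub_distrib, Finset.sum_add_distrib, ← map_sum, sum_connBilin_frame _ G hG,
    sum_curvature, sum_ricci, sum_connBilin_codazziTensor]
  simp only [map_add, map_sub, map_smul, LinearMap.sub_apply, LinearMap.smul_apply, smul_eq_mul,
    H.g_symm X H.U]
  module

theorem D_tr_A_sq (Y : V) :
    H.D Y (H.tr (H.A ∘ₗ H.A)) = 2 * ∑ i, H.g (H.nablaA Y (H.e i)) (H.A (H.e i)) := by
  have h := H.sum_conn_frame (H.g.compl₁₂ H.A H.A) Y
  rw [tr, map_sum, Finset.mul_sum, ← sub_eq_zero, ← Finset.sum_sub_distrib, ← h]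
  refine Finset.sum_congr rfl fun i _ => ?_
  rw [LinearMap.comp_apply, H.A_symm, H.D_g, nablaA_apply]
  simp only [LinearMap.compl₁₂_apply, map_sub, LinearMap.sub_apply]
  rw [H.g_symm (H.A (H.e i)), H.g_symm (H.A (H.e i))]
  ring

/-- In view of `D_tr_A_sq`, this is the Hessian of `½ tr A²` on the pair `(Y, Z)`, by the product
rule. -/
theorem D_sum_nablaA (Y Z : V) :
    H.D Y (∑ i, H.g (H.nablaA Z (H.e i)) (H.A (H.e i)))
        - ∑ i, H.g (H.nablaA (H.conn Y Z) (H.e i)) (H.A (H.e i)) =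
      ∑ i, H.g (H.connBilin H.nablaA Y Z (H.e i)) (H.A (H.e i))
        + ∑ i, H.g (H.nablaA Z (H.e i)) (H.nablaA Y (H.e i)) := by
  have h := H.sum_conn_frame (H.g.compl₁₂ (H.nablaA Z) H.A) Y
  rw [map_sum, ← Finset.sum_sub_distrib, ← Finset.sum_add_distrib, ← sub_eq_zero,
    ← Finset.sum_sub_distrib, ← h]
  refine Finset.sum_congr rfl fun i _ => ?_
  rw [H.D_g, connBilin, H.nablaA_apply Y]
  simp only [LinearMap.compl₁₂_apply, map_sub, LinearMap.sub_apply]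
  ring

theorem sum_inner_laplacianA (G : V) (hG : ∀ X, H.g G X = H.D X (H.tr H.A)) :
    ∑ i, H.g (H.laplacianA (H.e i)) (H.A (H.e i)) =
      6 * H.c * H.g (H.A H.U) (H.A H.U) - 3 * H.c * H.tr H.A * H.g (H.A H.U) H.U
        - 6 * H.c * H.tr (H.S ∘ₗ H.A ∘ₗ H.S ∘ₗ H.A) + H.c * H.tr H.A ^ 2
        + (H.tr (H.A ∘ₗ H.A) - H.c * (H.tr LinearMap.id + 3)) * H.tr (H.A ∘ₗ H.A)
        - H.tr H.A * H.tr (H.A ∘ₗ H.A ∘ₗ H.A)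
        - ∑ i, H.g (H.conn (H.A (H.e i)) G) (H.e i) := by
  -- The map `X ↦ ∇_X G` is linear over functions, so cyclicity of the trace moves `A` to the other
  -- slot.
  have hT : ∑ i, H.g (H.conn (H.A (H.e i)) G) (H.e i) =
      ∑ i, H.g (H.conn (H.e i) G) (H.A (H.e i)) := by
    let T : V →ₗ[R] V :=
      { toFun := fun X => H.conn X G
        map_add' := by intros; simp
        map_smul' := by intros; simp }
    have := H.tr_comp_comm T H.A
    simp only [tr, LinearMap.comp_apply, H.A_symm (T _)] at this
    exact this
  have hS : H.tr (H.S ∘ₗ H.A ∘ₗ H.S ∘ₗ H.A) = H.tr (H.A ∘ₗ H.S ∘ₗ H.A ∘ₗ H.S) :=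
    H.tr_comp_comm H.S (H.A ∘ₗ H.S ∘ₗ H.A)
      |>.trans (by simp only [LinearMap.comp_assoc])
  have h : ∀ i, H.g (H.laplacianA (H.e i)) (H.A (H.e i)) =
      3 * H.c * (H.g (H.A H.U - H.tr H.A • H.U) (H.e i) • (H.g H.U ∘ₗ H.A) (H.e i))
        + 3 * H.c * (H.g H.U (H.e i) • (H.g (H.A H.U) ∘ₗ H.A) (H.e i))
        - 6 * H.c * H.g ((H.A ∘ₗ H.S ∘ₗ H.A ∘ₗ H.S) (H.e i)) (H.e i)
        + H.c * H.tr H.A * H.g (H.A (H.e i)) (H.e i)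
        + (H.tr (H.A ∘ₗ H.A) - H.c * (H.tr LinearMap.id + 3)) * H.g ((H.A ∘ₗ H.A) (H.e i)) (H.e i)
        - H.tr H.A * H.g ((H.A ∘ₗ H.A ∘ₗ H.A) (H.e i)) (H.e i)
        - H.g (H.conn (H.e i) G) (H.A (H.e i)) := fun i => by
    rw [H.laplacianA_eq G hG]
    simp only [LinearMap.comp_apply, H.A_symm _ (H.e i), map_sub, map_add, map_smul,
      LinearMap.sub_apply, LinearMap.add_apply, LinearMap.smul_apply, smul_eq_mul]
    ring
  rw [Finset.sum_congr rfl fun i _ => h i, hT, hS]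
  simp only [Finset.sum_add_distrib, Finset.sum_sub_distrib, ← Finset.mul_sum, sum_smul_map]
  simp only [tr, LinearMap.comp_apply, map_sub, map_smul, smul_eq_mul]
  rw [← H.A_symm H.U (H.A H.U), ← H.A_symm H.U H.U]
  ring

/-- The Simons type formula for `tr A²`. -/
theorem laplacian_tr_A_sq (G G₂ : V) (hG : ∀ X, H.g G X = H.D X (H.tr H.A))
    (hG₂ : ∀ X, H.g G₂ X = H.D X (H.tr (H.A ∘ₗ H.A))) :
    -∑ i, H.g (H.conn (H.e i) G₂) (H.e i) =
      2 * (6 * H.c * H.g (H.A H.U) (H.A H.U) - 3 * H.c * H.tr H.A * H.g (H.A H.U) H.U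
        - 6 * H.c * H.tr (H.S ∘ₗ H.A ∘ₗ H.S ∘ₗ H.A) + H.c * H.tr H.A ^ 2
        + (H.tr (H.A ∘ₗ H.A) - H.c * (H.tr LinearMap.id + 3)) * H.tr (H.A ∘ₗ H.A)
        - H.tr H.A * H.tr (H.A ∘ₗ H.A ∘ₗ H.A)
        - ∑ i, ∑ j, H.g (H.nablaA (H.e j) (H.e i)) (H.nablaA (H.e j) (H.e i))
        - ∑ i, H.g (H.conn (H.A (H.e i)) G) (H.e i)) := by
  -- The Hessian of `tr A²` on `(e j, e j)` splits into a second derivative of `A` paired with `A`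
  -- and a square of `∇A`; summed over `j`, the former is `-⟨ΔA, A⟩` and the latter `‖∇A‖²`.
  have h1 : ∀ j, H.g (H.conn (H.e j) G₂) (H.e j) =
      2 * (∑ i, H.g (H.connBilin H.nablaA (H.e j) (H.e j) (H.e i)) (H.A (H.e i))
        + ∑ i, H.g (H.nablaA (H.e j) (H.e i)) (H.nablaA (H.e j) (H.e i))) := fun j => by
    have h2 := H.D_g (H.e j) G₂ (H.e j)
    rw [hG₂, hG₂, D_tr_A_sq, D_tr_A_sq, two_mul, map_add] at h2
    rw [← D_sum_nablaA]
    linear_combination -h2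
  have h3 : ∑ j, ∑ i, H.g (H.connBilin H.nablaA (H.e j) (H.e j) (H.e i)) (H.A (H.e i)) =
      -∑ i, H.g (H.laplacianA (H.e i)) (H.A (H.e i)) := by
    rw [Finset.sum_comm, ← Finset.sum_neg_distrib]
    refine Finset.sum_congr rfl fun i _ => ?_
    rw [laplacianA_eq_neg_sum, map_neg, LinearMap.neg_apply, neg_neg, map_sum, LinearMap.sum_apply]
  have h4 := H.sum_inner_laplacianA G hG
  rw [Finset.sum_congr rfl fun j _ => h1 j, ← Finset.mul_sum, Finset.sum_add_distrib, h3, h4,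
    Finset.sum_comm (γ := ι) (f := fun i j => H.g (H.nablaA (H.e j) (H.e i)) _)]
  ring

end HypersurfaceAlgebra

noncomputable section

namespace ComplexSpaceForm

/-! ### Linear algebra of tangent vectors in the projector model. -/

section PointwiseAlgebra

variable {c : ℝ} {m : ℕ}

theorem ofReal_mul_self_of_sign (hc : c = 1 ∨ c = -1) : (c : ℂ) * c = 1 := by
  rcases hc with rfl | rfl <;> norm_num

theorem hermForm_add_right (z v w : Fin (m + 1) → ℂ) :
    hermForm c z (v + w) = hermForm c z v + hermForm c z w := by
  simp only [hermForm, Pi.add_apply, mul_add, Finset.sum_add_distrib]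
  ring

theorem hermForm_smul_right (z w : Fin (m + 1) → ℂ) (u : ℂ) :
    hermForm c z (u • w) = u * hermForm c z w := by
  simp only [hermForm, Pi.smul_apply, smul_eq_mul, mul_add, Finset.mul_sum]
  congr 1
  · ring
  · exact Finset.sum_congr rfl fun _ _ => by ring

theorem hermForm_smul_left (z w : Fin (m + 1) → ℂ) (u : ℂ) :
    hermForm c (u • z) w = star u * hermForm c z w := by
  rw [hermForm_conj, hermForm_smul_right, star_mul', ← hermForm_conj]

theorem projMatrix_smul_left (z w : Fin (m + 1) → ℂ) (u : ℂ) :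
    projMatrix c (u • z) w = u • projMatrix c z w := by
  ext i j
  simp [projMatrix]
  split_ifs <;> ring

theorem projMatrix_smul_right (z w : Fin (m + 1) → ℂ) (u : ℂ) :
    projMatrix c z (u • w) = star u • projMatrix c z w := by
  ext i j
  simp [projMatrix]
  split_ifs <;> ring

theorem projMatrix_add_left (z v w : Fin (m + 1) → ℂ) :
    projMatrix c (v + w) z = projMatrix c v z + projMatrix c w z := by
  ext i j
  simp [projMatrix]
  split_ifs <;> ring

theorem projMatrix_add_right (z v w : Fin (m + 1) → ℂ) :
    projMatrix c z (v + w) = projMatrix c z v + projMatrix c z w := by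
  ext i j
  simp [projMatrix]
  split_ifs <;> ring

/-- Tangent vectors can be lifted horizontally at any point of the fibre. -/
theorem IsTangent.exists_lift {z : Quadric c m} {V : Mat m}
    (hV : IsTangent (Quotient.mk (circleOrbit c m) z) V) :
    ∃ w, hermForm c z.1 w = 0 ∧ V = liftTangent c z.1 w := by
  obtain ⟨z', hz', w, hw, rfl⟩ := hV
  obtain ⟨u, hu, hzu⟩ := Quotient.exact hz'
  have hu2 : star u * u = 1 := by
    have := Complex.conj_mul' u
    rw [hu] at this
    simpa using this
  refine ⟨u • w, ?_, ?_⟩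
  · rw [hzu, hermForm_smul_right, hermForm_smul_left, hw, mul_zero, mul_zero]
  · simp only [liftTangent, hzu, projMatrix_smul_left, projMatrix_smul_right, smul_smul,
      hu2, one_smul]

/-- Horizontality kills six of the eight products of rank-one matrices, so double commutators of
tangent vectors are again of tangent type. -/
theorem liftTangent_mul_mul (hc : c = 1 ∨ c = -1) (z : Quadric c m) {v w y : Fin (m + 1) → ℂ}
    (hv : hermForm c z.1 v = 0) (hw : hermForm c z.1 w = 0) (hy : hermForm c z.1 y = 0) :
    liftTangent c z.1 v * liftTangent c z.1 w * liftTangent c z.1 y =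
      (c * hermForm c w y) • projMatrix c v z.1 + (c * hermForm c v w) • projMatrix c z.1 y := by
  have h2 := ofReal_mul_self_of_sign hc
  have hv' : hermForm c v z.1 = 0 := by rw [hermForm_conj, hv, star_zero]
  have hw' : hermForm c w z.1 = 0 := by rw [hermForm_conj, hw, star_zero]
  simp only [liftTangent, add_mul, mul_add, projMatrix_mul hc, hw, hv', hw', hy, z.2, h2, mul_zero,
    zero_smul, one_smul, zero_add, add_zero, Matrix.smul_mul, smul_zero]

/-- The curvature tensor of `ℂQ^m(4c)`. -/
theorem commutator_commutator (hc : c = 1 ∨ c = -1) {q : CQ c m} {V W Z : Mat m}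
    (hV : IsTangent q V) (hW : IsTangent q W) (hZ : IsTangent q Z) :
    (V * W - W * V) * Z - Z * (V * W - W * V) =
      c • (traceForm c W Z • V - traceForm c V Z • W
        + traceForm c (complexJ q W) Z • complexJ q V
        - traceForm c (complexJ q V) Z • complexJ q W
        - (2 * traceForm c (complexJ q V) W) • complexJ q Z) := by
  obtain ⟨z, rfl⟩ := Quotient.exists_rep q
  obtain ⟨v, hv, rfl⟩ := hV.exists_lift
  obtain ⟨w, hw, rfl⟩ := hW.exists_lift
  obtain ⟨y, hy, rfl⟩ := hZ.exists_lift
  have hI : ∀ {a : Fin (m + 1) → ℂ}, hermForm c z.1 a = 0 →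
      hermForm c z.1 (Complex.I • a) = 0 := fun h => by rw [hermForm_smul_right, h, mul_zero]
  have him : ∀ a b : Fin (m + 1) → ℂ, (hermForm c (Complex.I • a) b).re = (hermForm c a b).im :=
    fun a b => by rw [hermForm_smul_left]; simp
  rw [sub_mul, mul_sub, ← mul_assoc, ← mul_assoc, complexJ_liftTangent hc z v hv,
    complexJ_liftTangent hc z w hw, complexJ_liftTangent hc z y hy,
    traceForm_liftTangent hc z w y hw hy, traceForm_liftTangent hc z v y hv hy,
    traceForm_liftTangent hc z _ y (hI hw) hy, traceForm_liftTangent hc z _ y (hI hv) hy,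
    traceForm_liftTangent hc z _ w (hI hv) hw, him, him, him,
    liftTangent_mul_mul hc z hv hw hy, liftTangent_mul_mul hc z hw hv hy,
    liftTangent_mul_mul hc z hy hv hw, liftTangent_mul_mul hc z hy hw hv,
    hermForm_conj v w, hermForm_conj w y, hermForm_conj v y]
  -- Both sides are now combinations of rank-one matrices pairing `z` with `v`, `w`, `y`. Splitting
  -- the three Hermitian products into real and imaginary parts reduces the identity to matching
  -- coefficients.
  obtain ⟨a, ha⟩ : ∃ a, hermForm c v w = a := ⟨_, rfl⟩
  obtain ⟨b, hb⟩ : ∃ b, hermForm c w y = b := ⟨_, rfl⟩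
  obtain ⟨d, hd⟩ : ∃ d, hermForm c v y = d := ⟨_, rfl⟩
  simp only [ha, hb, hd, liftTangent, projMatrix_smul_left, projMatrix_smul_right,
    Complex.star_def, Complex.conj_I]
  have e1 := (Complex.re_add_im a).symm
  have e2 := (Complex.re_add_im b).symm
  have e3 := (Complex.re_add_im d).symm
  have conj_eq : ∀ t : ℂ, (starRingEnd ℂ) t = t.re - t.im * Complex.I := fun t => by
    apply Complex.ext <;> simp
  rw [conj_eq, conj_eq, conj_eq]
  generalize a.re = ar at *
  generalize a.im = ai at *
  generalize b.re = br at *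
  generalize b.im = bi at *
  generalize d.re = dr at *
  generalize d.im = di at *
  subst e1 e2 e3
  simp only [← Complex.coe_smul]
  push_cast
  module

/-- Matrices that are Hermitian for `Ψ_c`. -/
def IsHerm (c : ℝ) {m : ℕ} (W : Mat m) : Prop :=
  ∀ a b : Fin (m + 1) → ℂ,
    hermForm c (Matrix.mulVec W a) b = hermForm c a (Matrix.mulVec W b)

theorem isHerm_embed (hc : c = 1 ∨ c = -1) (q : CQ c m) : IsHerm c (embed q) := by
  obtain ⟨z, rfl⟩ := Quotient.exists_rep q
  have hvec : ∀ v : Fin (m + 1) → ℂ,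
      Matrix.mulVec (projMatrix c z.1 z.1) v = ((c : ℂ) * hermForm c z.1 v) • z.1 := by
    intro v
    ext i
    rw [hermForm_eq hc, Matrix.mulVec, dotProduct, Pi.smul_apply, smul_eq_mul, Finset.sum_mul]
    refine Finset.sum_congr rfl fun k _ => ?_
    simp only [projMatrix, Matrix.of_apply]
    ring
  intro a b
  rw [embed_mk, hvec, hvec, hermForm_smul_left, hermForm_smul_right, hermForm_conj a z.1]
  simp
  ring

/-- This is the linearisation of `P² = P`: tangent vectors are off-diagonal for the splitting into
image and kernel of `P`. -/
theorem IsTangent.mul_add_mul (hc : c = 1 ∨ c = -1) {q : CQ c m} {V : Mat m}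
    (hV : IsTangent q V) : embed q * V + V * embed q = V := by
  obtain ⟨z, rfl⟩ := Quotient.exists_rep q
  obtain ⟨w, hw, rfl⟩ := hV.exists_lift
  have h2 := ofReal_mul_self_of_sign hc
  have hw' : hermForm c w z.1 = 0 := by rw [hermForm_conj, hw, star_zero]
  simp only [embed_mk, liftTangent, add_mul, mul_add,
    projMatrix_mul hc, hw, hw', z.2, h2, mul_zero, zero_smul, one_smul, zero_add, add_zero]
  exact add_comm _ _

theorem IsTangent.complexJ (hc : c = 1 ∨ c = -1) {q : CQ c m} {V : Mat m}
    (hV : IsTangent q V) : IsTangent q (complexJ q V) := by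
  obtain ⟨z, rfl⟩ := Quotient.exists_rep q
  obtain ⟨w, hw, rfl⟩ := hV.exists_lift
  exact ⟨z, rfl, Complex.I • w, by rw [hermForm_smul_right, hw, mul_zero],
    complexJ_liftTangent hc z w hw⟩

theorem complexJ_complexJ (hc : c = 1 ∨ c = -1) {q : CQ c m} {V : Mat m}
    (hV : IsTangent q V) : complexJ q (complexJ q V) = -V := by
  obtain ⟨z, rfl⟩ := Quotient.exists_rep q
  obtain ⟨w, hw, rfl⟩ := hV.exists_lift
  rw [complexJ_liftTangent hc z w hw,
    complexJ_liftTangent hc z _ (by rw [hermForm_smul_right, hw, mul_zero])]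
  simp only [liftTangent, projMatrix_smul_left, projMatrix_smul_right, smul_smul,
    Complex.star_def, Complex.I_mul_I, map_neg, map_one]
  module

theorem traceForm_comm (V W : Mat m) : traceForm c V W = traceForm c W V := by
  simp only [traceForm, LinearMap.mk₂_apply, Matrix.trace_mul_comm V W]

theorem traceForm_complexJ (q : CQ c m) (V W : Mat m) :
    traceForm c (complexJ q V) W = -traceForm c V (complexJ q W) := by
  have h : ((V * embed q - embed q * V) * W).trace = -(V * (W * embed q - embed q * W)).trace := by
    rw [sub_mul, mul_sub, Matrix.trace_sub, Matrix.trace_sub, mul_assoc (embed q),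
      Matrix.trace_mul_comm (embed q)]
    simp only [mul_assoc]
    ring
  simp only [traceForm, LinearMap.mk₂_apply, complexJ, LinearMap.coe_mk, AddHom.coe_mk,
    Matrix.smul_mul, Matrix.mul_smul, Matrix.trace_smul, h]
  simp

/-- The horizontal space at a point of the quadric. -/
def horizontal (z : Fin (m + 1) → ℂ) (c : ℝ) : Submodule ℂ (Fin (m + 1) → ℂ) :=
  LinearMap.ker ({ toFun := hermForm c z
                   map_add' := hermForm_add_right z
                   map_smul' := fun u w => hermForm_smul_right z w u } :
    (Fin (m + 1) → ℂ) →ₗ[ℂ] ℂ)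

/-- The horizontal space is the kernel of a complex linear form which is nonzero because its value
at `z` is `c`. -/
theorem finrank_horizontal (hc : c = 1 ∨ c = -1) (z : Quadric c m) :
    Module.finrank ℝ (horizontal z.1 c) = 2 * m := by
  rw [finrank_real_of_complex]
  congr 1
  have h := LinearMap.finrank_range_add_finrank_ker
    ({ toFun := hermForm c z.1
       map_add' := hermForm_add_right z.1
       map_smul' := fun u w => hermForm_smul_right z.1 w u } : (Fin (m + 1) → ℂ) →ₗ[ℂ] ℂ)
  rw [LinearMap.range_eq_top.2, finrank_top, Module.finrank_self, Module.finrank_fin_fun] at h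
  · exact Nat.add_left_cancel (h.trans (add_comm _ _))
  · refine LinearMap.surjective fun h0 => ?_
    have h1 := congrArg (fun L => L z.1) h0
    have h2 : (c : ℂ) = 0 := z.2.symm.trans h1
    rcases hc with rfl | rfl <;> norm_num at h2

/-- An orthonormal family of `2m` tangent vectors of `ℂQ^m(4c)` is complete. -/
theorem IsTangent.eq_zero_of_orthogonal (hc : c = 1 ∨ c = -1) {ι : Type*} [Fintype ι]
    [DecidableEq ι] (hι : Fintype.card ι = 2 * m) {q : CQ c m} {b : ι → Mat m}
    (hb : ∀ i, IsTangent q (b i)) (hbo : ∀ i j, traceForm c (b i) (b j) = if i = j then 1 else 0)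
    {W : Mat m} (hW : IsTangent q W) (hWb : ∀ i, traceForm c W (b i) = 0) : W = 0 := by
  obtain ⟨z, rfl⟩ := Quotient.exists_rep q
  obtain ⟨w, hw, rfl⟩ := hW.exists_lift
  choose v hv hbv using fun i => (hb i).exists_lift
  let v' : ι → horizontal z.1 c := fun i => ⟨v i, hv i⟩
  let B : horizontal z.1 c →ₗ[ℝ] Mat m :=
    { toFun := fun u => liftTangent c z.1 u.1
      map_add' := fun s t => by
        simp only [liftTangent, Submodule.coe_add, projMatrix_add_left, projMatrix_add_right]
        abel
      map_smul' := fun r t => by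
        have : (r • t : horizontal z.1 c).1 = (r : ℂ) • t.1 := by ext; simp
        rw [this, liftTangent, projMatrix_smul_left, projMatrix_smul_right, Complex.star_def,
          Complex.conj_ofReal, ← smul_add, Complex.coe_smul]
        rfl }
  have hBv : ∀ i, B (v' i) = b i := fun i => (hbv i).symm
  -- Pairing with `b i` isolates the coefficient `g i`, so the lifts are independent; being `2m` in
  -- number they span the horizontal space. Positivity of the trace form plays no role.
  have hli : LinearIndependent ℝ v' := by
    rw [Fintype.linearIndependent_iff]
    intro g hg i
    have h1 := congrArg (fun t => traceForm c (B t) (b i)) hg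
    simpa [map_sum, hBv, hbo] using h1
  have hspan := hli.span_eq_top_of_card_eq_finrank' (hι.trans (finrank_horizontal hc z).symm)
  have hmem : (⟨w, hw⟩ : horizontal z.1 c) ∈ Submodule.span ℝ (Set.range v') := by
    rw [hspan]; trivial
  obtain ⟨g, hg⟩ := (Submodule.mem_span_range_iff_exists_fun ℝ).1 hmem
  have hWB : liftTangent c z.1 w = ∑ i, g i • b i := by
    have : B ⟨w, hw⟩ = liftTangent c z.1 w := rfl
    rw [← this, ← hg]
    simp [map_sum, hBv]
  have hg0 : ∀ i, g i = 0 := fun i => by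
    have := hWb i
    rw [hWB] at this
    simpa [map_sum, hbo] using this
  rw [hWB]
  simp [hg0]

end PointwiseAlgebra

/-! ### Derivatives of vector-valued functions along fields. -/

section Calculus

variable {n : ℕ} {M : Type*} [TopologicalSpace M] [ChartedSpace (EuclideanSpace ℝ (Fin n)) M]
  {F : Type*} [NormedAddCommGroup F] [NormedSpace ℝ F]

theorem mvfderiv_congr {G H : M → F} {O : Set M} (hO : IsOpen O) (h : Set.EqOn G H O) {p : M}
    (hp : p ∈ O) : mvfderiv (𝓡 n) G p = mvfderiv (𝓡 n) H p := by
  have h1 : G =ᶠ[nhds p] H := Filter.eventuallyEq_of_mem (hO.mem_nhds hp) h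
  simp only [mvfderiv]
  rw [h1.mfderiv_eq]
  rfl

theorem mvfderiv_mul_apply {A : Type*} [NormedRing A] [NormedAlgebra ℝ A] {G H : M → A} {p : M}
    (hG : MDifferentiableAt (𝓡 n) 𝓘(ℝ, A) G p) (hH : MDifferentiableAt (𝓡 n) 𝓘(ℝ, A) H p)
    (v : TangentSpace (𝓡 n) p) :
    mvfderiv (𝓡 n) (fun q => G q * H q) p v =
      G p * mvfderiv (𝓡 n) H p v + mvfderiv (𝓡 n) G p v * H p :=
  congrArg (fun T => T v) (hG.hasMFDerivAt.mul' hH.hasMFDerivAt).mfderiv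

theorem mvfderiv_add_apply {G H : M → F} {p : M} (hG : MDifferentiableAt (𝓡 n) 𝓘(ℝ, F) G p)
    (hH : MDifferentiableAt (𝓡 n) 𝓘(ℝ, F) H p) (v : TangentSpace (𝓡 n) p) :
    mvfderiv (𝓡 n) (fun q => G q + H q) p v =
      mvfderiv (𝓡 n) G p v + mvfderiv (𝓡 n) H p v :=
  congrArg (fun T => T v) (mvfderiv_fun_add hG hH)

theorem mvfderiv_sub_apply {G H : M → F} {p : M} (hG : MDifferentiableAt (𝓡 n) 𝓘(ℝ, F) G p)
    (hH : MDifferentiableAt (𝓡 n) 𝓘(ℝ, F) H p) (v : TangentSpace (𝓡 n) p) :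
    mvfderiv (𝓡 n) (fun q => G q - H q) p v =
      mvfderiv (𝓡 n) G p v - mvfderiv (𝓡 n) H p v :=
  congrArg (fun T => T v) (mvfderiv_fun_sub hG hH)

theorem mvfderiv_smul_apply {φ : M → ℝ} {G : M → F} {p : M}
    (hφ : MDifferentiableAt (𝓡 n) 𝓘(ℝ, ℝ) φ p) (hG : MDifferentiableAt (𝓡 n) 𝓘(ℝ, F) G p)
    (v : TangentSpace (𝓡 n) p) :
    mvfderiv (𝓡 n) (fun q => φ q • G q) p v =
      φ p • mvfderiv (𝓡 n) G p v + mvfderiv (𝓡 n) φ p v • G p := by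
  have := congrArg (fun T => T v) (mvfderiv_fun_smul hφ hG)
  simpa using this

theorem mvfderiv_clm_apply {F' : Type*} [NormedAddCommGroup F'] [NormedSpace ℝ F'] (L : F →L[ℝ] F')
    {G : M → F} {p : M} (hG : MDifferentiableAt (𝓡 n) 𝓘(ℝ, F) G p) (v : TangentSpace (𝓡 n) p) :
    mvfderiv (𝓡 n) (fun q => L (G q)) p v = L (mvfderiv (𝓡 n) G p v) :=
  congrArg (fun T => T v) (L.hasMFDerivAt.comp p hG.hasMFDerivAt).mfderiv

variable [IsManifold (𝓡 n) ∞ M]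

/-- The derivative along a smooth field is the fibre component of the tangent map composed with the
field; on an open set the derivative within the set is the full one. -/
theorem contMDiffOn_mvfderiv {O : Set M} (hO : IsOpen O) {G : M → F}
    (hG : ContMDiffOn (𝓡 n) 𝓘(ℝ, F) ∞ G O) {X : VField n M} (hX : SmoothOn X O) :
    ContMDiffOn (𝓡 n) 𝓘(ℝ, F) ∞ (fun p => mvfderiv (𝓡 n) G p (X p)) O := by
  have h1 := hG.contMDiffOn_tangentMapWithin (m := ∞) (by norm_cast) hO.uniqueMDiffOn
  have h2 := h1.comp hX (fun p hp => hp)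
  have h3 := (contMDiff_snd_tangentBundle_modelSpace F 𝓘(ℝ, F) (n := ∞)).comp_contMDiffOn h2
  refine h3.congr fun p hp => ?_
  change _ = mfderivWithin (𝓡 n) 𝓘(ℝ, F) G O p (X p)
  rw [mfderivWithin_of_isOpen hO hp]
  rfl

theorem SmoothOn.mdifferentiableAt {O : Set M} (hO : IsOpen O) {X : VField n M}
    (hX : SmoothOn X O) {p : M} (hp : p ∈ O) :
    MDifferentiableAt (𝓡 n) (𝓡 n).tangent (fun q => (⟨q, X q⟩ : TangentBundle (𝓡 n) M)) p :=
  (hX.contMDiffAt (hO.mem_nhds hp)).mdifferentiableAt (by simp)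

/-- The commutator of the derivatives along two vector fields is the derivative along their
bracket. -/
theorem mvfderiv_mvfderiv_sub {O : Set M} (hO : IsOpen O) {G : M → F}
    (hG : ContMDiffOn (𝓡 n) 𝓘(ℝ, F) ∞ G O) {X Y : VField n M} (hX : SmoothOn X O)
    (hY : SmoothOn Y O) {p : M} (hp : p ∈ O) :
    mvfderiv (𝓡 n) (fun q => mvfderiv (𝓡 n) G q (Y q)) p (X p)
        - mvfderiv (𝓡 n) (fun q => mvfderiv (𝓡 n) G q (X q)) p (Y p) =
      mvfderiv (𝓡 n) G p (VectorField.mlieBracket (𝓡 n) X Y p) := by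
  let φ := extChartAt (𝓡 n) p
  have hpt : φ p ∈ φ.target := mem_extChartAt_target p
  have hps : φ.symm (φ p) = p := extChartAt_to_inv p
  let P : VField n M → EuclideanSpace ℝ (Fin n) → EuclideanSpace ℝ (Fin n) := fun V =>
    VectorField.mpullbackWithin 𝓘(ℝ, EuclideanSpace ℝ (Fin n)) (𝓡 n) φ.symm V (Set.range (𝓡 n))
  let K : EuclideanSpace ℝ (Fin n) → F := G ∘ φ.symm
  have hmd : ∀ q ∈ O, MDifferentiableAt (𝓡 n) 𝓘(ℝ, F) G q :=
    fun q hq => (hG.contMDiffAt (hO.mem_nhds hq)).mdifferentiableAt (by simp)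
  have hP : ∀ {V : VField n M}, SmoothOn V O → DifferentiableAt ℝ (P V) (φ p) := by
    intro V hV
    have := MDifferentiableWithinAt.differentiableWithinAt_mpullbackWithin_vectorField
      (s := Set.univ) (hV.mdifferentiableAt hO hp).mdifferentiableWithinAt
    exact this.differentiableAt (by simp)
  have hsymm : ContMDiffAt 𝓘(ℝ, EuclideanSpace ℝ (Fin n)) (𝓡 n) ∞ φ.symm (φ p) :=
    (contMDiffOn_extChartAt_symm (I := 𝓡 n) (n := ∞) p (φ p) hpt).contMDiffAt
      (extChartAt_target_mem_nhds p)
  have hK : ContDiffAt ℝ ∞ K (φ p) := by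
    have h1 : ContMDiffAt 𝓘(ℝ, EuclideanSpace ℝ (Fin n)) 𝓘(ℝ, F) ∞ K (φ p) :=
      (show ContMDiffAt (𝓡 n) 𝓘(ℝ, F) ∞ G (φ.symm (φ p)) by
        rw [hps]; exact hG.contMDiffAt (hO.mem_nhds hp)).comp (φ p) hsymm
    exact h1.contDiffAt
  have hD : ∀ {V W : VField n M}, SmoothOn V O →
      fderiv ℝ (fun y => fderiv ℝ K y (P V y)) (φ p) (P W (φ p)) =
        mvfderiv (𝓡 n) (fun q => mvfderiv (𝓡 n) G q (V q)) p (W p) := by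
    intro V W hV
    have h1 : (fun y => fderiv ℝ K y (P V y)) =ᶠ[nhds (φ p)]
        (fun q => mvfderiv (𝓡 n) G q (V q)) ∘ φ.symm := by
      have hO' : φ.symm ⁻¹' O ∈ nhds (φ p) :=
        hsymm.continuousAt.preimage_mem_nhds (by rw [hps]; exact hO.mem_nhds hp)
      filter_upwards [extChartAt_target_mem_nhds p, hO'] with y hy hyO
      exact fderiv_comp_chart p hy (hmd _ hyO) V
    rw [h1.fderiv_eq]
    have h2 := fderiv_comp_chart (g := fun q => mvfderiv (𝓡 n) G q (V q)) p hpt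
      (by rw [hps]; exact ((contMDiffOn_mvfderiv hO hG hV).contMDiffAt
            (hO.mem_nhds hp)).mdifferentiableAt (by simp)) W
    refine h2.trans ?_
    rw [hps]
  -- In the chart the claim is the symmetry of the second derivative; the rest transports the
  -- bracket back to the manifold.
  have hbr := VectorField.fderiv_apply_lieBracket (𝕜 := ℝ) (f := K) (x := φ p) (n := ∞) hK
    (by simpa using WithTop.coe_le_coe.2 (le_top : (2 : ℕ∞) ≤ ⊤)) (hP hY) (hP hX)
  rw [hD hY, hD hX] at hbr
  rw [← hbr]
  have hB : VectorField.mlieBracket (𝓡 n) X Y p =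
      (mfderiv (𝓡 n) 𝓘(ℝ, EuclideanSpace ℝ (Fin n)) φ p).inverse
        (VectorField.lieBracket ℝ (P X) (P Y) (φ p)) := by
    have h := VectorField.mlieBracketWithin_apply (I := 𝓡 n) (V := X) (W := Y) (s := Set.univ)
      (x₀ := p)
    rw [Set.preimage_univ, Set.univ_inter] at h
    refine h.trans ?_
    congr 1
    have h0 : Set.range (𝓡 n) = Set.univ := ModelWithCorners.range_eq_univ _
    change VectorField.lieBracketWithin ℝ (P X) (P Y) (Set.range (𝓡 n)) (φ p) = _
    rw [h0, VectorField.lieBracketWithin_univ]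
    rfl
  have hφ : MDifferentiableAt (𝓡 n) 𝓘(ℝ, EuclideanSpace ℝ (Fin n)) φ p :=
    mdifferentiableAt_extChartAt (mem_chart_source _ p)
  have hKd : HasMFDerivAt 𝓘(ℝ, EuclideanSpace ℝ (Fin n)) 𝓘(ℝ, F) K (φ p)
      (fderiv ℝ K (φ p)) :=
    (hK.differentiableAt (by simp)).hasFDerivAt.hasMFDerivAt
  have hcomp := hKd.comp p hφ.hasMFDerivAt
  have hev : G =ᶠ[nhds p] K ∘ φ := by
    filter_upwards [extChartAt_source_mem_nhds (I := 𝓡 n) p] with q hq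
    simp only [K, Function.comp_apply]
    rw [PartialEquiv.left_inv φ hq]
  have hdiff := (hcomp.congr_of_eventuallyEq hev).mfderiv
  obtain ⟨L, hL⟩ := isInvertible_mfderiv_extChartAt (I := 𝓡 n) (mem_extChartAt_source (I := 𝓡 n) p)
  rw [hB]
  have h2 := congrArg (fun T => T ((mfderiv (𝓡 n) 𝓘(ℝ, EuclideanSpace ℝ (Fin n)) φ p).inverse
        (VectorField.lieBracket ℝ (P X) (P Y) (φ p)))) hdiff
  refine Eq.trans ?_ h2.symm
  change _ = fderiv ℝ K (φ p) (mfderiv (𝓡 n) 𝓘(ℝ, EuclideanSpace ℝ (Fin n)) φ p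
    (ContinuousLinearMap.inverse _ _))
  congr 1
  rw [← hL, ContinuousLinearMap.inverse_equiv]
  exact (L.apply_symm_apply _).symm

end Calculus

/-! ### The second fundamental form of the embedding by projectors. -/

section Ambient

variable {n m : ℕ} {c : ℝ} {M : Type*} [TopologicalSpace M]
  [ChartedSpace (EuclideanSpace ℝ (Fin n)) M]

/-- Both conditions on the right are real linear in `V`, which gives stability under sums and real
multiples and reduces tangency of a projected derivative to the Hermitian condition. -/
theorem isTangent_iff (hc : c = 1 ∨ c = -1) {q : CQ c m} {V : Mat m} :
    IsTangent q V ↔ IsHerm c V ∧ tangentProj q V = V := by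
  refine ⟨fun hV => ⟨?_, tangentProj_eq_self hc hV⟩, fun h => h.2 ▸ isTangent_tangentProj hc q h.1⟩
  obtain ⟨z, rfl⟩ := Quotient.exists_rep q
  obtain ⟨w, hw, rfl⟩ := hV.exists_lift
  have hvec : ∀ a b v : Fin (m + 1) → ℂ,
      Matrix.mulVec (projMatrix c a b) v = ((c : ℂ) * hermForm c b v) • a := by
    intro a b v
    ext i
    rw [hermForm_eq hc, Matrix.mulVec, dotProduct, Pi.smul_apply, smul_eq_mul, Finset.sum_mul]
    refine Finset.sum_congr rfl fun k _ => ?_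
    simp only [projMatrix, Matrix.of_apply]
    ring
  have hadd : ∀ u v t : Fin (m + 1) → ℂ,
      hermForm c (u + v) t = hermForm c u t + hermForm c v t := fun u v t => by
    rw [hermForm_conj, hermForm_add_right, star_add, ← hermForm_conj, ← hermForm_conj]
  intro a b
  simp only [liftTangent, Matrix.add_mulVec, hvec, hadd, hermForm_add_right, hermForm_smul_left,
    hermForm_smul_right, star_mul', ← hermForm_conj, Complex.star_def, Complex.conj_ofReal]
  ring

theorem IsHerm.add {V W : Mat m} (hV : IsHerm c V) (hW : IsHerm c W) : IsHerm c (V + W) := by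
  intro a b
  have hadd : ∀ u v t : Fin (m + 1) → ℂ,
      hermForm c (u + v) t = hermForm c u t + hermForm c v t := fun u v t => by
    rw [hermForm_conj, hermForm_add_right, star_add, ← hermForm_conj, ← hermForm_conj]
  rw [Matrix.add_mulVec, Matrix.add_mulVec, hadd, hermForm_add_right, hV, hW]

theorem IsHerm.smul {V : Mat m} (r : ℝ) (hV : IsHerm c V) : IsHerm c (r • V) := by
  intro a b
  rw [← Complex.coe_smul, Matrix.smul_mulVec, Matrix.smul_mulVec, hermForm_smul_left,
    hermForm_smul_right, hV]
  simp

theorem IsTangent.add (hc : c = 1 ∨ c = -1) {q : CQ c m} {V W : Mat m} (hV : IsTangent q V)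
    (hW : IsTangent q W) : IsTangent q (V + W) := by
  rw [isTangent_iff hc] at *
  exact ⟨hV.1.add hW.1, by rw [map_add, hV.2, hW.2]⟩

theorem IsTangent.smul (hc : c = 1 ∨ c = -1) {q : CQ c m} {V : Mat m} (r : ℝ)
    (hV : IsTangent q V) : IsTangent q (r • V) := by
  rw [isTangent_iff hc] at *
  exact ⟨hV.1.smul r, by rw [map_smul, hV.2]⟩

/-- The Hermitian condition is the vanishing of a family of real linear maps, and these commute with
the derivative. -/
theorem isHerm_mvfderiv {O : Set M} (hO : IsOpen O) {G : M → Mat m}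
    (hG : ∀ q ∈ O, IsHerm c (G q)) {p : M} (hp : p ∈ O)
    (hGd : MDifferentiableAt (𝓡 n) 𝓘(ℝ, Mat m) G p) (v : TangentSpace (𝓡 n) p) :
    IsHerm c (mvfderiv (𝓡 n) G p v) := by
  intro a b
  have hadd : ∀ u v t : Fin (m + 1) → ℂ,
      hermForm c (u + v) t = hermForm c u t + hermForm c v t := fun u v t => by
    rw [hermForm_conj, hermForm_add_right, star_add, ← hermForm_conj, ← hermForm_conj]
  let L : Mat m →ₗ[ℝ] ℂ :=
    { toFun := fun W => hermForm c (Matrix.mulVec W a) b - hermForm c a (Matrix.mulVec W b)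
      map_add' := fun V W => by
        rw [Matrix.add_mulVec, Matrix.add_mulVec, hadd, hermForm_add_right]
        ring
      map_smul' := fun r W => by
        rw [← Complex.coe_smul, Matrix.smul_mulVec, Matrix.smul_mulVec, hermForm_smul_left,
          hermForm_smul_right]
        simp
        ring }
  have h0 : mvfderiv (𝓡 n) (fun q => L.toContinuousLinearMap (G q)) p = 0 := by
    rw [mvfderiv_congr (H := fun _ => (0 : ℂ)) hO _ hp, mvfderiv_const]
    exact fun q hq => sub_eq_zero.2 (hG q hq a b)
  have h1 := mvfderiv_clm_apply L.toContinuousLinearMap hGd v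
  rw [h0] at h1
  exact sub_eq_zero.1 h1.symm

theorem mdifferentiableAt_of_contMDiffOn {F : Type*} [NormedAddCommGroup F] [NormedSpace ℝ F]
    {O : Set M} (hO : IsOpen O) {G : M → F} (hG : ContMDiffOn (𝓡 n) 𝓘(ℝ, F) ∞ G O) {p : M}
    (hp : p ∈ O) : MDifferentiableAt (𝓡 n) 𝓘(ℝ, F) G p :=
  (hG.contMDiffAt (hO.mem_nhds hp)).mdifferentiableAt (by simp)

theorem mdifferentiableAt_mul {A : Type*} [NormedRing A] [NormedAlgebra ℝ A] {G H : M → A} {p : M}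
    (hG : MDifferentiableAt (𝓡 n) 𝓘(ℝ, A) G p) (hH : MDifferentiableAt (𝓡 n) 𝓘(ℝ, A) H p) :
    MDifferentiableAt (𝓡 n) 𝓘(ℝ, A) (fun q => G q * H q) p :=
  (hG.hasMFDerivAt.mul' hH.hasMFDerivAt).mdifferentiableAt

theorem contMDiffOn_mul {A : Type*} [NormedRing A] [NormedAlgebra ℝ A] {O : Set M} {G H : M → A}
    (hG : ContMDiffOn (𝓡 n) 𝓘(ℝ, A) ∞ G O) (hH : ContMDiffOn (𝓡 n) 𝓘(ℝ, A) ∞ H O) :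
    ContMDiffOn (𝓡 n) 𝓘(ℝ, A) ∞ (fun q => G q * H q) O :=
  ((contDiff_mul (𝕜 := ℝ) (𝔸 := A) (n := ∞)).contMDiff).comp_contMDiffOn (hG.prodMk_space hH)

theorem contMDiffOn_clm {F F' : Type*} [NormedAddCommGroup F] [NormedSpace ℝ F]
    [NormedAddCommGroup F'] [NormedSpace ℝ F'] (L : F →L[ℝ] F') {O : Set M} {G : M → F}
    (hG : ContMDiffOn (𝓡 n) 𝓘(ℝ, F) ∞ G O) :
    ContMDiffOn (𝓡 n) 𝓘(ℝ, F') ∞ (fun q => L (G q)) O :=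
  L.contDiff.contMDiff.comp_contMDiffOn hG

/-- The trace metric as a continuous linear form of the product. -/
def traceCLM (c : ℝ) (m : ℕ) : Mat m →L[ℝ] ℝ :=
  LinearMap.toContinuousLinearMap
    ((c / 2) • Complex.reLm ∘ₗ (Matrix.traceLinearMap (Fin (m + 1)) ℝ ℂ))

theorem traceForm_eq_traceCLM (V W : Mat m) : traceForm c V W = traceCLM c m (V * W) := by
  simp [traceCLM, traceForm]

/-- Multiplication by `i`. -/
def smulICLM (m : ℕ) : Mat m →L[ℝ] Mat m :=
  LinearMap.toContinuousLinearMap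
    { toFun := fun V => Complex.I • V
      map_add' := smul_add _
      map_smul' := fun _ _ => smul_comm _ _ _ }

theorem complexJ_eq_smulICLM (q : CQ c m) (V : Mat m) :
    complexJ q V = smulICLM m (V * embed q - embed q * V) := rfl

theorem contMDiffOn_traceForm {O : Set M} {G H : M → Mat m}
    (hG : ContMDiffOn (𝓡 n) 𝓘(ℝ, Mat m) ∞ G O) (hH : ContMDiffOn (𝓡 n) 𝓘(ℝ, Mat m) ∞ H O) :
    ContMDiffOn (𝓡 n) 𝓘(ℝ, ℝ) ∞ (fun q => traceForm c (G q) (H q)) O := by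
  simp only [traceForm_eq_traceCLM]
  exact contMDiffOn_clm _ (contMDiffOn_mul hG hH)

theorem mvfderiv_traceForm {G H : M → Mat m} {p : M}
    (hG : MDifferentiableAt (𝓡 n) 𝓘(ℝ, Mat m) G p) (hH : MDifferentiableAt (𝓡 n) 𝓘(ℝ, Mat m) H p)
    (v : TangentSpace (𝓡 n) p) :
    mvfderiv (𝓡 n) (fun q => traceForm c (G q) (H q)) p v =
      traceForm c (mvfderiv (𝓡 n) G p v) (H p) + traceForm c (G p) (mvfderiv (𝓡 n) H p v) := by
  simp only [traceForm_eq_traceCLM]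
  rw [mvfderiv_clm_apply _ (mdifferentiableAt_mul hG hH), mvfderiv_mul_apply hG hH, map_add, add_comm]

variable {x : M → CQ c m}

theorem contMDiffOn_complexJ (hx : ContMDiff (𝓡 n) 𝓘(ℝ, Mat m) ∞ (fun p => embed (x p)))
    {O : Set M} {W : M → Mat m} (hW : ContMDiffOn (𝓡 n) 𝓘(ℝ, Mat m) ∞ W O) :
    ContMDiffOn (𝓡 n) 𝓘(ℝ, Mat m) ∞ (fun q => complexJ (x q) (W q)) O := by
  simp only [complexJ_eq_smulICLM]
  exact contMDiffOn_clm _ ((contMDiffOn_mul hW hx.contMDiffOn).sub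
    (contMDiffOn_mul hx.contMDiffOn hW))

/-- A product of tangent vectors commutes with the projector. -/
theorem IsTangent.mul_mul_embed (hc : c = 1 ∨ c = -1) {q : CQ c m} {V W : Mat m}
    (hV : IsTangent q V) (hW : IsTangent q W) : V * W * embed q = embed q * (V * W) := by
  have h1 := hV.mul_add_mul hc
  have h2 := hW.mul_add_mul hc
  have h3 : V * embed q = V - embed q * V := eq_sub_of_add_eq' h1
  have h4 : W * embed q = W - embed q * W := eq_sub_of_add_eq' h2
  rw [mul_assoc, h4, mul_sub, ← mul_assoc V (embed q), h3]
  noncomm_ring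

variable [Bundle.RiemannianBundle (fun p : M => TangentSpace (𝓡 n) p)]

theorem isTangent_diff (hc : c = 1 ∨ c = -1) (hx : IsIsometricImmersion (n := n) x) (p : M)
    (v : TangentSpace (𝓡 n) p) : IsTangent (x p) (diff x p v) := by
  rw [isTangent_iff hc]
  refine ⟨?_, tangentProj_diff hc hx p v⟩
  exact isHerm_mvfderiv isOpen_univ (fun q _ => isHerm_embed hc (x q)) (Set.mem_univ p)
    (hx.smooth.mdifferentiableAt (by simp)) v

/-- The Gauss formula of the embedding of `ℂQ^m(4c)`. -/
theorem mvfderiv_eq_ambientDeriv_add (hc : c = 1 ∨ c = -1) (hx : IsIsometricImmersion (n := n) x)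
    {O : Set M} (hO : IsOpen O) {W : M → Mat m} (hW : ContMDiffOn (𝓡 n) 𝓘(ℝ, Mat m) ∞ W O)
    (hWt : ∀ q ∈ O, IsTangent (x q) (W q)) {p : M} (hp : p ∈ O) (v : TangentSpace (𝓡 n) p) :
    mvfderiv (𝓡 n) W p v = ambientDeriv x W p v
      + (1 - (2 : ℝ) • embed (x p)) * (diff x p v * W p + W p * diff x p v) := by
  have hP : MDifferentiableAt (𝓡 n) 𝓘(ℝ, Mat m) (fun q => embed (x q)) p :=
    hx.smooth.mdifferentiableAt (by simp)
  have hWd := mdifferentiableAt_of_contMDiffOn hO hW hp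
  have h1 : mvfderiv (𝓡 n) W p v = mvfderiv (𝓡 n) (fun q => embed (x q) * W q + W q * embed (x q)) p v :=
    congrArg (fun T => T v) (mvfderiv_congr hO (fun q hq => ((hWt q hq).mul_add_mul hc).symm) hp)
  have h3 : mvfderiv (𝓡 n) W p v = embed (x p) * mvfderiv (𝓡 n) W p v + diff x p v * W p +
      (W p * diff x p v + mvfderiv (𝓡 n) W p v * embed (x p)) := by
    refine h1.trans ?_
    rw [mvfderiv_add_apply (mdifferentiableAt_mul hP hWd) (mdifferentiableAt_mul hWd hP),
      mvfderiv_mul_apply hP hWd, mvfderiv_mul_apply hWd hP]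
    rfl
  have hPP := embed_mul_self hc (x p)
  have ht := isTangent_diff hc hx p v
  have hc1 := ht.mul_mul_embed hc (hWt p hp)
  have hc2 := (hWt p hp).mul_mul_embed hc ht
  simp only [ambientDeriv, LinearMap.comp_apply, ContinuousLinearMap.coe_coe, tangentProj,
    LinearMap.coe_mk, AddHom.coe_mk]
  generalize mvfderiv (𝓡 n) W p v = Q at *
  generalize diff x p v = V at *
  generalize W p = w at *
  generalize embed (x p) = P at *
  -- Sandwiching the derivative of `PW + WP = W` between two copies of `P` determines the `P`-block
  -- of the derivative; `Vw + wV` may be moved past `P` by `IsTangent.mul_mul_embed`.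
  have h4 : P * Q * P = -(P * (V * w + w * V)) := by
    have h5 := congrArg (fun T => P * T * P) h3
    have h6 : P * (P * Q + V * w + (w * V + Q * P)) * P =
        P * P * Q * P + P * (V * w * P) + P * (w * V * P) + P * Q * (P * P) := by noncomm_ring
    simp only [h6, hPP, hc1, hc2, ← mul_assoc] at h5
    simp only [mul_add, ← mul_assoc]
    have h7 : P * Q * P = P * Q * P + (P * V * w + P * w * V + P * Q * P) := by
      refine h5.trans ?_
      abel
    have h8 := left_eq_add.1 h7
    rw [← add_eq_zero_iff_eq_neg, ← h8]
    abel
  rw [h4, sub_mul, one_mul, smul_mul_assoc]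
  nth_rewrite 1 [h3]
  module

end Ambient

/-! ### Gauss and Weingarten formulas, `∇̄J = 0`, and the tensors `A`, `S`, `U`. -/

section

/-- The commutator with `P` sees only the off-diagonal blocks of a matrix and has no others, while
`tangentProj` is the projection onto these blocks. -/
theorem complexJ_tangentProj {m : ℕ} {c : ℝ} (hc : c = 1 ∨ c = -1) (q : CQ c m) (W : Mat m) :
    complexJ q (tangentProj q W) = complexJ q W ∧ tangentProj q (complexJ q W) = complexJ q W := by
  have hP := embed_mul_self hc q
  simp only [complexJ, tangentProj, LinearMap.coe_mk, AddHom.coe_mk, Matrix.mul_smul,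
    Matrix.smul_mul]
  generalize embed q = P at *
  have e1 : P * W * P * P = P * W * P := by rw [mul_assoc, hP]
  have e2 : P * (P * W) = P * W := by rw [← mul_assoc, hP]
  have e3 : W * P * P = W * P := by rw [mul_assoc, hP]
  have e4 : P * (W * P) = P * W * P := (mul_assoc _ _ _).symm
  have e5 : P * (P * W * P) = P * W * P := by rw [← mul_assoc, ← mul_assoc, hP]
  constructor
  · congr 1
    simp only [add_mul, mul_add, sub_mul, mul_sub, smul_mul_assoc, mul_smul_comm, e1, e2, e3, e4, e5]
    abel
  · simp only [mul_sub, sub_mul, e1, e2, e3, e4, smul_sub]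
    module

variable {n m : ℕ} {c : ℝ} {M : Type*} [TopologicalSpace M]
  [ChartedSpace (EuclideanSpace ℝ (Fin n)) M]
  [Bundle.RiemannianBundle (fun p : M => TangentSpace (𝓡 n) p)]

theorem inner_structEndo (x : M → CQ c m) (p : M) (v w : TangentSpace (𝓡 n) p) :
    inner ℝ (structEndo x p v) w = -inner ℝ v (structEndo x p w) := by
  have : ∀ v w : TangentSpace (𝓡 n) p, inner ℝ (structEndo x p v) w =
      traceForm c (complexJ (x p) (diff x p v)) (diff x p w) := fun v w => by
    simp [structEndo, inner_tangentPart]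
  rw [this, real_inner_comm, this, traceForm_complexJ, traceForm_comm]

/-- `x` is an isometric immersion as a real hypersurface with unit normal field `ξ` on the open
set `O`. -/
structure IsHypersurfaceOn (x : M → CQ c m) (ξ : M → Mat m) (O : Set M) : Prop where
  dim : n + 1 = 2 * m
  sign : c = 1 ∨ c = -1
  immersion : IsIsometricImmersion (n := n) x
  isOpen : IsOpen O
  normal : IsUnitNormalOn (n := n) x ξ O

namespace IsHypersurfaceOn

variable {x : M → CQ c m} {ξ : M → Mat m} {O : Set M}
  (h : IsHypersurfaceOn (n := n) x ξ O)

include h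

/-- This separates tangential and normal parts; every structure equation below is obtained by
applying it to one identity in the ambient space. -/
theorem diff_add_smul_eq {p : M} (hp : p ∈ O) {v w : TangentSpace (𝓡 n) p} {r s : ℝ}
    (he : diff x p v + r • ξ p = diff x p w + s • ξ p) : v = w ∧ r = s := by
  constructor
  · refine ext_inner_right ℝ fun u => ?_
    have := congrArg (fun W => traceForm c W (diff x p u)) he
    simpa [h.immersion.isometric, h.normal.normal p hp] using this
  · have := congrArg (fun W => traceForm c W (ξ p)) he
    simpa [traceForm_comm _ (ξ p), h.normal.normal p hp, h.normal.unit p hp] using this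

theorem isTangent_diff (p : M) (v : TangentSpace (𝓡 n) p) : IsTangent (x p) (diff x p v) :=
  ComplexSpaceForm.isTangent_diff h.sign h.immersion p v

theorem traceForm_ambientDeriv (W : M → Mat m) {p : M} {V : Mat m} (hV : IsTangent (x p) V)
    (v : TangentSpace (𝓡 n) p) :
    traceForm c (ambientDeriv x W p v) V = traceForm c (mvfderiv (𝓡 n) W p v) V :=
  traceForm_tangentProj h.sign _ _ _ (tangentProj_eq_self h.sign hV)

theorem isTangent_ambientDeriv {W : M → Mat m} (hW : ContMDiffOn (𝓡 n) 𝓘(ℝ, Mat m) ∞ W O)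
    (hWt : ∀ q ∈ O, IsTangent (x q) (W q)) {p : M} (hp : p ∈ O) (v : TangentSpace (𝓡 n) p) :
    IsTangent (x p) (ambientDeriv x W p v) :=
  isTangent_tangentProj h.sign (x p) (isHerm_mvfderiv h.isOpen
    (fun q hq => ((isTangent_iff h.sign).1 (hWt q hq)).1) hp
    (mdifferentiableAt_of_contMDiffOn h.isOpen hW hp) v)

/-- The decomposition of a tangent vector of `ℂQ^m(4c)` into its components tangent and normal to
the hypersurface. -/
theorem decomp {p : M} (hp : p ∈ O) {W : Mat m} (hW : IsTangent (x p) W) :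
    W = diff x p (tangentPart (n := n) x p W) + traceForm c W (ξ p) • ξ p := by
  have hdim : Module.finrank ℝ (TangentSpace (𝓡 n) p) = n := finrank_euclideanSpace_fin
  let b := (stdOrthonormalBasis ℝ (TangentSpace (𝓡 n) p))
  -- An orthonormal basis of `T_pM` together with `ξ` has `n + 1 = 2m` elements; this is where the
  -- hypersurface condition enters.
  let B : Option (Fin (Module.finrank ℝ (TangentSpace (𝓡 n) p))) → Mat m := fun o =>
    o.elim (ξ p) fun i => diff x p (b i)
  have hn := h.normal.normal p hp
  have hu := h.normal.unit p hp
  have hcard : Fintype.card (Option (Fin (Module.finrank ℝ (TangentSpace (𝓡 n) p)))) = 2 * m := by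
    rw [Fintype.card_option, Fintype.card_fin, hdim, h.dim]
  have hB : ∀ o, IsTangent (x p) (B o) := by
    rintro (_ | i)
    · exact h.normal.tangent p hp
    · exact h.isTangent_diff p _
  have hBo : ∀ i j, traceForm c (B i) (B j) = if i = j then 1 else 0 := by
    rintro (_ | i) (_ | j)
    · simpa [B] using hu
    · simpa [B] using hn _
    · simpa [B, traceForm_comm _ (ξ p)] using hn _
    · simp only [B, Option.elim, h.immersion.isometric, Option.some_inj]
      exact orthonormal_iff_ite.1 b.orthonormal i j
  have h0 := IsTangent.eq_zero_of_orthogonal h.sign hcard hB hBo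
    (W := W + (-1 : ℝ) • (diff x p (tangentPart (n := n) x p W) + traceForm c W (ξ p) • ξ p))
    (hW.add h.sign (((h.isTangent_diff p _).add h.sign
      ((h.normal.tangent p hp).smul h.sign _)).smul h.sign _)) (by
      rintro (_ | i)
      · simp [B, hu, traceForm_comm _ (ξ p), hn]
      · simp [B, hn, h.immersion.isometric, inner_tangentPart])
  rw [neg_smul, one_smul, add_neg_eq_zero] at h0
  exact h0

/-- `∇̄ J = 0`. -/
theorem ambientDeriv_complexJ {W : M → Mat m} (hW : ContMDiffOn (𝓡 n) 𝓘(ℝ, Mat m) ∞ W O)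
    (hWt : ∀ q ∈ O, IsTangent (x q) (W q)) {p : M} (hp : p ∈ O) (v : TangentSpace (𝓡 n) p) :
    ambientDeriv x (fun q => complexJ (x q) (W q)) p v = complexJ (x p) (ambientDeriv x W p v) := by
  have hP : MDifferentiableAt (𝓡 n) 𝓘(ℝ, Mat m) (fun q => embed (x q)) p :=
    h.immersion.smooth.mdifferentiableAt (by simp)
  have hWd := mdifferentiableAt_of_contMDiffOn h.isOpen hW hp
  have h1 : mvfderiv (𝓡 n) (fun q => complexJ (x q) (W q)) p v =
      complexJ (x p) (mvfderiv (𝓡 n) W p v)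
        + Complex.I • (W p * diff x p v - diff x p v * W p) := by
    simp only [complexJ_eq_smulICLM]
    have hd : MDifferentiableAt (𝓡 n) 𝓘(ℝ, Mat m)
        (fun q => W q * embed (x q) - embed (x q) * W q) p :=
      (mdifferentiableAt_mul hWd hP).sub (mdifferentiableAt_mul hP hWd)
    rw [mvfderiv_clm_apply _ hd,
      mvfderiv_sub_apply (mdifferentiableAt_mul hWd hP) (mdifferentiableAt_mul hP hWd),
      mvfderiv_mul_apply hWd hP, mvfderiv_mul_apply hP hWd]
    change Complex.I • (W p * diff x p v + _ - (_ + diff x p v * W p)) = Complex.I • _ + _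
    rw [← smul_add]
    congr 1
    abel
  have ht := h.isTangent_diff p v
  have hc1 := ht.mul_mul_embed h.sign (hWt p hp)
  have hc2 := (hWt p hp).mul_mul_embed h.sign ht
  -- The term from differentiating `P` inside `J` is a commutator of tangent vectors. It commutes
  -- with `P`, hence is block-diagonal and has no tangent component.
  have h2 : tangentProj (x p) (Complex.I • (W p * diff x p v - diff x p v * W p)) = 0 := by
    have hPP := embed_mul_self h.sign (x p)
    simp only [tangentProj, LinearMap.coe_mk, AddHom.coe_mk, Matrix.mul_smul, Matrix.smul_mul,
      mul_sub, sub_mul]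
    generalize diff x p v = V at *
    generalize W p = w at *
    generalize embed (x p) = P at *
    rw [mul_assoc P (w * V), mul_assoc P (V * w), hc1, hc2, ← mul_assoc P P, ← mul_assoc P P, hPP]
    module
  simp only [ambientDeriv, LinearMap.comp_apply, ContinuousLinearMap.coe_coe]
  rw [h1, map_add, h2, add_zero, (complexJ_tangentProj h.sign _ _).1,
    (complexJ_tangentProj h.sign _ _).2]

/-- The Weingarten formula. -/
theorem ambientDeriv_normal {p : M} (hp : p ∈ O) (v : TangentSpace (𝓡 n) p) :
    ambientDeriv x ξ p v = -diff x p (shape x ξ p v) := by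
  have hξd := mdifferentiableAt_of_contMDiffOn h.isOpen h.normal.smooth hp
  -- Since `ξ` has constant length, its derivative has no normal component.
  have h1 : traceForm c (mvfderiv (𝓡 n) ξ p v) (ξ p) = 0 := by
    have h2 := mvfderiv_traceForm (c := c) hξd hξd v
    rw [mvfderiv_congr (H := fun _ => (1 : ℝ)) h.isOpen (fun q hq => h.normal.unit q hq) hp,
      mvfderiv_const, traceForm_comm (ξ p)] at h2
    have h3 : (0 : ℝ) = traceForm c (mvfderiv (𝓡 n) ξ p v) (ξ p)
      + traceForm c (mvfderiv (𝓡 n) ξ p v) (ξ p) := h2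
    linarith
  rw [h.decomp hp (h.isTangent_ambientDeriv h.normal.smooth h.normal.tangent hp v),
    h.traceForm_ambientDeriv _ (h.normal.tangent p hp), h1, zero_smul, add_zero]
  simp [shape]

theorem complexJ_normal {p : M} (hp : p ∈ O) :
    complexJ (x p) (ξ p) = -diff x p (structVec (n := n) x ξ p) := by
  have h1 := h.decomp hp ((h.normal.tangent p hp).complexJ h.sign)
  have h2 : traceForm c (complexJ (x p) (ξ p)) (ξ p) = 0 := by
    have := traceForm_complexJ (c := c) (x p) (ξ p) (ξ p)
    rw [traceForm_comm (ξ p)] at this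
    linarith
  rw [h1, h2, zero_smul, add_zero, structVec]
  simp

/-- The normal component is `⟨Jv, ξ⟩ = -⟨v, Jξ⟩ = ⟨v, U⟩`. -/
theorem complexJ_diff {p : M} (hp : p ∈ O) (v : TangentSpace (𝓡 n) p) :
    complexJ (x p) (diff x p v) =
      diff x p (structEndo x p v) + (inner ℝ v (structVec x ξ p) : ℝ) • ξ p := by
  have h1 := h.decomp hp ((h.isTangent_diff p v).complexJ h.sign)
  rw [traceForm_complexJ, h.complexJ_normal hp, map_neg, neg_neg, h.immersion.isometric] at h1
  exact h1

/-- These are the tangential and normal parts of `J² = -1` on `dx(v)`. -/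
theorem structEndo_structEndo {p : M} (hp : p ∈ O) (v : TangentSpace (𝓡 n) p) :
    structEndo x p (structEndo x p v) =
        -v + (inner ℝ v (structVec x ξ p) : ℝ) • structVec x ξ p ∧
      inner ℝ (structEndo x p v) (structVec x ξ p) = 0 := by
  have h1 := complexJ_complexJ h.sign (h.isTangent_diff p v)
  rw [h.complexJ_diff hp, map_add, map_smul, h.complexJ_diff hp, h.complexJ_normal hp] at h1
  refine h.diff_add_smul_eq hp (r := inner ℝ (structEndo x p v) (structVec x ξ p)) (s := 0) ?_
  rw [map_add, map_neg, map_smul, ← h1]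
  module

theorem structEndo_structVec {p : M} (hp : p ∈ O) : structEndo x p (structVec (n := n) x ξ p) = 0 := by
  refine ext_inner_right ℝ fun w => ?_
  rw [inner_structEndo, real_inner_comm, (h.structEndo_structEndo hp w).2, neg_zero,
    inner_zero_left]

variable [IsManifold (𝓡 n) ∞ M]

theorem contMDiffOn_diff {Y : VField n M} (hY : SmoothOn Y O) :
    ContMDiffOn (𝓡 n) 𝓘(ℝ, Mat m) ∞ (fun q => diff x q (Y q)) O :=
  contMDiffOn_mvfderiv h.isOpen h.immersion.smooth.contMDiffOn hY

/-- Differentiate `⟨ξ, dx(Y)⟩ = 0` and insert the Weingarten formula. -/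
theorem inner_shape {Y : VField n M} (hY : SmoothOn Y O) {p : M} (hp : p ∈ O)
    (v : TangentSpace (𝓡 n) p) :
    inner ℝ (shape x ξ p v) (Y p) =
      traceForm c (mvfderiv (𝓡 n) (fun q => diff x q (Y q)) p v) (ξ p) := by
  have hξd := mdifferentiableAt_of_contMDiffOn h.isOpen h.normal.smooth hp
  have hYd := mdifferentiableAt_of_contMDiffOn h.isOpen (h.contMDiffOn_diff hY) hp
  have h2 := mvfderiv_traceForm (c := c) hξd hYd v
  rw [mvfderiv_congr (H := fun _ => (0 : ℝ)) h.isOpen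
    (fun q hq => h.normal.normal q hq (Y q)) hp, mvfderiv_const] at h2
  have h3 := congrArg (fun W => traceForm c W (diff x p (Y p))) (h.ambientDeriv_normal hp v)
  simp only [h.traceForm_ambientDeriv _ (h.isTangent_diff p _), map_neg, LinearMap.neg_apply,
    h.immersion.isometric] at h3
  rw [traceForm_comm _ (ξ p)]
  have h4 : (0 : ℝ) = _ := h2
  linarith

/-- The Gauss formula. -/
theorem ambientDeriv_diff {Y : VField n M} (hY : SmoothOn Y O) {p : M} (hp : p ∈ O)
    (v : TangentSpace (𝓡 n) p) :
    ambientDeriv x (fun q => diff x q (Y q)) p v =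
      diff x p (covDeriv x Y p v) + (inner ℝ (shape x ξ p v) (Y p) : ℝ) • ξ p := by
  rw [h.decomp hp (h.isTangent_ambientDeriv (h.contMDiffOn_diff hY)
    (fun q _ => h.isTangent_diff q _) hp v), h.traceForm_ambientDeriv _ (h.normal.tangent p hp),
    h.inner_shape hY hp]
  rfl

theorem ambientDeriv_diff_add_smul {Y : VField n M} (hY : SmoothOn Y O) {φ : M → ℝ}
    (hφ : ContMDiffOn (𝓡 n) 𝓘(ℝ, ℝ) ∞ φ O) {p : M} (hp : p ∈ O) (v : TangentSpace (𝓡 n) p) :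
    ambientDeriv x (fun q => diff x q (Y q) + φ q • ξ q) p v =
      diff x p (covDeriv x Y p v - φ p • shape x ξ p v)
        + (inner ℝ (shape x ξ p v) (Y p) + mvfderiv (𝓡 n) φ p v) • ξ p := by
  have hξd := mdifferentiableAt_of_contMDiffOn h.isOpen h.normal.smooth hp
  have hYd := mdifferentiableAt_of_contMDiffOn h.isOpen (h.contMDiffOn_diff hY) hp
  have hφd := mdifferentiableAt_of_contMDiffOn h.isOpen hφ hp
  have h1 : ambientDeriv x (fun q => diff x q (Y q) + φ q • ξ q) p v =
      ambientDeriv x (fun q => diff x q (Y q)) p v + φ p • ambientDeriv x ξ p v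
        + mvfderiv (𝓡 n) φ p v • ξ p := by
    have hφξ : MDifferentiableAt (𝓡 n) 𝓘(ℝ, Mat m) (fun q => φ q • ξ q) p := hφd.smul hξd
    simp only [ambientDeriv, LinearMap.comp_apply, ContinuousLinearMap.coe_coe]
    rw [mvfderiv_add_apply hYd hφξ, mvfderiv_smul_apply hφd hξd, map_add, map_add,
      map_smul, map_smul, tangentProj_eq_self h.sign (h.normal.tangent p hp), add_assoc]
  rw [h1, h.ambientDeriv_diff hY hp, h.ambientDeriv_normal hp, map_sub, map_smul]
  module

/-- The difference is the normal component of `dx([X, Y])`, which is zero. -/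
theorem inner_shape_comm {X Y : VField n M} (hX : SmoothOn X O) (hY : SmoothOn Y O) {p : M}
    (hp : p ∈ O) : inner ℝ (shape x ξ p (X p)) (Y p) = inner ℝ (shape x ξ p (Y p)) (X p) := by
  rw [h.inner_shape hX hp, h.inner_shape hY hp, ← sub_eq_zero, ← LinearMap.sub_apply, ← map_sub]
  have := mvfderiv_mvfderiv_sub h.isOpen h.immersion.smooth.contMDiffOn hX hY hp
  erw [this]
  rw [traceForm_comm]
  exact h.normal.normal p hp _

end IsHypersurfaceOn

end

/-! ### The ambient curvature as a double commutator. -/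

section

variable {n m : ℕ} {c : ℝ} {M : Type*} [TopologicalSpace M]
  [ChartedSpace (EuclideanSpace ℝ (Fin n)) M]

theorem ambientDeriv_congr {x : M → CQ c m} {V W : M → Mat m} {O : Set M} (hO : IsOpen O)
    (hVW : Set.EqOn V W O) {p : M} (hp : p ∈ O) :
    ambientDeriv (n := n) x V p = ambientDeriv x W p := by
  simp only [ambientDeriv, mvfderiv_congr hO hVW hp]

/-- Here `ε` stands for `1 - 2P`, `K` for first derivatives of `W`, `B` for those of the tangent
fields, `Lxy`, `Lyx` for second derivatives of `W` and `L` for its derivative along the bracket. The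
`K` terms are symmetric and cancel, the `B` terms match `T`, and moving `ε` past the tangent vectors
leaves only cubic terms. -/
theorem curvature_algebra {A : Type*} [Ring A] {ε X Y W Kx Ky Bxy Byx T Lxy Lyx L : A}
    (hε : ε * ε = 1) (hX : ε * X = -(X * ε)) (hY : ε * Y = -(Y * ε)) (hW : ε * W = -(W * ε))
    (hB : Bxy - Byx = T)
    (h : (Lxy + ε * (X * Ky + Ky * X) + (ε * (Y * (Kx + ε * (X * W + W * X))
            + (Bxy + ε * (X * Y + Y * X)) * W + (W * (Bxy + ε * (X * Y + Y * X))
            + (Kx + ε * (X * W + W * X)) * Y)) - 2 * X * (Y * W + W * Y)))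
        - (Lyx + ε * (Y * Kx + Kx * Y) + (ε * (X * (Ky + ε * (Y * W + W * Y))
            + (Byx + ε * (Y * X + X * Y)) * W + (W * (Byx + ε * (Y * X + X * Y))
            + (Ky + ε * (Y * W + W * Y)) * X)) - 2 * Y * (X * W + W * X))) =
      L + ε * (T * W + W * T)) :
    Lxy - Lyx - L = (X * Y - Y * X) * W - W * (X * Y - Y * X) := by
  have a : ∀ t, ε * (ε * t) = t := fun t => by rw [← mul_assoc, hε, one_mul]
  have b : ∀ {V : A}, ε * V = -(V * ε) → ∀ t, ε * (V * (ε * t)) = -(V * t) := fun {V} hV t => by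
    rw [← mul_assoc, hV, neg_mul, mul_assoc, a]
  have h1 : ∀ t, ε * (X * (ε * t)) = -(X * t) := b hX
  have h2 : ∀ t, ε * (Y * (ε * t)) = -(Y * t) := b hY
  have h3 : ∀ t, ε * (W * (ε * t)) = -(W * t) := b hW
  rw [← hB] at h
  simp only [mul_add, add_mul, mul_assoc, a, h1, h2, h3, mul_sub, sub_mul, two_mul] at h ⊢
  rw [← sub_eq_zero] at h ⊢
  rw [← h]
  abel

variable [Bundle.RiemannianBundle (fun p : M => TangentSpace (𝓡 n) p)] [IsManifold (𝓡 n) ∞ M]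

/-- A field is the sum of its frame components; this reduces smoothness of fields defined by duality
with the metric to smoothness of functions. -/
theorem IsOrthonormalFrameOn.smoothOn_of_inner {e : Fin n → VField n M} {O : Set M}
    (he : IsOrthonormalFrameOn e O) {X : VField n M}
    (hX : ∀ i, ContMDiffOn (𝓡 n) 𝓘(ℝ, ℝ) ∞ (fun q => (inner ℝ (X q) (e i q) : ℝ)) O) :
    SmoothOn X O := by
  have h1 : SmoothOn (fun q => ∑ i, (inner ℝ (X q) (e i q) : ℝ) • e i q) O :=
    ContMDiffOn.sum_section fun i _ => (hX i).smul_section (he.smooth i)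
  refine h1.congr fun q hq => ?_
  have hd : Fintype.card (Fin n) = Module.finrank ℝ (TangentSpace (𝓡 n) q) := by
    rw [Fintype.card_fin]
    exact finrank_euclideanSpace_fin.symm
  have ho := he.orthonormal q hq
  let b := OrthonormalBasis.mk ho
    (by rw [ho.linearIndependent.span_eq_top_of_card_eq_finrank' hd])
  have h2 := b.sum_repr' (X q)
  simp only [b, OrthonormalBasis.coe_mk] at h2
  simp only [real_inner_comm, h2]

namespace IsHypersurfaceOn

variable {x : M → CQ c m} {ξ : M → Mat m} {O : Set M}
  (h : IsHypersurfaceOn (n := n) x ξ O)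

include h

/-- The curvature tensor of `ℂQ^m(4c)` along the hypersurface. -/
theorem ambientDeriv_ambientDeriv_sub {W : M → Mat m}
    (hW : ContMDiffOn (𝓡 n) 𝓘(ℝ, Mat m) ∞ W O) (hWt : ∀ q ∈ O, IsTangent (x q) (W q))
    {X Y : VField n M} (hX : SmoothOn X O) (hY : SmoothOn Y O) {p : M} (hp : p ∈ O) :
    ambientDeriv x (fun q => ambientDeriv x W q (Y q)) p (X p)
        - ambientDeriv x (fun q => ambientDeriv x W q (X q)) p (Y p)
        - ambientDeriv x W p (nabla x X Y p - nabla x Y X p) =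
      (diff x p (X p) * diff x p (Y p) - diff x p (Y p) * diff x p (X p)) * W p
        - W p * (diff x p (X p) * diff x p (Y p) - diff x p (Y p) * diff x p (X p)) := by
  have hPs := h.immersion.smooth.contMDiffOn (s := O)
  have h2P : ContMDiffOn (𝓡 n) 𝓘(ℝ, Mat m) ∞ (fun q => (2 : ℝ) • embed (x q)) O :=
    contMDiffOn_clm ((2 : ℝ) • ContinuousLinearMap.id ℝ (Mat m)) hPs
  have hεs : ContMDiffOn (𝓡 n) 𝓘(ℝ, Mat m) ∞ (fun q => 1 - (2 : ℝ) • embed (x q)) O :=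
    contMDiffOn_const.sub h2P
  have hεd : ∀ v : TangentSpace (𝓡 n) p, mvfderiv (𝓡 n) (fun q => 1 - (2 : ℝ) • embed (x q)) p v =
      -(2 * diff x p v) := fun v => by
    have hPd := mdifferentiableAt_of_contMDiffOn h.isOpen hPs hp
    have h2 : MDifferentiableAt (𝓡 n) 𝓘(ℝ, ℝ) (fun _ : M => (2 : ℝ)) p := mdifferentiableAt_const
    have h3 : MDifferentiableAt (𝓡 n) 𝓘(ℝ, Mat m) (fun _ : M => (1 : Mat m)) p :=
      mdifferentiableAt_const
    have h4 : MDifferentiableAt (𝓡 n) 𝓘(ℝ, Mat m) (fun q => (2 : ℝ) • embed (x q)) p := h2.smul hPd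
    rw [mvfderiv_sub_apply h3 h4, mvfderiv_smul_apply h2 hPd, mvfderiv_const, mvfderiv_const]
    change (0 : Mat m) - ((2 : ℝ) • diff x p v + (0 : ℝ) • _) = _
    rw [zero_smul, add_zero, zero_sub, two_mul, two_smul]
  -- The Gauss formula of the embedding is applied to `W`, to its covariant derivative and to the
  -- tangent field; the last summand comes from differentiating `1 - 2P`.
  have key : ∀ {X Y : VField n M}, SmoothOn X O → SmoothOn Y O →
      mvfderiv (𝓡 n) (fun q => mvfderiv (𝓡 n) W q (Y q)) p (X p) =
        ambientDeriv x (fun q => ambientDeriv x W q (Y q)) p (X p)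
          + (1 - (2 : ℝ) • embed (x p)) * (diff x p (X p) * ambientDeriv x W p (Y p)
            + ambientDeriv x W p (Y p) * diff x p (X p))
          + ((1 - (2 : ℝ) • embed (x p)) * (diff x p (Y p) *
              (ambientDeriv x W p (X p) + (1 - (2 : ℝ) • embed (x p)) *
                (diff x p (X p) * W p + W p * diff x p (X p)))
            + (ambientDeriv x (fun q => diff x q (Y q)) p (X p) + (1 - (2 : ℝ) • embed (x p)) *
                (diff x p (X p) * diff x p (Y p) + diff x p (Y p) * diff x p (X p))) * W p
            + (W p * (ambientDeriv x (fun q => diff x q (Y q)) p (X p)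
                + (1 - (2 : ℝ) • embed (x p)) *
                (diff x p (X p) * diff x p (Y p) + diff x p (Y p) * diff x p (X p)))
            + (ambientDeriv x W p (X p) + (1 - (2 : ℝ) • embed (x p)) *
                (diff x p (X p) * W p + W p * diff x p (X p))) * diff x p (Y p)))
            - 2 * diff x p (X p) * (diff x p (Y p) * W p + W p * diff x p (Y p))) := by
    intro X Y hX hY
    have hYs := h.contMDiffOn_diff hY
    have hNs : ContMDiffOn (𝓡 n) 𝓘(ℝ, Mat m) ∞
        (fun q => diff x q (Y q) * W q + W q * diff x q (Y q)) O :=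
      (contMDiffOn_mul hYs hW).add (contMDiffOn_mul hW hYs)
    have hEN := contMDiffOn_mul hεs hNs
    have hK : ContMDiffOn (𝓡 n) 𝓘(ℝ, Mat m) ∞ (fun q => ambientDeriv x W q (Y q)) O := by
      refine ((contMDiffOn_mvfderiv h.isOpen hW hY).sub hEN).congr fun q hq => ?_
      rw [eq_sub_iff_add_eq]
      exact (mvfderiv_eq_ambientDeriv_add h.sign h.immersion h.isOpen hW hWt hq (Y q)).symm
    have md := fun {G : M → Mat m} (hG : ContMDiffOn (𝓡 n) 𝓘(ℝ, Mat m) ∞ G O) =>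
      mdifferentiableAt_of_contMDiffOn h.isOpen hG hp
    rw [mvfderiv_congr h.isOpen (fun q hq =>
        mvfderiv_eq_ambientDeriv_add h.sign h.immersion h.isOpen hW hWt hq (Y q)) hp,
      mvfderiv_add_apply (md hK) (md hEN),
      mvfderiv_eq_ambientDeriv_add h.sign h.immersion h.isOpen hK
        (fun q hq => h.isTangent_ambientDeriv hW hWt hq _) hp,
      mvfderiv_mul_apply (md hεs) (md hNs), hεd,
      mvfderiv_add_apply (md (contMDiffOn_mul hYs hW)) (md (contMDiffOn_mul hW hYs)),
      mvfderiv_mul_apply (md hYs) (md hW), mvfderiv_mul_apply (md hW) (md hYs),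
      mvfderiv_eq_ambientDeriv_add h.sign h.immersion h.isOpen hW hWt hp,
      mvfderiv_eq_ambientDeriv_add h.sign h.immersion h.isOpen hYs
        (fun q _ => h.isTangent_diff q _) hp, neg_mul, ← sub_eq_add_neg]
  have hcomm := mvfderiv_mvfderiv_sub h.isOpen hW hX hY hp
  have hbr : nabla x X Y p - nabla x Y X p = VectorField.mlieBracket (𝓡 n) X Y p :=
    covDeriv_torsionFree h.sign h.immersion (hX.mdifferentiableAt h.isOpen hp)
      (hY.mdifferentiableAt h.isOpen hp)
  rw [← hbr, key hX hY, key hY hX,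
    mvfderiv_eq_ambientDeriv_add h.sign h.immersion h.isOpen hW hWt hp] at hcomm
  have hPP := embed_mul_self h.sign (x p)
  have anti : ∀ {V : Mat m}, IsTangent (x p) V →
      (1 - (2 : ℝ) • embed (x p)) * V = -(V * (1 - (2 : ℝ) • embed (x p))) := fun {V} hV => by
    have h1 := hV.mul_add_mul h.sign
    rw [sub_mul, mul_sub, one_mul, mul_one, smul_mul_assoc, mul_smul_comm]
    have h2 : embed (x p) * V = V - V * embed (x p) := eq_sub_of_add_eq h1
    rw [h2]
    module
  refine curvature_algebra (ε := 1 - (2 : ℝ) • embed (x p)) ?_ (anti (h.isTangent_diff p _))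
    (anti (h.isTangent_diff p _)) (anti (hWt p hp)) ?_ hcomm
  · simp only [mul_sub, sub_mul, mul_one, one_mul, smul_mul_assoc, mul_smul_comm, hPP]
    module
  · rw [h.ambientDeriv_diff hY hp, h.ambientDeriv_diff hX hp, h.inner_shape_comm hX hY hp, map_sub]
    simp only [nabla]
    abel

end IsHypersurfaceOn

end

/-! ### Smoothness of the induced tensors and the structure equations. -/

section

variable {n m : ℕ} {c : ℝ} {M : Type*} [TopologicalSpace M]
  [ChartedSpace (EuclideanSpace ℝ (Fin n)) M]
  [Bundle.RiemannianBundle (fun p : M => TangentSpace (𝓡 n) p)] [IsManifold (𝓡 n) ∞ M]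

namespace IsHypersurfaceOn

variable {x : M → CQ c m} {ξ : M → Mat m} {O : Set M}
  (h : IsHypersurfaceOn (n := n) x ξ O) {e : Fin n → VField n M} (he : IsOrthonormalFrameOn e O)

include h

/-- Smoothness of the metric is not an assumption: it follows from smoothness of the immersion, as
the metric is the pullback of the trace form. -/
theorem contMDiffOn_inner {X Y : VField n M} (hX : SmoothOn X O) (hY : SmoothOn Y O) :
    ContMDiffOn (𝓡 n) 𝓘(ℝ, ℝ) ∞ (fun q => (inner ℝ (X q) (Y q) : ℝ)) O := by
  simp only [← h.immersion.isometric]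
  exact contMDiffOn_traceForm (h.contMDiffOn_diff hX) (h.contMDiffOn_diff hY)

include he

theorem smoothOn_tangentPart {W : M → Mat m} (hW : ContMDiffOn (𝓡 n) 𝓘(ℝ, Mat m) ∞ W O) :
    SmoothOn (n := n) (fun q => tangentPart x q (W q)) O := by
  refine he.smoothOn_of_inner fun i => ?_
  simp only [inner_tangentPart]
  exact contMDiffOn_traceForm hW (h.contMDiffOn_diff (he.smooth i))

theorem smoothOn_nabla {X Y : VField n M} (hX : SmoothOn X O) (hY : SmoothOn Y O) :
    SmoothOn (nabla x X Y) O := by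
  refine he.smoothOn_of_inner fun i => ?_
  simp only [nabla, inner_covDeriv h.sign h.immersion]
  exact contMDiffOn_traceForm (contMDiffOn_mvfderiv h.isOpen (h.contMDiffOn_diff hY) hX)
    (h.contMDiffOn_diff (he.smooth i))

theorem smoothOn_shape {X : VField n M} (hX : SmoothOn X O) :
    SmoothOn (fun q => shape x ξ q (X q)) O := by
  refine he.smoothOn_of_inner fun i => ?_
  refine (contMDiffOn_traceForm (c := c) (contMDiffOn_mvfderiv h.isOpen
    (h.contMDiffOn_diff (he.smooth i)) hX) h.normal.smooth).congr fun q hq => ?_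
  rw [h.inner_shape (he.smooth i) hq]

theorem smoothOn_structVec : SmoothOn (n := n) (structVec x ξ) O := by
  refine h.smoothOn_tangentPart he ?_
  exact (contMDiffOn_complexJ h.immersion.smooth h.normal.smooth).neg

theorem smoothOn_structEndo {X : VField n M} (hX : SmoothOn X O) :
    SmoothOn (fun q => structEndo x q (X q)) O :=
  h.smoothOn_tangentPart he (contMDiffOn_complexJ h.immersion.smooth (h.contMDiffOn_diff hX))

omit h in
theorem smoothOn_grad {φ : M → ℝ} (hO : IsOpen O) (hφ : ContMDiffOn (𝓡 n) 𝓘(ℝ, ℝ) ∞ φ O) :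
    SmoothOn (n := n) (grad φ) O := by
  refine he.smoothOn_of_inner fun i => ?_
  simp only [grad, inner_sharp]
  exact contMDiffOn_mvfderiv hO hφ (he.smooth i)

/-- These are the tangential and normal parts of `∇̄(JY) = J ∇̄Y`. The first gives `∇S`; the second,
with metric compatibility, gives `∇U`. -/
theorem covDeriv_structEndo_and {Y : VField n M} (hY : SmoothOn Y O) {p : M} (hp : p ∈ O)
    (v : TangentSpace (𝓡 n) p) :
    covDeriv x (fun q => structEndo x q (Y q)) p v
          - (inner ℝ (Y p) (structVec x ξ p) : ℝ) • shape x ξ p v =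
        structEndo x p (covDeriv x Y p v)
          - (inner ℝ (shape x ξ p v) (Y p) : ℝ) • structVec x ξ p ∧
      inner ℝ (shape x ξ p v) (structEndo x p (Y p))
          + mvfderiv (𝓡 n) (fun q => (inner ℝ (Y q) (structVec x ξ q) : ℝ)) p v =
        inner ℝ (covDeriv x Y p v) (structVec x ξ p) := by
  have h1 := h.ambientDeriv_complexJ (h.contMDiffOn_diff hY) (fun q _ => h.isTangent_diff q _) hp v
  rw [h.ambientDeriv_diff hY hp, map_add, map_smul, h.complexJ_diff hp, h.complexJ_normal hp,
    ambientDeriv_congr h.isOpen (fun q hq => h.complexJ_diff hq (Y q)) hp,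
    h.ambientDeriv_diff_add_smul (h.smoothOn_structEndo he hY)
      (h.contMDiffOn_inner hY (h.smoothOn_structVec he)) hp] at h1
  refine h.diff_add_smul_eq hp (h1.trans ?_)
  rw [map_sub, map_smul]
  module

theorem nabla_structEndo {X Y : VField n M} (hY : SmoothOn Y O) {p : M} (hp : p ∈ O) :
    nabla x X (fun q => structEndo x q (Y q)) p =
      structEndo x p (nabla x X Y p) + (inner ℝ (Y p) (structVec x ξ p) : ℝ) • shape x ξ p (X p)
        - (inner ℝ (shape x ξ p (X p)) (Y p) : ℝ) • structVec x ξ p := by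
  have h1 := (h.covDeriv_structEndo_and he hY hp (X p)).1
  rw [sub_eq_iff_eq_add] at h1
  rw [nabla, h1, nabla]
  abel

theorem nabla_structVec {X : VField n M} {p : M} (hp : p ∈ O) :
    nabla x X (structVec x ξ) p = structEndo x p (shape x ξ p (X p)) := by
  have hi : ∀ i, inner ℝ (e i p) (nabla x X (structVec x ξ) p
      - structEndo x p (shape x ξ p (X p))) = 0 := fun i => by
    have h1 := (h.covDeriv_structEndo_and he (he.smooth i) hp (X p)).2
    rw [covDeriv_metric h.sign h.immersion ((he.smooth i).mdifferentiableAt h.isOpen hp)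
      ((h.smoothOn_structVec he).mdifferentiableAt h.isOpen hp)] at h1
    rw [inner_sub_right, real_inner_comm (structEndo x p _), inner_structEndo, nabla]
    linarith
  have ho := he.orthonormal p hp
  have hd : Fintype.card (Fin n) = Module.finrank ℝ (TangentSpace (𝓡 n) p) := by
    rw [Fintype.card_fin]
    exact finrank_euclideanSpace_fin.symm
  let b := OrthonormalBasis.mk ho
    (by rw [ho.linearIndependent.span_eq_top_of_card_eq_finrank' hd])
  have h2 := b.sum_repr' (nabla x X (structVec x ξ) p - structEndo x p (shape x ξ p (X p)))
  simp only [b, OrthonormalBasis.coe_mk, hi, zero_smul, Finset.sum_const_zero] at h2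
  exact sub_eq_zero.1 h2.symm

/-- Apply the ambient curvature identity to `W = dx(Z)`: the tangential part is Gauss, the normal
part is Codazzi paired with `Z`. -/
theorem gauss_and_codazzi {X Y Z : VField n M} (hX : SmoothOn X O) (hY : SmoothOn Y O)
    (hZ : SmoothOn Z O) {p : M} (hp : p ∈ O) :
    nabla x X (nabla x Y Z) p - nabla x Y (nabla x X Z) p
          - covDeriv x Z p (nabla x X Y p - nabla x Y X p) =
        c • ((inner ℝ (Y p) (Z p) : ℝ) • X p - (inner ℝ (X p) (Z p) : ℝ) • Y p
          + (inner ℝ (structEndo x p (Y p)) (Z p) : ℝ) • structEndo x p (X p)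
          - (inner ℝ (structEndo x p (X p)) (Z p) : ℝ) • structEndo x p (Y p)
          - (2 * inner ℝ (structEndo x p (X p)) (Y p) : ℝ) • structEndo x p (Z p))
        + (inner ℝ (shape x ξ p (Y p)) (Z p) : ℝ) • shape x ξ p (X p)
        - (inner ℝ (shape x ξ p (X p)) (Z p) : ℝ) • shape x ξ p (Y p) ∧
      inner ℝ (nabla x X (fun q => shape x ξ q (Y q)) p - shape x ξ p (nabla x X Y p)
          - (nabla x Y (fun q => shape x ξ q (X q)) p - shape x ξ p (nabla x Y X p))) (Z p) =
        c * inner ℝ ((inner ℝ (X p) (structVec x ξ p) : ℝ) • structEndo x p (Y p)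
          - (inner ℝ (Y p) (structVec x ξ p) : ℝ) • structEndo x p (X p)
          - (2 * inner ℝ (structEndo x p (X p)) (Y p) : ℝ) • structVec x ξ p) (Z p) := by
  have h1 := h.ambientDeriv_ambientDeriv_sub (h.contMDiffOn_diff hZ)
    (fun q _ => h.isTangent_diff q _) hX hY hp
  rw [commutator_commutator h.sign (h.isTangent_diff p _) (h.isTangent_diff p _)
    (h.isTangent_diff p _)] at h1
  have hA := fun {V : VField n M} (hV : SmoothOn V O) => h.smoothOn_shape he hV
  -- The second ambient derivative follows from the Gauss formula, then Gauss and Weingarten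
  -- together, with the normal coefficient differentiated by metric compatibility.
  have hD : ∀ {X Y : VField n M}, SmoothOn X O → SmoothOn Y O →
      ambientDeriv x (fun q => ambientDeriv x (fun q => diff x q (Z q)) q (Y q)) p (X p) =
        diff x p (nabla x X (nabla x Y Z) p
          - (inner ℝ (shape x ξ p (Y p)) (Z p) : ℝ) • shape x ξ p (X p))
        + (inner ℝ (shape x ξ p (X p)) (nabla x Y Z p)
          + (inner ℝ (nabla x X (fun q => shape x ξ q (Y q)) p) (Z p)
            + inner ℝ (shape x ξ p (Y p)) (nabla x X Z p))) • ξ p := by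
    intro X Y hX hY
    rw [ambientDeriv_congr h.isOpen (fun q hq => h.ambientDeriv_diff hZ hq (Y q)) hp]
    have h2 := h.ambientDeriv_diff_add_smul (h.smoothOn_nabla he hY hZ)
      (h.contMDiffOn_inner (hA hY) hZ) hp (X p)
    rw [covDeriv_metric h.sign h.immersion ((hA hY).mdifferentiableAt h.isOpen hp)
      (hZ.mdifferentiableAt h.isOpen hp)] at h2
    exact h2
  have hJ : ∀ v w : TangentSpace (𝓡 n) p, traceForm c (complexJ (x p) (diff x p v)) (diff x p w) =
      inner ℝ (structEndo x p v) w := fun v w => by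
    rw [h.complexJ_diff hp]
    simp [h.immersion.isometric, h.normal.normal p hp]
  rw [hD hX hY, hD hY hX, h.ambientDeriv_diff hZ hp, hJ, hJ, hJ, h.complexJ_diff hp,
    h.complexJ_diff hp, h.complexJ_diff hp, h.immersion.isometric, h.immersion.isometric] at h1
  have h3 := h.diff_add_smul_eq hp (v := nabla x X (nabla x Y Z) p
          - (inner ℝ (shape x ξ p (Y p)) (Z p) : ℝ) • shape x ξ p (X p)
          - (nabla x Y (nabla x X Z) p
            - (inner ℝ (shape x ξ p (X p)) (Z p) : ℝ) • shape x ξ p (Y p))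
          - covDeriv x Z p (nabla x X Y p - nabla x Y X p))
    (w := c • ((inner ℝ (Y p) (Z p) : ℝ) • X p - (inner ℝ (X p) (Z p) : ℝ) • Y p
          + (inner ℝ (structEndo x p (Y p)) (Z p) : ℝ) • structEndo x p (X p)
          - (inner ℝ (structEndo x p (X p)) (Z p) : ℝ) • structEndo x p (Y p)
          - (2 * inner ℝ (structEndo x p (X p)) (Y p) : ℝ) • structEndo x p (Z p)))
    (r := inner ℝ (shape x ξ p (X p)) (nabla x Y Z p)
          + (inner ℝ (nabla x X (fun q => shape x ξ q (Y q)) p) (Z p)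
            + inner ℝ (shape x ξ p (Y p)) (nabla x X Z p))
          - (inner ℝ (shape x ξ p (Y p)) (nabla x X Z p)
          + (inner ℝ (nabla x Y (fun q => shape x ξ q (X q)) p) (Z p)
            + inner ℝ (shape x ξ p (X p)) (nabla x Y Z p)))
          - inner ℝ (shape x ξ p (nabla x X Y p - nabla x Y X p)) (Z p))
    (s := c * (inner ℝ (structEndo x p (Y p)) (Z p) * inner ℝ (X p) (structVec x ξ p)
          - inner ℝ (structEndo x p (X p)) (Z p) * inner ℝ (Y p) (structVec x ξ p)
          - 2 * inner ℝ (structEndo x p (X p)) (Y p) * inner ℝ (Z p) (structVec x ξ p))) (by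
      refine Eq.trans ?_ (h1.trans ?_)
      · simp only [map_sub]
        module
      · simp only [map_sub, map_add, map_smul]
        module)
  constructor
  · linear_combination (norm := module) h3.1
  · have h4 := h3.2
    simp only [inner_sub_left, map_sub, inner_smul_left, RCLike.conj_to_real] at h4 ⊢
    rw [real_inner_comm (structVec x ξ p) (Z p)] at h4
    linarith

end IsHypersurfaceOn

end

/-! ### Functions smooth on `O`, and fields smooth on `O` and zero elsewhere. -/

section Fields

variable {n : ℕ} {M : Type*} [TopologicalSpace M] [ChartedSpace (EuclideanSpace ℝ (Fin n)) M]

/-- The ring of functions that are smooth on `O`. -/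
def smoothFunctions (n : ℕ) {M : Type*} [TopologicalSpace M]
    [ChartedSpace (EuclideanSpace ℝ (Fin n)) M] (O : Set M) : Subring (M → ℝ) where
  carrier := {φ | ContMDiffOn (𝓡 n) 𝓘(ℝ, ℝ) ∞ φ O}
  mul_mem' := contMDiffOn_mul
  one_mem' := contMDiffOn_const
  add_mem' := ContMDiffOn.add
  zero_mem' := contMDiffOn_const
  neg_mem' := ContMDiffOn.neg

theorem smoothFunctions_mdifferentiableAt {O : Set M} (hO : IsOpen O) (φ : smoothFunctions n O) {p : M}
    (hp : p ∈ O) : MDifferentiableAt (𝓡 n) 𝓘(ℝ, ℝ) φ.1 p :=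
  mdifferentiableAt_of_contMDiffOn hO φ.2 hp

variable [IsManifold (𝓡 n) ∞ M]

/-- The module of vector fields that are smooth on `O` and vanish outside `O`. -/
def smoothFields (O : Set M) : Submodule (smoothFunctions n O) (VField n M) where
  carrier := {X | SmoothOn X O ∧ ∀ p ∉ O, X p = 0}
  add_mem' := fun {X Y} hX hY => ⟨hX.1.add_section hY.1, fun p hp => by
    rw [Pi.add_apply, hX.2 p hp, hY.2 p hp, add_zero]⟩
  zero_mem' := ⟨(Bundle.contMDiff_zeroSection ℝ _).contMDiffOn, fun _ _ => rfl⟩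
  smul_mem' := fun φ X hX => ⟨φ.2.smul_section hX.1, fun p hp => by
    change φ.1 p • X p = 0
    rw [hX.2 p hp, smul_zero]⟩

open Classical in
/-- The field equal to `X` on `O` and zero outside `O`. -/
def cutOff {X : VField n M} {O : Set M} (hX : SmoothOn X O) : smoothFields (n := n) O :=
  ⟨O.piecewise X 0, hX.congr fun p hp => by simp only [Set.piecewise_eq_of_mem _ _ _ hp],
    fun p hp => Set.piecewise_eq_of_notMem _ _ _ hp⟩

variable {O : Set M}

theorem cutOff_apply {X : VField n M} (hX : SmoothOn X O) {p : M} (hp : p ∈ O) :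
    (cutOff hX).1 p = X p := by
  classical exact Set.piecewise_eq_of_mem O X 0 hp

/-- The cut-off convention serves this purpose: identities between fields need only be verified on
`O`. -/
theorem smoothFields_ext {X Y : smoothFields (n := n) O} (h : ∀ p ∈ O, X.1 p = Y.1 p) : X = Y := by
  refine Subtype.ext (funext fun p => ?_)
  by_cases hp : p ∈ O
  · exact h p hp
  · rw [X.2.2 p hp, Y.2.2 p hp]

/-- The value at a point of a function of `smoothFunctions n O`. -/
def evalFunction (O : Set M) (p : M) : smoothFunctions n O →+* ℝ :=
  (Pi.evalRingHom _ p).comp (smoothFunctions n O).subtype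

/-- The value at a point of a field of `smoothFields O`. -/
def evalField (O : Set M) (p : M) : smoothFields (n := n) O →+ TangentSpace (𝓡 n) p where
  toFun X := X.1 p
  map_zero' := rfl
  map_add' _ _ := rfl

theorem evalField_smul (p : M) (φ : smoothFunctions n O) (X : smoothFields (n := n) O) :
    evalField O p (φ • X) = evalFunction O p φ • evalField O p X := rfl

theorem evalField_cutOff {X : VField n M} (hX : SmoothOn X O) {p : M} (hp : p ∈ O) :
    evalField O p (cutOff hX) = X p := cutOff_apply hX hp

/-- The derivative of functions along fields. -/
def fieldDeriv (hO : IsOpen O) :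
    smoothFields (n := n) O →ₗ[smoothFunctions n O] smoothFunctions n O →+ smoothFunctions n O where
  toFun X := AddMonoidHom.mk'
    (fun φ => ⟨fun p => mvfderiv (𝓡 n) φ.1 p (X.1 p), contMDiffOn_mvfderiv hO φ.2 X.2.1⟩)
    (fun φ ψ => Subtype.ext (funext fun p => by
      by_cases hp : p ∈ O
      · exact mvfderiv_add_apply (smoothFunctions_mdifferentiableAt hO φ hp)
          (smoothFunctions_mdifferentiableAt hO ψ hp) _
      -- Functions are unrestricted outside `O` and may fail to be differentiable there, but the
      -- direction `X p` is zero.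
      · change mvfderiv (𝓡 n) (φ.1 + ψ.1) p (X.1 p) =
          mvfderiv (𝓡 n) φ.1 p (X.1 p) + mvfderiv (𝓡 n) ψ.1 p (X.1 p)
        simp only [X.2.2 p hp, map_zero, add_zero]))
  map_add' X Y := by
    ext φ p
    exact map_add (mvfderiv (𝓡 n) φ.1 p) (X.1 p) (Y.1 p)
  map_smul' a X := by
    ext φ p
    exact map_smul (mvfderiv (𝓡 n) φ.1 p) (a.1 p) (X.1 p)

end Fields

/-! ### Metric, connection and tensors as operations on the module of fields. -/

section Instantiation

variable {n m : ℕ} {c : ℝ} {M : Type*} [TopologicalSpace M]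
  [ChartedSpace (EuclideanSpace ℝ (Fin n)) M]
  [Bundle.RiemannianBundle (fun p : M => TangentSpace (𝓡 n) p)]

theorem covDeriv_congr {x : M → CQ c m} {O : Set M} (hO : IsOpen O) {Y Y' : VField n M}
    (hY : ∀ q ∈ O, Y q = Y' q) {p : M} (hp : p ∈ O) : covDeriv x Y p = covDeriv x Y' p := by
  rw [covDeriv, covDeriv, ambientDeriv_congr hO (fun q hq => ?_) hp]
  simp only [hY q hq]

variable [IsManifold (𝓡 n) ∞ M]

theorem IsOrthonormalFrameOn.sum_inner_smul {e : Fin n → VField n M} {O : Set M}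
    (he : IsOrthonormalFrameOn e O) {p : M} (hp : p ∈ O) (v : TangentSpace (𝓡 n) p) :
    ∑ i, (inner ℝ v (e i p) : ℝ) • e i p = v := by
  have hd : Fintype.card (Fin n) = Module.finrank ℝ (TangentSpace (𝓡 n) p) := by
    rw [Fintype.card_fin]
    exact finrank_euclideanSpace_fin.symm
  have ho := he.orthonormal p hp
  let b := OrthonormalBasis.mk ho
    (by rw [ho.linearIndependent.span_eq_top_of_card_eq_finrank' hd])
  have h2 := b.sum_repr' v
  simp only [b, OrthonormalBasis.coe_mk] at h2
  exact (Finset.sum_congr rfl fun i _ => by rw [real_inner_comm]).trans h2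

theorem IsOrthonormalFrameOn.trace_eq_sum {e : Fin n → VField n M} {O : Set M}
    (he : IsOrthonormalFrameOn e O) {p : M} (hp : p ∈ O)
    (T : TangentSpace (𝓡 n) p →ₗ[ℝ] TangentSpace (𝓡 n) p) :
    LinearMap.trace ℝ _ T = ∑ i, inner ℝ (T (e i p)) (e i p) := by
  have hd : Fintype.card (Fin n) = Module.finrank ℝ (TangentSpace (𝓡 n) p) := by
    rw [Fintype.card_fin]
    exact finrank_euclideanSpace_fin.symm
  have ho := he.orthonormal p hp
  let b := OrthonormalBasis.mk ho
    (by rw [ho.linearIndependent.span_eq_top_of_card_eq_finrank' hd])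
  rw [LinearMap.trace_eq_sum_inner T b]
  simp only [b, OrthonormalBasis.coe_mk, real_inner_comm]

namespace IsHypersurfaceOn

variable {x : M → CQ c m} {ξ : M → Mat m} {O : Set M}
  (h : IsHypersurfaceOn (n := n) x ξ O) {e : Fin n → VField n M} (he : IsOrthonormalFrameOn e O)

include h

theorem covDeriv_add {Y Z : VField n M} (hY : SmoothOn Y O) (hZ : SmoothOn Z O) {p : M}
    (hp : p ∈ O) (v : TangentSpace (𝓡 n) p) :
    covDeriv x (Y + Z) p v = covDeriv x Y p v + covDeriv x Z p v := by
  have hYd := mdifferentiableAt_of_contMDiffOn h.isOpen (h.contMDiffOn_diff hY) hp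
  have hZd := mdifferentiableAt_of_contMDiffOn h.isOpen (h.contMDiffOn_diff hZ) hp
  simp only [covDeriv, ambientDeriv, LinearMap.comp_apply, ContinuousLinearMap.coe_coe,
    Pi.add_apply, map_add]
  rw [mvfderiv_add_apply hYd hZd, map_add, map_add]

theorem covDeriv_smul {φ : M → ℝ} (hφ : ContMDiffOn (𝓡 n) 𝓘(ℝ, ℝ) ∞ φ O) {Y : VField n M}
    (hY : SmoothOn Y O) {p : M} (hp : p ∈ O) (v : TangentSpace (𝓡 n) p) :
    covDeriv x (fun q => φ q • Y q) p v =
      mvfderiv (𝓡 n) φ p v • Y p + φ p • covDeriv x Y p v := by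
  have hYd := mdifferentiableAt_of_contMDiffOn h.isOpen (h.contMDiffOn_diff hY) hp
  have hφd := mdifferentiableAt_of_contMDiffOn h.isOpen hφ hp
  have h1 : tangentPart x p (diff x p (Y p)) = Y p := by
    refine ext_inner_right ℝ fun w => ?_
    rw [inner_tangentPart, h.immersion.isometric]
  simp only [covDeriv, ambientDeriv, LinearMap.comp_apply, ContinuousLinearMap.coe_coe, map_smul]
  rw [mvfderiv_smul_apply hφd hYd, map_add, map_add, map_smul, map_smul, map_smul, map_smul,
    tangentProj_diff h.sign h.immersion, h1, add_comm]

/-- The metric on fields. -/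
def metricForm : smoothFields (n := n) O →ₗ[smoothFunctions n O]
    smoothFields (n := n) O →ₗ[smoothFunctions n O] smoothFunctions n O :=
  LinearMap.mk₂ _ (fun X Y => ⟨fun p => inner ℝ (X.1 p) (Y.1 p), h.contMDiffOn_inner X.2.1 Y.2.1⟩)
    (fun X Y Z => Subtype.ext (funext fun p => inner_add_left (X.1 p) (Y.1 p) (Z.1 p)))
    (fun a X Y => Subtype.ext (funext fun p => real_inner_smul_left (X.1 p) (Y.1 p) (a.1 p)))
    (fun X Y Z => Subtype.ext (funext fun p => inner_add_right (X.1 p) (Y.1 p) (Z.1 p)))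
    (fun a X Y => Subtype.ext (funext fun p => real_inner_smul_right (X.1 p) (Y.1 p) (a.1 p)))

include he

/-- The Levi-Civita connection on fields. -/
def connection : smoothFields (n := n) O →ₗ[smoothFunctions n O]
    smoothFields (n := n) O →+ smoothFields (n := n) O where
  toFun X := AddMonoidHom.mk'
    (fun Y => ⟨nabla x X.1 Y.1, h.smoothOn_nabla he X.2.1 Y.2.1, fun p hp => by
      rw [nabla, X.2.2 p hp, map_zero]⟩)
    (fun Y Z => smoothFields_ext fun _ hp => h.covDeriv_add Y.2.1 Z.2.1 hp _)
  map_add' X Y := by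
    ext Z p : 3
    exact map_add (covDeriv x Z.1 p) (X.1 p) (Y.1 p)
  map_smul' a X := by
    ext Z p : 3
    exact map_smul (covDeriv x Z.1 p) (a.1 p) (X.1 p)

/-- The shape operator on fields. -/
def shapeField : smoothFields (n := n) O →ₗ[smoothFunctions n O] smoothFields (n := n) O where
  toFun X := ⟨fun p => shape x ξ p (X.1 p), h.smoothOn_shape he X.2.1, fun p hp => by
    simp only [X.2.2 p hp, map_zero]⟩
  map_add' X Y := Subtype.ext (funext fun p => map_add (shape x ξ p) (X.1 p) (Y.1 p))
  map_smul' a X := Subtype.ext (funext fun p => map_smul (shape x ξ p) (a.1 p) (X.1 p))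

/-- The structure endomorphism on fields. -/
def structEndoField : smoothFields (n := n) O →ₗ[smoothFunctions n O] smoothFields (n := n) O where
  toFun X := ⟨fun p => structEndo x p (X.1 p), h.smoothOn_structEndo he X.2.1, fun p hp => by
    simp only [X.2.2 p hp, map_zero]⟩
  map_add' X Y := Subtype.ext (funext fun p => map_add (structEndo x p) (X.1 p) (Y.1 p))
  map_smul' a X := Subtype.ext (funext fun p => map_smul (structEndo x p) (a.1 p) (X.1 p))

/-- The structure vector field, cut off. -/
def structVecField : smoothFields (n := n) O := cutOff (h.smoothOn_structVec he)

end IsHypersurfaceOn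

end Instantiation

/-! ### Verification of the structure equations for the module of fields. -/

section

variable {n m : ℕ} {c : ℝ} {M : Type*} [TopologicalSpace M]
  [ChartedSpace (EuclideanSpace ℝ (Fin n)) M]
  [Bundle.RiemannianBundle (fun p : M => TangentSpace (𝓡 n) p)] [IsManifold (𝓡 n) ∞ M]

namespace IsHypersurfaceOn

variable {x : M → CQ c m} {ξ : M → Mat m} {O : Set M}
  (h : IsHypersurfaceOn (n := n) x ξ O) {e : Fin n → VField n M} (he : IsOrthonormalFrameOn e O)

theorem structVecField_apply {p : M} (hp : p ∈ O) :
    (h.structVecField he).1 p = structVec x ξ p := cutOff_apply _ hp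

theorem evalFunction_metricForm_eq_zero (X Y : smoothFields (n := n) O) {p : M} (hp : p ∉ O) :
    (h.metricForm X Y).1 p = 0 := by
  change inner ℝ (X.1 p) (Y.1 p) = 0
  rw [X.2.2 p hp, inner_zero_left]

include h in
theorem inner_shape_symm (X Y : smoothFields (n := n) O) {p : M} (hp : p ∈ O) :
    inner ℝ (shape x ξ p (X.1 p)) (Y.1 p) = inner ℝ (X.1 p) (shape x ξ p (Y.1 p)) := by
  rw [h.inner_shape_comm X.2.1 Y.2.1 hp, real_inner_comm]

/-- The structure equations of a real hypersurface. -/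
def algebra : HypersurfaceAlgebra (smoothFunctions n O) (smoothFields (n := n) O) (Fin n) where
  c := ⟨fun _ => c, contMDiffOn_const⟩
  D := fieldDeriv h.isOpen
  g := h.metricForm
  conn := h.connection he
  e i := cutOff (he.smooth i)
  A := h.shapeField he
  S := h.structEndoField he
  U := h.structVecField he
  eq_zero_of_two_mul r hr := Subtype.ext (funext fun p => by
    have := congrFun (congrArg Subtype.val hr) p
    change (2 : ℝ) * r.1 p = 0 at this
    change r.1 p = 0
    linarith)
  D_mul X φ ψ := Subtype.ext (funext fun p => by
    by_cases hp : p ∈ O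
    · exact (mvfderiv_mul_apply (smoothFunctions_mdifferentiableAt h.isOpen φ hp)
          (smoothFunctions_mdifferentiableAt h.isOpen ψ hp) _).trans (add_comm _ _)
    · change mvfderiv (𝓡 n) (φ.1 * ψ.1) p (X.1 p) =
        mvfderiv (𝓡 n) φ.1 p (X.1 p) * ψ.1 p + φ.1 p * mvfderiv (𝓡 n) ψ.1 p (X.1 p)
      simp only [X.2.2 p hp, map_zero, zero_mul, mul_zero, add_zero])
  D_c X := Subtype.ext (funext fun p => by
    change mvfderiv (𝓡 n) (fun _ : M => c) p (X.1 p) = 0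
    rw [mvfderiv_const]
    rfl)
  g_symm X Y := Subtype.ext (funext fun p => real_inner_comm (Y.1 p) (X.1 p))
  conn_smul X φ Y := smoothFields_ext fun p hp => h.covDeriv_smul φ.2 Y.2.1 hp (X.1 p)
  D_g X Y Z := Subtype.ext (funext fun p => by
    by_cases hp : p ∈ O
    · exact covDeriv_metric h.sign h.immersion (Y.2.1.mdifferentiableAt h.isOpen hp)
        (Z.2.1.mdifferentiableAt h.isOpen hp) (X.1 p)
    · change mvfderiv (𝓡 n) (fun q => (inner ℝ (Y.1 q) (Z.1 q) : ℝ)) p (X.1 p) =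
        inner ℝ (covDeriv x Y.1 p (X.1 p)) (Z.1 p) + inner ℝ (Y.1 p) (covDeriv x Z.1 p (X.1 p))
      simp only [X.2.2 p hp, map_zero, inner_zero_left, inner_zero_right, add_zero])
  frame X := smoothFields_ext fun p hp => by
    refine (map_sum (evalField O p) _ _).trans (Eq.trans ?_ (he.sum_inner_smul hp (X.1 p)))
    refine Finset.sum_congr rfl fun i _ => ?_
    change (inner ℝ (X.1 p) ((cutOff (he.smooth i)).1 p) : ℝ) • (cutOff (he.smooth i)).1 p = _
    rw [cutOff_apply _ hp]
  D_frame X i j := Subtype.ext (funext fun p => by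
    change mvfderiv (𝓡 n) (fun q => (inner ℝ ((cutOff (he.smooth i)).1 q)
        ((cutOff (he.smooth j)).1 q) : ℝ)) p (X.1 p) = 0
    by_cases hp : p ∈ O
    · rw [mvfderiv_congr (H := fun _ => if i = j then (1 : ℝ) else 0) h.isOpen (fun q hq => ?_) hp,
        mvfderiv_const]
      · rfl
      · simp only [cutOff_apply _ hq]
        exact orthonormal_iff_ite.1 (he.orthonormal q hq) i j
    · rw [X.2.2 p hp, map_zero])
  A_symm X Y := Subtype.ext (funext fun p => by
    by_cases hp : p ∈ O
    · exact h.inner_shape_symm X Y hp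
    · rw [h.evalFunction_metricForm_eq_zero _ _ hp, h.evalFunction_metricForm_eq_zero _ _ hp])
  S_skew X Y := Subtype.ext (funext fun p => inner_structEndo x p (X.1 p) (Y.1 p))
  S_sq X := smoothFields_ext fun p hp => by
    change structEndo x p (structEndo x p (X.1 p)) = -X.1 p +
      (inner ℝ (X.1 p) ((h.structVecField he).1 p) : ℝ) • (h.structVecField he).1 p
    rw [h.structVecField_apply he hp, (h.structEndo_structEndo hp _).1]
  S_U := smoothFields_ext fun p hp => by
    change structEndo x p ((h.structVecField he).1 p) = 0
    rw [h.structVecField_apply he hp, h.structEndo_structVec hp]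
  conn_U X := smoothFields_ext fun p hp => by
    change covDeriv x (h.structVecField he).1 p (X.1 p) = structEndo x p (shape x ξ p (X.1 p))
    rw [covDeriv_congr h.isOpen (fun q hq => h.structVecField_apply he hq) hp]
    exact h.nabla_structVec he hp
  conn_S X Y := smoothFields_ext fun p hp => by
    have h1 := h.nabla_structEndo he (X := X.1) Y.2.1 hp
    rw [← h.structVecField_apply he hp] at h1
    exact h1
  codazzi X Y := smoothFields_ext fun p hp => by
    refine ext_inner_right ℝ fun w => ?_
    -- Codazzi is available only paired with a smooth field, so the vector `w` is extended with
    -- constant coefficients in the frame.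
    let Z : VField n M := fun q => ∑ i, (inner ℝ w (e i p) : ℝ) • e i q
    have hZ : SmoothOn Z O :=
      ContMDiffOn.sum_section fun i _ => contMDiffOn_const.smul_section (he.smooth i)
    have hZp : Z p = w := he.sum_inner_smul hp w
    have h1 := (h.gauss_and_codazzi he X.2.1 Y.2.1 hZ hp).2
    rw [← h.structVecField_apply he hp, hZp, ← real_inner_smul_left] at h1
    exact h1
  gauss X Y Z := smoothFields_ext fun p hp =>
    (h.gauss_and_codazzi he X.2.1 Y.2.1 Z.2.1 hp).1

end IsHypersurfaceOn

end

/-! ### Locality of the operators, and evaluation of the abstract formulas at a point. -/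

section

variable {n m : ℕ} {c : ℝ} {M : Type*} [TopologicalSpace M]
  [ChartedSpace (EuclideanSpace ℝ (Fin n)) M]
  [Bundle.RiemannianBundle (fun p : M => TangentSpace (𝓡 n) p)]

theorem nabla_congr {x : M → CQ c m} {O : Set M} (hO : IsOpen O) {X X' Y Y' : VField n M}
    (hX : ∀ q ∈ O, X q = X' q) (hY : ∀ q ∈ O, Y q = Y' q) :
    ∀ q ∈ O, nabla x X Y q = nabla x X' Y' q := fun q hq => by
  rw [nabla, nabla, covDeriv_congr hO hY hq, hX q hq]

theorem nablaOp_congr {x : M → CQ c m} {O : Set M} (hO : IsOpen O) {Z Z' X X' : VField n M}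
    {B B' : VField n M → VField n M}
    (hB : ∀ {V V' : VField n M}, (∀ q ∈ O, V q = V' q) → ∀ q ∈ O, B V q = B' V' q)
    (hZ : ∀ q ∈ O, Z q = Z' q) (hX : ∀ q ∈ O, X q = X' q) :
    ∀ q ∈ O, nablaOp x Z B X q = nablaOp x Z' B' X' q := fun q hq => by
  simp only [nablaOp, Pi.sub_apply]
  rw [nabla_congr hO hZ (hB hX) q hq, hB (nabla_congr hO hZ hX) q hq]

theorem shapeOp_congr {x : M → CQ c m} {ξ : M → Mat m} {O : Set M} {X X' : VField n M}
    (hX : ∀ q ∈ O, X q = X' q) : ∀ q ∈ O, shapeOp x ξ X q = shapeOp x ξ X' q := fun q hq => by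
  simp only [shapeOp, hX q hq]

theorem laplacianShape_congr {x : M → CQ c m} {ξ : M → Mat m} {O : Set M} (hO : IsOpen O)
    {e e' : Fin n → VField n M} {X X' : VField n M} (he : ∀ i, ∀ q ∈ O, e i q = e' i q)
    (hX : ∀ q ∈ O, X q = X' q) :
    ∀ q ∈ O, laplacianShape x ξ e X q = laplacianShape x ξ e' X' q := fun q hq => by
  simp only [laplacianShape, Finset.sum_apply, Pi.sub_apply]
  refine Finset.sum_congr rfl fun i _ => ?_
  rw [nablaOp_congr hO shapeOp_congr (nabla_congr hO (he i) (he i)) hX q hq,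
    nablaOp_congr hO (nablaOp_congr hO shapeOp_congr (he i)) (he i) hX q hq]

theorem grad_congr {O : Set M} (hO : IsOpen O) {φ ψ : M → ℝ} (hφ : Set.EqOn φ ψ O) :
    ∀ q ∈ O, grad (n := n) φ q = grad ψ q := fun q hq => by
  rw [grad, grad, mvfderiv_congr hO hφ hq]

variable [IsManifold (𝓡 n) ∞ M]

namespace IsHypersurfaceOn

variable {x : M → CQ c m} {ξ : M → Mat m} {O : Set M}
  (h : IsHypersurfaceOn (n := n) x ξ O) {e : Fin n → VField n M} (he : IsOrthonormalFrameOn e O)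

theorem evalField_conn (X Y : smoothFields (n := n) O) (p : M) :
    evalField O p ((h.algebra he).conn X Y) = nabla x X.1 Y.1 p := rfl

theorem evalField_A (X : smoothFields (n := n) O) (p : M) :
    evalField O p ((h.algebra he).A X) = shape x ξ p (evalField O p X) := rfl

theorem evalField_S (X : smoothFields (n := n) O) (p : M) :
    evalField O p ((h.algebra he).S X) = structEndo x p (evalField O p X) := rfl

theorem evalField_U {p : M} (hp : p ∈ O) :
    evalField O p (h.algebra he).U = structVec x ξ p :=
  evalField_cutOff (h.smoothOn_structVec he) hp

theorem evalField_e (i : Fin n) {p : M} (hp : p ∈ O) :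
    evalField O p ((h.algebra he).e i) = e i p :=
  evalField_cutOff (he.smooth i) hp

theorem evalFunction_g (X Y : smoothFields (n := n) O) (p : M) :
    evalFunction O p ((h.algebra he).g X Y) = inner ℝ (evalField O p X) (evalField O p Y) := rfl

theorem evalFunction_c (p : M) : evalFunction O p (h.algebra he).c = c := rfl

/-- At points of `O` the cut-off frame is an orthonormal basis, so the abstract frame sum is the
genuine trace. -/
theorem evalFunction_tr {p : M} (hp : p ∈ O)
    {T : smoothFields (n := n) O →ₗ[smoothFunctions n O] smoothFields (n := n) O}
    {Tp : TangentSpace (𝓡 n) p →ₗ[ℝ] TangentSpace (𝓡 n) p}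
    (hT : ∀ X, evalField O p (T X) = Tp (evalField O p X)) :
    evalFunction O p ((h.algebra he).tr T) = LinearMap.trace ℝ _ Tp := by
  rw [HypersurfaceAlgebra.tr, map_sum, he.trace_eq_sum hp]
  refine Finset.sum_congr rfl fun i _ => ?_
  rw [h.evalFunction_g, hT, h.evalField_e he i hp]

theorem evalFunction_tr_id {p : M} (hp : p ∈ O) :
    evalFunction O p ((h.algebra he).tr LinearMap.id) = n := by
  rw [h.evalFunction_tr he hp (Tp := LinearMap.id) (fun _ => rfl), LinearMap.trace_id]
  exact congrArg _ finrank_euclideanSpace_fin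

theorem evalField_nablaA (X Y : smoothFields (n := n) O) (p : M) :
    evalField O p ((h.algebra he).nablaA X Y) = nablaOp x X.1 (shapeOp x ξ) Y.1 p := rfl

theorem evalField_laplacianA (X : smoothFields (n := n) O) (p : M) :
    evalField O p ((h.algebra he).laplacianA X) =
      laplacianShape x ξ (fun i => ((h.algebra he).e i).1) X.1 p := by
  rw [HypersurfaceAlgebra.laplacianA, map_sum, laplacianShape, Finset.sum_apply]
  rfl

/-- This supplies the gradient hypotheses `hG` and `hG₂` of the abstract formulas, with equality
also outside `O`, where `X` vanishes. -/
theorem g_cutOff_grad (φ : smoothFunctions n O) (X : smoothFields (n := n) O) :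
    (h.algebra he).g (cutOff (smoothOn_grad he h.isOpen φ.2)) X = (h.algebra he).D X φ := by
  refine Subtype.ext (funext fun p => ?_)
  change (inner ℝ ((cutOff (smoothOn_grad he h.isOpen φ.2)).1 p) (X.1 p) : ℝ) =
    mvfderiv (𝓡 n) φ.1 p (X.1 p)
  by_cases hp : p ∈ O
  · rw [cutOff_apply _ hp, grad, inner_sharp]
    rfl
  · rw [X.2.2 p hp, inner_zero_right, map_zero]

theorem evalFunction_tr_A {p : M} (hp : p ∈ O) :
    evalFunction O p ((h.algebra he).tr (h.algebra he).A) =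
      LinearMap.trace ℝ _ (shape (n := n) x ξ p) :=
  h.evalFunction_tr he hp fun X => h.evalField_A he X p

theorem evalFunction_tr_A_sq {p : M} (hp : p ∈ O) :
    evalFunction O p ((h.algebra he).tr ((h.algebra he).A ∘ₗ (h.algebra he).A)) =
      LinearMap.trace ℝ _ (shape (n := n) x ξ p ^ 2) :=
  h.evalFunction_tr he hp fun X => by
    simp only [LinearMap.comp_apply, h.evalField_A, pow_succ, pow_zero, one_mul,
      Module.End.mul_apply]

theorem evalFunction_tr_A_cube {p : M} (hp : p ∈ O) :
    evalFunction O p ((h.algebra he).tr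
        ((h.algebra he).A ∘ₗ (h.algebra he).A ∘ₗ (h.algebra he).A)) =
      LinearMap.trace ℝ _ (shape (n := n) x ξ p ^ 3) :=
  h.evalFunction_tr he hp fun X => by
    simp only [LinearMap.comp_apply, h.evalField_A, pow_succ, pow_zero, one_mul,
      Module.End.mul_apply]

theorem evalFunction_tr_S_A_sq {p : M} (hp : p ∈ O) :
    evalFunction O p ((h.algebra he).tr
        ((h.algebra he).S ∘ₗ (h.algebra he).A ∘ₗ (h.algebra he).S ∘ₗ (h.algebra he).A)) =
      LinearMap.trace ℝ _ ((structEndo x p ∘ₗ shape (n := n) x ξ p) ^ 2) :=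
  h.evalFunction_tr he hp fun X => by
    simp only [LinearMap.comp_apply, h.evalField_A, h.evalField_S, pow_succ, pow_zero, one_mul,
      Module.End.mul_apply]

include h he in
theorem laplacianShape_eq {f f₂ : M → ℝ}
    (hf : ∀ p, f p = LinearMap.trace ℝ _ (shape (n := n) x ξ p))
    (hf₂ : ∀ p, f₂ p = LinearMap.trace ℝ _ (shape (n := n) x ξ p ^ 2))
    {X : VField n M} (hX : SmoothOn X O) {p : M} (hp : p ∈ O) :
    laplacianShape x ξ e X p =
      (3 * c) • ((inner ℝ (shape x ξ p (structVec x ξ p) - f p • structVec x ξ p) (X p) : ℝ)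
            • structVec x ξ p
          + (inner ℝ (structVec x ξ p) (X p) : ℝ) • shape x ξ p (structVec x ξ p))
        - (6 * c) • structEndo x p (shape x ξ p (structEndo x p (X p)))
        + (c * f p) • X p
        + (f₂ p - c * (n + 3)) • shape x ξ p (X p)
        - f p • shape x ξ p (shape x ξ p (X p))
        - nabla x X (grad f) p := by
  have h1 := congrArg (evalField O p)
    ((h.algebra he).laplacianA_eq _ (h.g_cutOff_grad he _) (cutOff hX))
  -- The frame, `X` and the gradient are exchanged for their cut-offs. The function `f` and the
  -- abstract trace of `A` are known to agree only on `O`, which suffices because all operators are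
  -- local.
  rw [laplacianShape_congr h.isOpen (fun i q hq => (h.evalField_e he i hq).symm)
      (fun q hq => (cutOff_apply hX hq).symm) p hp,
    nabla_congr h.isOpen (fun q hq => (cutOff_apply hX hq).symm)
      (fun q hq => ((cutOff_apply (smoothOn_grad he h.isOpen
        ((h.algebra he).tr (h.algebra he).A).2) hq).trans
        (grad_congr h.isOpen (fun q hq => (h.evalFunction_tr_A he hq).trans (hf q).symm)
          q hq)).symm) p hp]
  rw [inner_sub_left]
  simp only [map_add, map_sub, map_mul, evalField_smul, map_ofNat, LinearMap.sub_apply,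
    h.evalFunction_tr_A he hp, h.evalFunction_tr_A_sq he hp, ← hf, ← hf₂,
    h.evalField_laplacianA he, h.evalFunction_c he, h.evalFunction_g he, h.evalField_U he hp,
    h.evalField_A he, h.evalField_S he, h.evalFunction_tr_id he hp, h.evalField_conn he,
    evalField_cutOff hX hp] at h1
  exact h1

include h he in
theorem laplacian_trace_sq_eq {f f₂ f₃ : M → ℝ}
    (hf : ∀ p, f p = LinearMap.trace ℝ _ (shape (n := n) x ξ p))
    (hf₂ : ∀ p, f₂ p = LinearMap.trace ℝ _ (shape (n := n) x ξ p ^ 2))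
    (hf₃ : ∀ p, f₃ p = LinearMap.trace ℝ _ (shape (n := n) x ξ p ^ 3)) {p : M} (hp : p ∈ O) :
    1 / 2 * laplacian (n := n) x f₂ p =
      6 * c * inner ℝ (shape x ξ p (structVec (n := n) x ξ p)) (shape x ξ p (structVec x ξ p))
        - 3 * c * f p * inner ℝ (shape x ξ p (structVec x ξ p)) (structVec (n := n) x ξ p)
        - 6 * c * LinearMap.trace ℝ (TangentSpace (𝓡 n) p) ((structEndo x p ∘ₗ shape x ξ p) ^ 2)
        + c * f p ^ 2
        + (f₂ p - c * (n + 3)) * f₂ p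
        - f p * f₃ p
        - normSqNablaShape x ξ e p
        - ∑ i, hess x f p (shape x ξ p (e i p)) (e i p) := by
  have h1 := congrArg (evalFunction O p)
    ((h.algebra he).laplacian_tr_A_sq _ _ (h.g_cutOff_grad he _) (h.g_cutOff_grad he _))
  have hn : normSqNablaShape x ξ e p = ∑ i, ∑ j, inner ℝ
      (nablaOp x ((h.algebra he).e j).1 (shapeOp x ξ) ((h.algebra he).e i).1 p)
      (nablaOp x ((h.algebra he).e j).1 (shapeOp x ξ) ((h.algebra he).e i).1 p) := by
    refine Finset.sum_congr rfl fun i _ => Finset.sum_congr rfl fun j _ => ?_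
    rw [nablaOp_congr h.isOpen shapeOp_congr (fun q hq => (h.evalField_e he j hq).symm)
      (fun q hq => (h.evalField_e he i hq).symm) p hp]
    rfl
  have hl : laplacian (n := n) x f₂ p = -∑ i, inner ℝ (covDeriv x (cutOff (smoothOn_grad he h.isOpen
        ((h.algebra he).tr ((h.algebra he).A ∘ₗ (h.algebra he).A)).2)).1 p (e i p)) (e i p) := by
    rw [laplacian, he.trace_eq_sum hp, covDeriv_congr h.isOpen (fun q hq =>
      ((cutOff_apply (smoothOn_grad he h.isOpen
        ((h.algebra he).tr ((h.algebra he).A ∘ₗ (h.algebra he).A)).2) hq).trans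
        (grad_congr h.isOpen (fun q hq => (h.evalFunction_tr_A_sq he hq).trans (hf₂ q).symm)
          q hq)).symm) hp]
  have hh : ∀ i, hess x f p (shape x ξ p (e i p)) (e i p) =
      inner ℝ (covDeriv x (cutOff (smoothOn_grad he h.isOpen
        ((h.algebra he).tr (h.algebra he).A).2)).1 p (shape x ξ p (e i p))) (e i p) := fun i => by
    rw [hess, covDeriv_congr h.isOpen (fun q hq =>
      ((cutOff_apply (smoothOn_grad he h.isOpen
        ((h.algebra he).tr (h.algebra he).A).2) hq).trans
        (grad_congr h.isOpen (fun q hq => (h.evalFunction_tr_A he hq).trans (hf q).symm)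
          q hq)).symm) hp]
  have hconn : ∀ X Y : smoothFields (n := n) O, evalField O p ((h.algebra he).conn X Y) =
    covDeriv x Y.1 p (evalField O p X) := fun _ _ => rfl
  simp only [map_add, map_sub, map_mul, map_neg, map_pow, map_sum, map_ofNat,
    h.evalFunction_tr_A he hp, h.evalFunction_tr_A_sq he hp, h.evalFunction_tr_A_cube he hp,
    h.evalFunction_tr_S_A_sq he hp, ← hf, ← hf₂, ← hf₃, h.evalFunction_c he,
    h.evalFunction_g he, h.evalField_U he hp, h.evalField_A he, h.evalField_nablaA he,
    h.evalFunction_tr_id he hp, hconn, h.evalField_e he _ hp] at h1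
  -- The abstract formula computes the full Laplacian of `tr A²`; its factor 2 cancels the `1 / 2`.
  rw [hl, h1, hn, Finset.sum_congr rfl fun i _ => hh i]
  ring

end IsHypersurfaceOn

end

end ComplexSpaceForm

end

/-! ### The two formulas for a real hypersurface. -/

open ComplexSpaceForm in
theorem mainTheorem11 {n m : ℕ} (hn : n + 1 = 2 * m) {c : ℝ} (hc : c = 1 ∨ c = -1)
    {M : Type*} [TopologicalSpace M] [ChartedSpace (EuclideanSpace ℝ (Fin n)) M]
    [IsManifold (𝓡 n) ∞ M] [Bundle.RiemannianBundle (fun p : M => TangentSpace (𝓡 n) p)]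
    (x : M → CQ c m) (hx : IsIsometricImmersion (n := n) x)
    (O : Set M) (hO : IsOpen O)
    (ξ : M → Mat m) (hξ : IsUnitNormalOn (n := n) x ξ O)
    (e : Fin n → VField n M) (he : IsOrthonormalFrameOn e O)
    (A S : ∀ p : M, TangentSpace (𝓡 n) p →ₗ[ℝ] TangentSpace (𝓡 n) p)
    (hA : A = shape x ξ) (hS : S = structEndo x)
    (U : VField n M) (hU : U = structVec x ξ)
    (f f₂ f₃ : M → ℝ) (hf : f = fun p => LinearMap.trace ℝ _ (A p))
    (hf₂ : f₂ = fun p => LinearMap.trace ℝ _ (A p ^ 2))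
    (hf₃ : f₃ = fun p => LinearMap.trace ℝ _ (A p ^ 3)) :
    (∀ X : VField n M, SmoothOn X O → ∀ p ∈ O,
      laplacianShape x ξ e X p =
        (3 * c) • ((inner ℝ (A p (U p) - f p • U p) (X p) : ℝ) • U p
            + (inner ℝ (U p) (X p) : ℝ) • A p (U p))
          - (6 * c) • S p (A p (S p (X p)))
          + (c * f p) • X p
          + (f₂ p - c * (n + 3)) • A p (X p)
          - f p • A p (A p (X p))
          - nabla x X (grad f) p) ∧
    (∀ p ∈ O,
      1 / 2 * laplacian (n := n) x f₂ p =
        6 * c * inner ℝ (A p (U p)) (A p (U p))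
          - 3 * c * f p * inner ℝ (A p (U p)) (U p)
          - 6 * c * LinearMap.trace ℝ (TangentSpace (𝓡 n) p) ((S p ∘ₗ A p) ^ 2)
          + c * f p ^ 2
          + (f₂ p - c * (n + 3)) * f₂ p
          - f p * f₃ p
          - normSqNablaShape x ξ e p
          - ∑ i, hess x f p (A p (e i p)) (e i p)) := by
  subst hA hS hU
  have h : IsHypersurfaceOn (n := n) x ξ O := ⟨hn, hc, hx, hO, hξ⟩
  exact ⟨fun X hX p hp => h.laplacianShape_eq he (fun q => congrFun hf q)
      (fun q => congrFun hf₂ q) hX hp,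
    fun p hp => h.laplacian_trace_sq_eq he (fun q => congrFun hf q) (fun q => congrFun hf₂ q)
      (fun q => congrFun hf₃ q) hp⟩
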